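/- Let $n\ge 2$ and let $c$ be a Coxeter element of the affine symmetric group $\widehat{\mathfrak S}_n$ (a product, in some order, of the simple reflections $((i,i+1))$, $0\le i<n$, each used once). Put $\overline{L_c}=\{i\in\mathbb Z: c(i)>i\}$ and $\overline{R_c}=\{i\in\mathbb Z: c(i)<i\}$. For integers $x_1,\dots,x_k$ pairwise distinct modulo $n$, $((x_1,\dots,x_k))_{[s]}$ denotes the permutation of $\mathbb Z$ with $x_i+pn\mapsto x_{i+1}+pn$ for $i<k$ and $x_k+pn\mapsto x_1+(p+s)n$ for all $p\in\mathbb Z$, which fixes all other integers; the index is omitted when $s=0$. **Annulus.** Mark on an annulus the points $i \bmod n$, in increasing clockwise order, on the outer border if $i\in\overline{L_c}$ and on the inner border if $i\in\overline{R_c}$. Its universal cover is a strip with marked points indexed by $\mathbb Z$. A curved polygon is, up to isotopy relative to the marked points, either a contractible one (a marked point, a curve joining two marked points, or an embedded disk with marked points as corners) or an annular one having marked points as corners on both borders (dangling annular polygons are not allowed). Each isotopy class is represented by its geodesic member for the hyperbolic structure in which the marked points are ideal points. For a curved polygon $E$, $\mathrm{part}(E)$ is the set of the vertex sets $U\subset\mathbb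 Z$ of its lifts to the strip: these are finite for a contractible polygon, and for an annular polygon there is one lift, with $U+n=U$. A $c$-noncrossing partition $P$ of the annulus is a set of pairwise disjoint curved polygons such that each marked point belongs to one of them. Let $\mathrm{perm}(P)$ be the permutation of $\mathbb Z$ that sends each vertex of each lifted polygon to the next one along its boundary, followed with the polygon on the right-hand side. **Arc diagrams.** An arc $(p,q,L,R)$ consists of integers $p<q$ and a partition $L\sqcup R$ of the set of integers strictly between $p$ and $q$ (the points on the left and on the right of the arc). Two distinct arcs $(p,q,L,R)$, $(p',q',L',R')$ cross if $((L\cup\{p,q\})\cap R')\cup(L\cap\{p',q'\})\neq\emptyset$ and $(R\cap(L'\cup\{p',q'\}))\cup(\{p,q\}\cap L')\ne\emptyset$. A cyclic noncrossing arc diagram is a set of arcs invariant under translation by $n$, in which distinct arcs do not cross and have neither the same initial point nor the same final point. A full chain is a finite nonempty sequence of consecutive arcs (the final point of each is the initial point of the next) that cannot be extended at either end; a chain is a full chain or a single point on no arc; a loop is a bi-infinite sequence of consecutive arcs. The support of a chain or loop is the set of its points. The diagram is a cyclic $c$-noncrossing arc diagram if moreover $L\subset\overline{L_c}$ and $R\subset\overline{R_c}$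 for each of its arcs, and no loop has its support contained in $\overline{L_c}$ or in $\overline{R_c}$. **Claim.** For a $c$-noncrossing partition $P$ of the annulus, let $\mathcal A(P)$ be the set of all arcs $(p,q,L,R)$ with $L\subset\overline{L_c}$, $R\subset\overline{R_c}$ such that $p<q$ are consecutive elements of some $U\in\mathrm{part}(E)$, $E\in P$. Then: 1. $P\mapsto\mathcal A(P)$ is a bijection from the set of $c$-noncrossing partitions of the annulus to the set of cyclic $c$-noncrossing arc diagrams. 2. The supports of the chains of $\mathcal A(P)$ are exactly the vertex sets of the lifts of the contractible polygons of $P$, and the supports of the loops of $\mathcal A(P)$ are exactly those of the annular polygons of $P$. 3. $\mathrm{perm}(P)$ is well defined, and the inverse bijection $\mathrm{NC}_c$ is explicit. Given a cyclic $c$-noncrossing arc diagram $\mathcal A$, attach to each chain of support $S$ the elementary divisor $((a_1,\dots,a_k,b_l,\dots,b_1))$ of $c$, where $S\cap\overline{L_c}=\{a_1<\dots<a_k\}$ and $S\cap\overline{R_c}=\{b_1<\dots<b_l\}$, and to each loop of support $S$ the elementary divisor $((a_1,\dots,a_k))_{[1]}((b_l,\dots,b_1))_{[-1]}$, where $S\cap\overline{L_c}\cap[1,n]=\{a_1<\dots<a_k\}$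 and $S\cap\overline{R_c}\cap[1,n]=\{b_1<\dots<b_l\}$. The product of these permutations over a system of representatives of the chains and loops modulo translation by multiples of $n$ exists, depends neither on the representatives nor on the order of the factors, and is an element $\mathrm{NC}_c(\mathcal A)$ of $\widehat{\mathfrak S}_n$; and for every $c$-noncrossing partition $P$ of the annulus, $\mathrm{perm}(P)=\mathrm{NC}_c(\mathcal A)$ if and only if $\mathcal A(P)=\mathcal A$. -/

import Mathlib

noncomputable section

namespace CNC

/-! ### Affine permutations, cycles and Coxeter elements -/

/-- `σ` belongs to the affine symmetric group of order `n`. -/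
def IsAffinePermutation (n : ℕ) (σ : Equiv.Perm ℤ) : Prop :=
  (∀ k : ℤ, σ (k + n) = σ k + n) ∧
    ∑ k ∈ Finset.Icc (1 : ℤ) n, σ k = ∑ k ∈ Finset.Icc (1 : ℤ) n, k

open Classical in
/-- The map that, for a list `x₁, …, x_k` of integers which are pairwise distinct modulo `n`, sends
`x_i + p n` to `x_{i+1} + p n` (`i < k`) and `x_k + p n` to `x₁ + (p + s) n`, for all `p`, and fixes
all other integers. -/
def affineCycleFun (n : ℕ) (l : List ℤ) (s : ℤ) (z : ℤ) : ℤ :=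
  if h : ∃ i : ℕ, i < l.length ∧ l.getD i 0 ≡ z [ZMOD n] then
    z - l.getD (Nat.find h) 0 + l.getD (Nat.find h + 1) (l.getD 0 0 + s * n)
  else z

theorem affineCycleFun_of_modEq {n : ℕ} {l : List ℤ} (s : ℤ)
    (hl : l.Pairwise (fun x y => ¬ x ≡ y [ZMOD n])) {i : ℕ} (hi : i < l.length) {z : ℤ}
    (hz : l.getD i 0 ≡ z [ZMOD n]) :
    affineCycleFun n l s z = z - l.getD i 0 + l.getD (i + 1) (l.getD 0 0 + s * n) := by
  have h : ∃ i : ℕ, i < l.length ∧ l.getD i 0 ≡ z [ZMOD n] := ⟨i, hi, hz⟩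
  classical
  have hf : Nat.find h = i := by
    obtain ⟨h1, h2⟩ := Nat.find_spec h
    rcases lt_trichotomy (Nat.find h) i with hlt | heq | hgt
    · have := List.pairwise_iff_getElem.1 hl (Nat.find h) i h1 hi hlt
      rw [List.getD_eq_getElem _ _ h1] at h2
      rw [List.getD_eq_getElem _ _ hi] at hz
      exact absurd (h2.trans hz.symm) this
    · exact heq
    · exact absurd ⟨hi, hz⟩ (Nat.find_min h hgt)
  unfold affineCycleFun
  rw [dif_pos h]
  have : ∀ (inst : DecidablePred fun i => i < l.length ∧ l.getD i 0 ≡ z [ZMOD n]),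
      @Nat.find _ inst h = i := by
    intro inst
    rw [← hf]
    congr
  rw [this]

theorem affineCycleFun_bijective (n : ℕ) (l : List ℤ) (s : ℤ)
    (hl : l.Pairwise (fun x y => ¬ x ≡ y [ZMOD n])) :
    Function.Bijective (affineCycleFun n l s) := by
  classical
  have uniq : ∀ i j, i < l.length → j < l.length → l.getD i 0 ≡ l.getD j 0 [ZMOD n] → i = j := by
    intro i j hi hj h
    rw [List.getD_eq_getElem _ _ hi, List.getD_eq_getElem _ _ hj] at h
    rcases lt_trichotomy i j with hlt | heq | hgt
    · exact absurd h (List.pairwise_iff_getElem.1 hl i j hi hj hlt)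
    · exact heq
    · exact absurd h.symm (List.pairwise_iff_getElem.1 hl j i hj hi hgt)
  have fixd : ∀ z, (¬ ∃ i : ℕ, i < l.length ∧ l.getD i 0 ≡ z [ZMOD n]) →
      affineCycleFun n l s z = z := by
    intro z hz
    unfold affineCycleFun
    rw [dif_neg hz]
  -- the class of the image
  have img : ∀ i, i < l.length → ∃ j, j < l.length ∧ (j = if i + 1 < l.length then i + 1 else 0) ∧
      l.getD j 0 ≡ l.getD (i + 1) (l.getD 0 0 + s * n) [ZMOD n] := by
    intro i hi
    by_cases h : i + 1 < l.length
    · refine ⟨i + 1, h, by simp [h], ?_⟩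
      rw [List.getD_eq_getElem _ _ h, List.getD_eq_getElem _ _ h]
    · refine ⟨0, by omega, by simp [h], ?_⟩
      rw [List.getD_eq_default l (l.getD 0 0 + s * n) (by omega)]
      exact (Int.modEq_iff_dvd).2 ⟨s, by ring⟩
  have imgz : ∀ i z, i < l.length → l.getD i 0 ≡ z [ZMOD n] → ∃ j, j < l.length ∧
      (j = if i + 1 < l.length then i + 1 else 0) ∧
      l.getD j 0 ≡ affineCycleFun n l s z [ZMOD n] := by
    intro i z hi hz
    obtain ⟨j, hj, hj', hm⟩ := img i hi
    refine ⟨j, hj, hj', ?_⟩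
    rw [affineCycleFun_of_modEq s hl hi hz]
    have h0 : (0 : ℤ) ≡ z - l.getD i 0 [ZMOD n] := by
      have := (hz.sub (Int.ModEq.refl (l.getD i 0)))
      simpa using this
    simpa using h0.add hm
  constructor
  · intro z w hzw
    by_cases hz : ∃ i : ℕ, i < l.length ∧ l.getD i 0 ≡ z [ZMOD n]
    · obtain ⟨i, hi, hiz⟩ := hz
      obtain ⟨j, hj, hj', hjm⟩ := imgz i z hi hiz
      by_cases hw : ∃ i : ℕ, i < l.length ∧ l.getD i 0 ≡ w [ZMOD n]
      · obtain ⟨i', hi', hiw⟩ := hw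
        obtain ⟨k, hk, hk', hkm⟩ := imgz i' w hi' hiw
        rw [← hzw] at hkm
        have hjk := uniq j k hj hk (hjm.trans hkm.symm)
        have hii : i = i' := by
          rw [hj', hk'] at hjk
          split_ifs at hjk <;> omega
        subst hii
        rw [affineCycleFun_of_modEq s hl hi hiz, affineCycleFun_of_modEq s hl hi hiw] at hzw
        linarith
      · rw [fixd w hw] at hzw
        rw [hzw] at hjm
        exact absurd ⟨j, hj, hjm⟩ hw
    · by_cases hw : ∃ i : ℕ, i < l.length ∧ l.getD i 0 ≡ w [ZMOD n]
      · obtain ⟨i', hi', hiw⟩ := hw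
        obtain ⟨k, hk, hk', hkm⟩ := imgz i' w hi' hiw
        rw [← hzw, fixd z hz] at hkm
        exact absurd ⟨k, hk, hkm⟩ hz
      · rwa [fixd z hz, fixd w hw] at hzw
  · intro w
    by_cases hw : ∃ i : ℕ, i < l.length ∧ l.getD i 0 ≡ w [ZMOD n]
    · obtain ⟨j, hj, hjw⟩ := hw
      obtain ⟨i, hi, hij⟩ : ∃ i, i < l.length ∧ j = if i + 1 < l.length then i + 1 else 0 := by
        by_cases h0 : j = 0
        · exact ⟨l.length - 1, by omega, by rw [if_neg (by omega)]; exact h0⟩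
        · exact ⟨j - 1, by omega, by rw [if_pos (by omega)]; omega⟩
      obtain ⟨j', hj', hj'', hm⟩ := img i hi
      have hjj : j = j' := by rw [hij, hj'']
      subst hjj
      have hz : l.getD i 0 ≡ w - l.getD (i + 1) (l.getD 0 0 + s * n) + l.getD i 0 [ZMOD n] := by
        have := ((hjw.symm.trans hm).sub
          (Int.ModEq.refl (l.getD (i + 1) (l.getD 0 0 + s * n)))).add (Int.ModEq.refl (l.getD i 0))
        simpa using this.symm
      refine ⟨w - l.getD (i + 1) (l.getD 0 0 + s * n) + l.getD i 0, ?_⟩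
      rw [affineCycleFun_of_modEq s hl hi hz]
      ring
    · exact ⟨w, fixd w hw⟩

open Classical in
/-- The cycle `((x₁, …, x_k))_[s]` of shift `s`. -/
def affineCycle (n : ℕ) (l : List ℤ) (s : ℤ) : Equiv.Perm ℤ :=
  if h : l.Pairwise (fun x y => ¬ x ≡ y [ZMOD n]) then
    Equiv.ofBijective _ (affineCycleFun_bijective n l s h)
  else 1

/-- A Coxeter element: the product, in some order, of the simple reflections
`((i, i + 1))`, `0 ≤ i < n`, each occurring exactly once. -/
def IsCoxeterElement (n : ℕ) (c : Equiv.Perm ℤ) : Prop :=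
  ∃ π : Equiv.Perm (Fin n),
    c = (List.ofFn fun k : Fin n => affineCycle n [((π k : ℕ) : ℤ), ((π k : ℕ) : ℤ) + 1] 0).prod

/-- The set `L_c + nℤ`. -/
def Lbar (c : Equiv.Perm ℤ) : Set ℤ := {i | i < c i}

/-- The set `R_c + nℤ`. -/
def Rbar (c : Equiv.Perm ℤ) : Set ℤ := {i | c i < i}

/-! ### The marked annulus and its curved polygons -/

/-- The closed strip `ℝ × [-1, 1]`, universal cover of the annulus. -/
abbrev Strip : Type := ℝ × Set.Icc (-1 : ℝ) 1

/-- The annulus `(ℝ / nℤ) × [-1, 1]`; the first coordinate is the (clockwise) angle, the outer border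
is at height `1` and the inner border at height `-1`. -/
abbrev Annulus (n : ℕ) : Type := AddCircle (n : ℝ) × Set.Icc (-1 : ℝ) 1

/-- The covering map. -/
def cover (n : ℕ) (x : Strip) : Annulus n := ((x.1 : AddCircle (n : ℝ)), x.2)

open Classical in
/-- The lift of the marked points: the integer `i` is on the outer border if it belongs to `Lbar c`
and on the inner border otherwise. -/
def vertex (c : Equiv.Perm ℤ) (i : ℤ) : Strip :=
  ((i : ℝ), if i ∈ Lbar c then ⟨1, by norm_num⟩ else ⟨-1, by norm_num⟩)

/-- The marked points of the annulus; `i` and `i + n` give the same point. -/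
def markedPoint (n : ℕ) (c : Equiv.Perm ℤ) (i : ℤ) : Annulus n := cover n (vertex c i)

/-- The homeomorphism from the strip onto the closed unit disk without the points `(-1, 0)` and
`(1, 0)` which conjugates the translations of the strip to the hyperbolic translations (in the
projective model of the hyperbolic plane) with these two fixed points. Through it, the strip and
the annulus get a hyperbolic geometry, for which the marked points are ideal points. -/
def klein (x : Strip) : ℝ × ℝ := (Real.tanh x.1, (x.2 : ℝ) / Real.cosh x.1)

/-- The geodesic polygon of the strip with set of vertices `U`. -/
def lifted (c : Equiv.Perm ℤ) (U : Set ℤ) : Set Strip :=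
  {x | klein x ∈ convexHull ℝ (klein '' (vertex c '' U))}

/-- Its image in the annulus. -/
def polygon (n : ℕ) (c : Equiv.Perm ℤ) (U : Set ℤ) : Set (Annulus n) := cover n '' lifted c U

/-- `U` is the set of vertices of a lift of a contractible curved polygon (a point, a curve joining
two marked points, or a disk with marked points as corners): `U` is finite and nonempty and
its geodesic polygon embeds in the annulus. -/
def IsDiskVertexSet (n : ℕ) (c : Equiv.Perm ℤ) (U : Set ℤ) : Prop :=
  U.Finite ∧ U.Nonempty ∧ Set.InjOn (cover n) (lifted c U)

/-- `U` is the set of vertices of the lift of a (nondangling) annular curved polygon: it is invariant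
under translation by `n` and has vertices on both borders. -/
def IsAnnularVertexSet (n : ℕ) (c : Equiv.Perm ℤ) (U : Set ℤ) : Prop :=
  (∀ i : ℤ, i + n ∈ U ↔ i ∈ U) ∧ (U ∩ Lbar c).Nonempty ∧ (U ∩ Rbar c).Nonempty

/-- The sets of vertices of all the lifts of the curved polygon `E`. -/
def part (n : ℕ) (c : Equiv.Perm ℤ) (E : Set (Annulus n)) : Set (Set ℤ) :=
  {U | (IsDiskVertexSet n c U ∨ IsAnnularVertexSet n c U) ∧ polygon n c U = E}

/-- Curved polygons of the annulus. Every isotopy class, relative to the marked points, of curved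
polygons is represented by its unique geodesic member. -/
def IsCurvedPolygon (n : ℕ) (c : Equiv.Perm ℤ) (E : Set (Annulus n)) : Prop :=
  (part n c E).Nonempty

/-- `c`-noncrossing partitions of the annulus (without dangling annular blocks): sets of pairwise
disjoint curved polygons such that every marked point belongs to one of them. -/
structure IsNoncrossingPartition (n : ℕ) (c : Equiv.Perm ℤ) (P : Set (Set (Annulus n))) : Prop where
  curved : ∀ E ∈ P, IsCurvedPolygon n c E
  disjoint : ∀ E ∈ P, ∀ F ∈ P, E ≠ F → Disjoint E F
  covers : ∀ i : ℤ, ∃ E ∈ P, markedPoint n c i ∈ E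

/-- `C` lies weakly to the right of the oriented line from `A` to `B`. -/
def WeaklyRight (A B C : ℝ × ℝ) : Prop :=
  (B.1 - A.1) * (C.2 - A.2) - (B.2 - A.2) * (C.1 - A.1) ≤ 0

/-- `σ` is the affine permutation `perm(P)` read off the partition `P`: it sends each vertex of each
lifted polygon to the next vertex of this polygon when its boundary is followed with the polygon on
the right-hand side, that is, clockwise for a disk. -/
def IsPermOf (n : ℕ) (c : Equiv.Perm ℤ) (P : Set (Set (Annulus n))) (σ : Equiv.Perm ℤ) : Prop :=
  ∀ E ∈ P, ∀ U ∈ part n c E, ∀ i ∈ U, σ i ∈ U ∧ (σ i = i → U = {i}) ∧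
    ∀ u ∈ U, WeaklyRight (klein (vertex c i)) (klein (vertex c (σ i))) (klein (vertex c u))

/-! ### Cyclic arc diagrams -/

/-- An arc from `p` to `q`; `L` and `R` are the points between `p` and `q` on its left and right. -/
@[ext] structure Arc where
  p : ℤ
  q : ℤ
  L : Set ℤ
  R : Set ℤ
  lt : p < q
  union_eq : L ∪ R = Set.Ioo p q
  disj : Disjoint L R

/-- Translation of an arc by `m`. -/
def Arc.translate (m : ℤ) (α : Arc) : Arc where
  p := α.p + m
  q := α.q + m
  L := {x | x - m ∈ α.L}
  R := {x | x - m ∈ α.R}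
  lt := by have := α.lt; omega
  union_eq := by
    ext x
    have h := Set.ext_iff.1 α.union_eq (x - m)
    simp only [Set.mem_union, Set.mem_Ioo, Set.mem_ofPred_eq] at h ⊢
    rw [h]
    omega
  disj := by
    rw [Set.disjoint_left]
    intro x h1 h2
    exact Set.disjoint_left.1 α.disj h1 h2

/-- The interiors of two arcs cross, or one of them passes on the wrong side of an endpoint of the
other: at some place `β` is on the left of `α`, and at some other place `β` is on the right of `α`. -/
def Arc.Crosses (α β : Arc) : Prop :=
  (((α.L ∪ {α.p, α.q}) ∩ β.R) ∪ (α.L ∩ {β.p, β.q})).Nonempty ∧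
    ((α.R ∩ (β.L ∪ {β.p, β.q})) ∪ ({α.p, α.q} ∩ β.L)).Nonempty

/-- Cyclic noncrossing arc diagrams on `n` points: distinct arcs do not cross, and may have no
common point except the final point of one being the initial point of the other. -/
structure IsCyclicNoncrossing (n : ℕ) (A : Set Arc) : Prop where
  translate_mem : ∀ α : Arc, α.translate n ∈ A ↔ α ∈ A
  noncrossing : ∀ α ∈ A, ∀ β ∈ A, α ≠ β → ¬ α.Crosses β ∧ α.p ≠ β.p ∧ α.q ≠ β.q

/-- Partial chains of arcs. -/
def IsPartialChain (A : Set Arc) (l : List Arc) : Prop :=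
  l ≠ [] ∧ (∀ α ∈ l, α ∈ A) ∧ l.IsChain (fun α β => α.q = β.p)

/-- Full chains of arcs. -/
def IsFullChain (A : Set Arc) (l : List Arc) : Prop :=
  IsPartialChain A l ∧ ∀ β ∈ A, ¬ IsPartialChain A (β :: l) ∧ ¬ IsPartialChain A (l ++ [β])

/-- Loops: bi-infinite sequences of consecutive arcs. -/
def IsLoop (A : Set Arc) (f : ℤ → Arc) : Prop :=
  ∀ i : ℤ, f i ∈ A ∧ (f i).q = (f (i + 1)).p

/-- The set of endpoints of the arcs of a loop. -/
def loopSupp (f : ℤ → Arc) : Set ℤ := {x | ∃ i, x = (f i).p ∨ x = (f i).q}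

/-- `S` is the support of a chain, i.e. of a full chain or of a single point on no arc. -/
def IsChainSupport (A : Set Arc) (S : Set ℤ) : Prop :=
  (∃ l, IsFullChain A l ∧ S = {x | ∃ α ∈ l, x = α.p ∨ x = α.q}) ∨
    ∃ x, (∀ α ∈ A, x ≠ α.p ∧ x ≠ α.q) ∧ S = {x}

/-- `S` is the support of a loop. -/
def IsLoopSupport (A : Set Arc) (S : Set ℤ) : Prop :=
  ∃ f, IsLoop A f ∧ S = loopSupp f

/-- Cyclic `c`-noncrossing arc diagrams. -/
structure IsCyclicCNoncrossing (n : ℕ) (c : Equiv.Perm ℤ) (A : Set Arc) : Prop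
    extends IsCyclicNoncrossing n A where
  left_sub : ∀ α ∈ A, α.L ⊆ Lbar c
  right_sub : ∀ α ∈ A, α.R ⊆ Rbar c
  real_loops : ∀ f, IsLoop A f → ¬ loopSupp f ⊆ Lbar c ∧ ¬ loopSupp f ⊆ Rbar c

/-! ### The construction and its inverse -/

/-- The arcs `p → q` with `p` and `q` consecutive integers of a member of `part(E)`, for all the curved
polygons `E` of `P`. -/
def arcDiagram (n : ℕ) (c : Equiv.Perm ℤ) (P : Set (Set (Annulus n))) : Set Arc :=
  {α | (∃ E ∈ P, ∃ U ∈ part n c E, α.p ∈ U ∧ α.q ∈ U ∧ ∀ u ∈ U, ¬ (α.p < u ∧ u < α.q)) ∧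
    α.L ⊆ Lbar c ∧ α.R ⊆ Rbar c}

open Classical in
/-- The elements of a finite set in increasing order. -/
def increasing (S : Set ℤ) : List ℤ :=
  if h : S.Finite then h.toFinset.sort (· ≤ ·) else []

open Classical in
/-- The elementary divisor of `c` attached to the support `S` of a chain (a finite set) or of
a loop (an infinite set): respectively `((a₁, …, a_k, b_l, …, b₁))` for `S ∩ Lbar = {a₁ < ⋯ < a_k}`
and `S ∩ Rbar = {b₁ < ⋯ < b_l}`, and `((a₁, …, a_k))_[1] ((b_l, …, b₁))_[-1]` for
`S ∩ Lbar ∩ [1, n] = {a₁ < ⋯ < a_k}` and `S ∩ Rbar ∩ [1, n] = {b₁ < ⋯ < b_l}`. -/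
def elementaryDivisor (n : ℕ) (c : Equiv.Perm ℤ) (S : Set ℤ) : Equiv.Perm ℤ :=
  if S.Finite then
    affineCycle n (increasing (S ∩ Lbar c) ++ (increasing (S ∩ Rbar c)).reverse) 0
  else
    affineCycle n (increasing (S ∩ Lbar c ∩ Set.Icc 1 n)) 1 *
      affineCycle n (increasing (S ∩ Rbar c ∩ Set.Icc 1 n)).reverse (-1)

/-- `Γ` lists, in some order and without repetition, the supports of a system of representatives
of the chains and loops of `A` modulo translation by multiples of `n`. -/
def IsNumbering (n : ℕ) (A : Set Arc) (Γ : List (Set ℤ)) : Prop :=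
  Γ.Nodup ∧ (∀ S ∈ Γ, IsChainSupport A S ∨ IsLoopSupport A S) ∧
    ∀ S, IsChainSupport A S ∨ IsLoopSupport A S →
      ∃! T, T ∈ Γ ∧ ∃ k : ℤ, S = (fun x => x + k * n) '' T

/-- `σ` is a product of the elementary divisors attached to the chains and loops of `A`, taken
once modulo translation. -/
def IsNC (n : ℕ) (c : Equiv.Perm ℤ) (A : Set Arc) (σ : Equiv.Perm ℤ) : Prop :=
  ∃ Γ, IsNumbering n A Γ ∧ σ = (Γ.map (elementaryDivisor n c)).prod

end CNC

end

noncomputable section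

namespace CNC

/-! ### The action of cycles and of Coxeter elements -/

/-! Of the Coxeter element only two properties matter: it commutes with the translation by `n` and
it fixes no integer. Hence every integer lies on exactly one border, periodically. The proof passes
from polygons to partitions of `ℤ`, and from these to arcs.

In the Klein disk the marked point `i` is the point of the unit circle with rational parameter `exp
(-i)` (outer border) or `-exp (-i)` (inner border). An affine form vanishing on a chord takes at a
point of the circle a value whose sign depends only on the order of the parameters, so two hulls of
vertices are disjoint exactly when the vertex sets are disjoint and no two chords alternate
(`disjoint_hull_iff`). If the vertex sets are instead drawn as monotone paths passing below outer
and above inner points, alternating chords mean that each path passes above the other somewhere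
(`Alternate.cross`, `Cross.alternate`). Since polygons are determined by their vertex sets up to
translation (`exists_eq_shift_of_polygon_eq`), noncrossing partitions of the annulus amount to
periodic noncrossing partitions of `ℤ` into finite and annular blocks (`IsBlockPartition`).

Such a partition is recovered from its arcs as the set of their connected components. Conversely,
the components of a cyclic noncrossing diagram are noncrossing: two opposite places, brought as
close together as possible, lie on two single arcs that cross (`not_over`). An infinite component is
periodic by the pigeonhole principle; when it meets both borders it would cross its translate by `n`
if it were different from it (`isBlockShape`).

For the permutation, clockwise motion means decreasing parameter, and the elementary divisors list
vertices in exactly this order. Divisors of different translation classes of blocks act on disjoint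
sets, whence the independence of all choices. In the other direction the finite blocks are orbits of
the permutation, and there is at most one infinite block, so the permutation determines the
partition (`eq_of_isPermOfBlocks`). -/

theorem affineCycle_apply_of_modEq {n : ℕ} {l : List ℤ} (s : ℤ)
    (hl : l.Pairwise (fun x y => ¬ x ≡ y [ZMOD n])) {i : ℕ} (hi : i < l.length) {z : ℤ}
    (hz : l.getD i 0 ≡ z [ZMOD n]) :
    affineCycle n l s z = z - l.getD i 0 + l.getD (i + 1) (l.getD 0 0 + s * n) := by
  rw [affineCycle, dif_pos hl]
  exact affineCycleFun_of_modEq s hl hi hz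

theorem affineCycle_apply_of_forall_not_modEq {n : ℕ} {l : List ℤ} (s : ℤ) {z : ℤ}
    (hz : ∀ a ∈ l, ¬ a ≡ z [ZMOD n]) : affineCycle n l s z = z := by
  rw [affineCycle]
  split_ifs with hl
  · change affineCycleFun n l s z = z
    unfold affineCycleFun
    rw [dif_neg]
    rintro ⟨i, hi, h⟩
    rw [List.getD_eq_getElem _ _ hi] at h
    exact hz _ (List.getElem_mem hi) h
  · rfl

theorem modEq_add_mul (n : ℕ) (a k : ℤ) : a ≡ a + k * n [ZMOD n] :=
  Int.modEq_iff_dvd.2 ⟨k, by ring⟩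

theorem modEq_iff_exists_add_mul {n : ℕ} {a b : ℤ} :
    a ≡ b [ZMOD n] ↔ ∃ k : ℤ, b = a + k * n := by
  constructor
  · intro h
    obtain ⟨k, hk⟩ := Int.modEq_iff_dvd.1 h
    exact ⟨k, by linarith⟩
  · rintro ⟨k, rfl⟩
    exact modEq_add_mul n a k

theorem affineCycle_add_mul (n : ℕ) (l : List ℤ) (s z k : ℤ) :
    affineCycle n l s (z + k * n) = affineCycle n l s z + k * n := by
  by_cases hl : l.Pairwise (fun x y => ¬ x ≡ y [ZMOD n])
  · by_cases hz : ∃ i : ℕ, i < l.length ∧ l.getD i 0 ≡ z [ZMOD n]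
    · obtain ⟨i, hi, h⟩ := hz
      rw [affineCycle_apply_of_modEq s hl hi h,
        affineCycle_apply_of_modEq s hl hi (h.trans (modEq_add_mul n z k))]
      ring
    · have key : ∀ a ∈ l, ¬ a ≡ z [ZMOD n] := by
        intro a ha h
        obtain ⟨i, hi, rfl⟩ := List.getElem_of_mem ha
        exact hz ⟨i, hi, by rwa [List.getD_eq_getElem _ _ hi]⟩
      rw [affineCycle_apply_of_forall_not_modEq s key, affineCycle_apply_of_forall_not_modEq s
        fun a ha h => key a ha (h.trans (modEq_add_mul n z k).symm)]
  · rw [affineCycle, dif_neg hl]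
    rfl

theorem not_modEq_add_one {n : ℕ} (hn : 2 ≤ n) (a : ℤ) : ¬ a ≡ a + 1 [ZMOD n] := by
  intro h
  have h1 := Int.modEq_iff_dvd.1 h
  rw [add_sub_cancel_left] at h1
  have := Int.le_of_dvd one_pos h1
  omega

/-- The simple reflection `((a, a + 1))`. -/
def simpleReflection (n : ℕ) (a : ℤ) : Equiv.Perm ℤ := affineCycle n [a, a + 1] 0

theorem simpleReflection_apply_left {n : ℕ} (hn : 2 ≤ n) {a x : ℤ} (h : a ≡ x [ZMOD n]) :
    simpleReflection n a x = x + 1 := by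
  have hl : [a, a + 1].Pairwise (fun x y => ¬ x ≡ y [ZMOD n]) := by
    simpa using not_modEq_add_one hn a
  rw [simpleReflection, affineCycle_apply_of_modEq 0 hl (i := 0) (by simp) (by simpa using h)]
  simp
  ring

theorem simpleReflection_apply_right {n : ℕ} (hn : 2 ≤ n) {a x : ℤ} (h : a ≡ x - 1 [ZMOD n]) :
    simpleReflection n a x = x - 1 := by
  have hl : [a, a + 1].Pairwise (fun x y => ¬ x ≡ y [ZMOD n]) := by
    simpa using not_modEq_add_one hn a
  have h' : a + 1 ≡ x [ZMOD n] := by simpa using h.add_right 1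
  rw [simpleReflection, affineCycle_apply_of_modEq 0 hl (i := 1) (by simp) (by simpa using h')]
  simp
  ring

theorem simpleReflection_apply_of_not {n : ℕ} {a x : ℤ} (h : ¬ a ≡ x [ZMOD n])
    (h' : ¬ a ≡ x - 1 [ZMOD n]) : simpleReflection n a x = x := by
  apply affineCycle_apply_of_forall_not_modEq
  intro b hb
  simp only [List.mem_cons, List.not_mem_nil, or_false] at hb
  rcases hb with rfl | rfl
  · exact h
  · intro h2
    exact h' (by simpa using h2.sub_right 1)

/-- The hypothesis excludes the reflection that could move `x` down. If the first acting factor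
moves `x` up to `x + 1`, it is itself the reflection that could bring the point back, and it does
not occur again; the hypothesis therefore persists. -/
theorem le_prod_simpleReflection {n : ℕ} (hn : 2 ≤ n) (l : List ℤ) :
    l.Pairwise (fun x y => ¬ x ≡ y [ZMOD n]) → ∀ x : ℤ, (∀ a ∈ l, ¬ a ≡ x - 1 [ZMOD n]) →
      x ≤ (l.map (simpleReflection n)).prod x := by
  induction l using List.reverseRecOn with
  | nil => simp
  | append_singleton l a ih =>
    intro hl x hx
    rw [List.pairwise_append] at hl
    obtain ⟨hl1, -, hl2⟩ := hl
    rw [List.map_append, List.prod_append]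
    simp only [List.map_cons, List.map_nil, List.prod_cons, List.prod_nil, mul_one,
      Equiv.Perm.mul_apply]
    by_cases h : a ≡ x [ZMOD n]
    · rw [simpleReflection_apply_left hn h]
      have := ih hl1 (x + 1) fun b hb hbx => hl2 b hb a (by simp) (by
        rw [add_sub_cancel_right] at hbx
        exact hbx.trans h.symm)
      omega
    · rw [simpleReflection_apply_of_not h (hx a (by simp))]
      exact ih hl1 x fun b hb => hx b (by simp [hb])

theorem prod_simpleReflection_le {n : ℕ} (hn : 2 ≤ n) (l : List ℤ) :
    l.Pairwise (fun x y => ¬ x ≡ y [ZMOD n]) → ∀ x : ℤ, (∀ a ∈ l, ¬ a ≡ x [ZMOD n]) →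
      (l.map (simpleReflection n)).prod x ≤ x := by
  induction l using List.reverseRecOn with
  | nil => simp
  | append_singleton l a ih =>
    intro hl x hx
    rw [List.pairwise_append] at hl
    obtain ⟨hl1, -, hl2⟩ := hl
    rw [List.map_append, List.prod_append]
    simp only [List.map_cons, List.map_nil, List.prod_cons, List.prod_nil, mul_one,
      Equiv.Perm.mul_apply]
    by_cases h : a ≡ x - 1 [ZMOD n]
    · rw [simpleReflection_apply_right hn h]
      have := ih hl1 (x - 1) fun b hb hbx => hl2 b hb a (by simp) (hbx.trans h.symm)
      omega
    · rw [simpleReflection_apply_of_not (hx a (by simp)) h]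
      exact ih hl1 x fun b hb => hx b (by simp [hb])

/-- Only the reflections at `x` and at `x - 1` move `x`. Whichever acts first decides the direction,
and the two one-sided bounds prevent a return, since that reflection is used up. -/
theorem prod_simpleReflection_ne {n : ℕ} (hn : 2 ≤ n) (l : List ℤ) :
    l.Pairwise (fun x y => ¬ x ≡ y [ZMOD n]) → ∀ x : ℤ, (∃ a ∈ l, a ≡ x [ZMOD n]) →
      (l.map (simpleReflection n)).prod x ≠ x := by
  induction l using List.reverseRecOn with
  | nil => simp
  | append_singleton l a ih =>
    intro hl x hx
    rw [List.pairwise_append] at hl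
    obtain ⟨hl1, -, hl2⟩ := hl
    rw [List.map_append, List.prod_append]
    simp only [List.map_cons, List.map_nil, List.prod_cons, List.prod_nil, mul_one,
      Equiv.Perm.mul_apply]
    by_cases h : a ≡ x [ZMOD n]
    · rw [simpleReflection_apply_left hn h]
      have := le_prod_simpleReflection hn l hl1 (x + 1) fun b hb hbx => hl2 b hb a (by simp) (by
        rw [add_sub_cancel_right] at hbx
        exact hbx.trans h.symm)
      omega
    · by_cases h' : a ≡ x - 1 [ZMOD n]
      · rw [simpleReflection_apply_right hn h']
        have := prod_simpleReflection_le hn l hl1 (x - 1)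
          fun b hb hbx => hl2 b hb a (by simp) (hbx.trans h'.symm)
        omega
      · rw [simpleReflection_apply_of_not h h']
        apply ih hl1
        obtain ⟨b, hb, hbx⟩ := hx
        rcases List.mem_append.1 hb with hb | hb
        · exact ⟨b, hb, hbx⟩
        · rw [List.mem_singleton] at hb
          exact absurd (hb ▸ hbx) h

/-- `c` commutes with the translation by `n > 0` and has no fixed point. -/
structure IsPeriodicDerangement (n : ℕ) (c : Equiv.Perm ℤ) : Prop where
  pos : 0 < n
  add : ∀ k : ℤ, c (k + n) = c k + n
  ne : ∀ k : ℤ, c k ≠ k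

/-- The only use of the Coxeter hypothesis; all that follows holds for any periodic derangement. -/
theorem IsCoxeterElement.isPeriodicDerangement {n : ℕ} {c : Equiv.Perm ℤ}
    (hc : IsCoxeterElement n c) (hn : 2 ≤ n) : IsPeriodicDerangement n c := by
  obtain ⟨π, rfl⟩ := hc
  set l : List ℤ := List.ofFn fun k : Fin n => ((π k : ℕ) : ℤ) with hldef
  have hprod : (List.ofFn fun k : Fin n => affineCycle n [((π k : ℕ) : ℤ), ((π k : ℕ) : ℤ) + 1] 0) =
      l.map (simpleReflection n) := by
    rw [hldef, List.map_ofFn]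
    rfl
  have hl : l.Pairwise (fun x y => ¬ x ≡ y [ZMOD n]) := by
    rw [List.pairwise_ofFn]
    intro i j hij h
    have h1 : ((π i : ℕ) : ℤ) = ((π j : ℕ) : ℤ) := by
      have hi := (π i).isLt
      have hj := (π j).isLt
      rw [Int.ModEq, Int.emod_eq_of_lt (by omega) (by omega),
        Int.emod_eq_of_lt (by omega) (by omega)] at h
      exact h
    exact hij.ne (π.injective (Fin.ext (by exact_mod_cast h1)))
  rw [hprod]
  refine ⟨by omega, ?_, ?_⟩
  · generalize l = l'
    induction l' with
    | nil => simp
    | cons a l' ih =>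
      intro k
      simp only [List.map_cons, List.prod_cons, Equiv.Perm.mul_apply]
      rw [ih]
      simpa [simpleReflection] using
        affineCycle_add_mul n [a, a + 1] 0 ((l'.map (simpleReflection n)).prod k) 1
  · intro x
    apply prod_simpleReflection_ne hn l hl
    have hpos : (0 : ℤ) < n := by omega
    have h0 := Int.emod_nonneg x hpos.ne'
    have h1 := Int.emod_lt_of_pos x hpos
    have hlt : (x % n).toNat < n := by omega
    refine ⟨x % n, ?_, Int.mod_modEq x n⟩
    rw [hldef, List.mem_ofFn]
    refine ⟨π.symm ⟨(x % n).toNat, hlt⟩, ?_⟩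
    simp [Int.toNat_of_nonneg h0]

namespace IsPeriodicDerangement

variable {n : ℕ} {c : Equiv.Perm ℤ}

theorem mem_Rbar_iff (h : IsPeriodicDerangement n c) {i : ℤ} : i ∈ Rbar c ↔ i ∉ Lbar c := by
  have := h.ne i
  simp only [Rbar, Lbar, Set.mem_ofPred_eq]
  omega

theorem add_mul (h : IsPeriodicDerangement n c) (i k : ℤ) : c (i + k * n) = c i + k * n := by
  induction k using Int.induction_on with
  | zero => simp
  | succ k ih =>
    rw [show i + (k + 1 : ℤ) * n = i + k * n + n by ring, h.add, ih]
    ring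
  | pred k ih =>
    have := h.add (i + (-k - 1 : ℤ) * n)
    rw [show i + (-k - 1 : ℤ) * n + n = i + -k * n by ring, ih] at this
    linarith

theorem add_mul_mem_Lbar (h : IsPeriodicDerangement n c) {i k : ℤ} : i + k * n ∈ Lbar c ↔ i ∈ Lbar c := by
  simp only [Lbar, Set.mem_ofPred_eq, h.add_mul]
  omega

theorem add_mul_mem_Rbar (h : IsPeriodicDerangement n c) {i k : ℤ} : i + k * n ∈ Rbar c ↔ i ∈ Rbar c := by
  simp only [Rbar, Set.mem_ofPred_eq, h.add_mul]
  omega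

end IsPeriodicDerangement

/-! ### Points of the circle and their chords -/

/-- The rational parametrization of the unit circle. -/
def circ (t : ℝ) : ℝ × ℝ := ((1 - t ^ 2) / (1 + t ^ 2), 2 * t / (1 + t ^ 2))

open Classical in
/-- The parameter of the marked point `i` on the circle. -/
def param (c : Equiv.Perm ℤ) (i : ℤ) : ℝ :=
  if i ∈ Lbar c then Real.exp (-i) else -Real.exp (-i)

/-- With `t = exp (-i)`, `tanh i = (1 - t ^ 2) / (1 + t ^ 2)` and `1 / cosh i = 2 * t / (1 + t ^
2)`; the inner border changes the sign of `t`. -/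
theorem klein_vertex (c : Equiv.Perm ℤ) (i : ℤ) : klein (vertex c i) = circ (param c i) := by
  have h1 : Real.exp (i : ℝ) ≠ 0 := (Real.exp_pos _).ne'
  have h2 : Real.exp (i : ℝ) ^ 2 + 1 ≠ 0 := by positivity
  by_cases h : i ∈ Lbar c <;>
    simp only [klein, vertex, circ, param, h, if_true, if_false, Real.tanh_eq, Real.cosh_eq,
      Real.exp_neg] <;>
    refine Prod.ext ?_ ?_ <;> field_simp

/-- The parameter cuts the circle open at `(-1, 0)`: counterclockwise one meets the inner points
from left to right, then the outer points from right to left. Every geometric question below is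
reduced to this linear order. -/
theorem param_lt_param_iff {c : Equiv.Perm ℤ} {i j : ℤ} : param c i < param c j ↔
    (i ∉ Lbar c ∧ j ∈ Lbar c) ∨ (i ∈ Lbar c ∧ j ∈ Lbar c ∧ j < i) ∨
      (i ∉ Lbar c ∧ j ∉ Lbar c ∧ i < j) := by
  have hi := Real.exp_pos (-(i : ℝ))
  have hj := Real.exp_pos (-(j : ℝ))
  by_cases h : i ∈ Lbar c <;> by_cases h' : j ∈ Lbar c <;> simp [param, h, h']
  · linarith
  · linarith

theorem param_injective (c : Equiv.Perm ℤ) : Function.Injective (param c) := by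
  intro i j h
  have h1 : ¬ param c i < param c j := h.not_lt
  have h2 : ¬ param c j < param c i := h.not_gt
  rw [param_lt_param_iff] at h1 h2
  by_cases hi : i ∈ Lbar c <;> by_cases hj : j ∈ Lbar c <;> simp [hi, hj] at h1 h2 <;> omega

theorem param_add_mul {n : ℕ} {c : Equiv.Perm ℤ} (hc : IsPeriodicDerangement n c) (i k : ℤ) :
    param c (i + k * n) = Real.exp (-(k * n)) * param c i := by
  have : Real.exp (-((i + k * n : ℤ) : ℝ)) = Real.exp (-(k * n)) * Real.exp (-i) := by
    rw [← Real.exp_add]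
    push_cast
    ring_nf
  by_cases h : i ∈ Lbar c
  · rw [param, param, if_pos h, if_pos (hc.add_mul_mem_Lbar.2 h), this]
  · rw [param, param, if_neg h, if_neg fun h' => h (hc.add_mul_mem_Lbar.1 h'), this, mul_neg]

/-- An affine form vanishing on the chord from `circ a` to `circ b`. -/
def chord (a b : ℝ) (Q : ℝ × ℝ) : ℝ := 1 - Q.1 - (a + b) * Q.2 + a * b * (1 + Q.1)

/-- The factorization turns the position of a point of the circle relative to a chord into the sign
of `(u - a) * (u - b)`; convexity then extends a common sign from the vertices to their hull. -/
theorem chord_circ (a b u : ℝ) : chord a b (circ u) = (u - a) * (u - b) * (2 / (1 + u ^ 2)) := by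
  have : 1 + u ^ 2 ≠ 0 := by positivity
  simp only [chord, circ]
  field_simp
  ring

theorem convex_chord_preimage (a b : ℝ) {S : Set ℝ} (hS : Convex ℝ S) :
    Convex ℝ (chord a b ⁻¹' S) := by
  intro P hP Q hQ x y hx hy hxy
  have := hS hP hQ hx hy hxy
  have e : chord a b (x • P + y • Q) = x • chord a b P + y • chord a b Q := by
    obtain rfl : y = 1 - x := by linarith
    simp only [chord, Prod.fst_add, Prod.snd_add, Prod.smul_fst, Prod.smul_snd, smul_eq_mul]
    ring
  rwa [Set.mem_preimage, e]

/-- The convex hull of the marked points of `U`. -/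
def hull (c : Equiv.Perm ℤ) (U : Set ℤ) : Set (ℝ × ℝ) :=
  convexHull ℝ (klein '' (vertex c '' U))

theorem hull_eq (c : Equiv.Perm ℤ) (U : Set ℤ) :
    hull c U = convexHull ℝ ((fun i => circ (param c i)) '' U) := by
  rw [hull, Set.image_image]
  simp only [klein_vertex]

theorem hull_subset {c : Equiv.Perm ℤ} {U : Set ℤ} {C : Set (ℝ × ℝ)} (hC : Convex ℝ C)
    (h : ∀ u ∈ U, circ (param c u) ∈ C) : hull c U ⊆ C := by
  rw [hull_eq]
  apply convexHull_min _ hC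
  rintro _ ⟨u, hu, rfl⟩
  exact h u hu

theorem circ_mem_hull {c : Equiv.Perm ℤ} {U : Set ℤ} {i : ℤ} (hi : i ∈ U) :
    circ (param c i) ∈ hull c U := by
  rw [hull_eq]
  exact subset_convexHull _ _ ⟨i, hi, rfl⟩

theorem segment_subset_hull {c : Equiv.Perm ℤ} {U : Set ℤ} {i j : ℤ} (hi : i ∈ U) (hj : j ∈ U) :
    segment ℝ (circ (param c i)) (circ (param c j)) ⊆ hull c U := by
  rw [hull_eq]
  exact segment_subset_convexHull ⟨i, hi, rfl⟩ ⟨j, hj, rfl⟩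

theorem chord_nonneg_of_mem_hull {c : Equiv.Perm ℤ} {U : Set ℤ} {a b : ℝ}
    (h : ∀ u ∈ U, 0 ≤ (param c u - a) * (param c u - b)) {Q : ℝ × ℝ} (hQ : Q ∈ hull c U) :
    0 ≤ chord a b Q := by
  refine hull_subset (convex_chord_preimage a b (convex_Ici 0)) (fun u hu => ?_) hQ
  rw [Set.mem_preimage, chord_circ]
  exact mul_nonneg (h u hu) (by positivity)

theorem chord_pos_of_mem_hull {c : Equiv.Perm ℤ} {U : Set ℤ} {a b : ℝ}
    (h : ∀ u ∈ U, 0 < (param c u - a) * (param c u - b)) {Q : ℝ × ℝ} (hQ : Q ∈ hull c U) :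
    0 < chord a b Q := by
  refine hull_subset (convex_chord_preimage a b (convex_Ioi 0)) (fun u hu => ?_) hQ
  rw [Set.mem_preimage, chord_circ]
  exact mul_pos (h u hu) (by positivity)

theorem chord_nonpos_of_mem_hull {c : Equiv.Perm ℤ} {U : Set ℤ} {a b : ℝ}
    (h : ∀ u ∈ U, (param c u - a) * (param c u - b) ≤ 0) {Q : ℝ × ℝ} (hQ : Q ∈ hull c U) :
    chord a b Q ≤ 0 := by
  refine hull_subset (convex_chord_preimage a b (convex_Iic 0)) (fun u hu => ?_) hQ
  rw [Set.mem_preimage, chord_circ]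
  exact mul_nonpos_of_nonpos_of_nonneg (h u hu) (by positivity)

theorem chord_neg_of_mem_hull {c : Equiv.Perm ℤ} {U : Set ℤ} {a b : ℝ}
    (h : ∀ u ∈ U, (param c u - a) * (param c u - b) < 0) {Q : ℝ × ℝ} (hQ : Q ∈ hull c U) :
    chord a b Q < 0 := by
  refine hull_subset (convex_chord_preimage a b (convex_Iio 0)) (fun u hu => ?_) hQ
  rw [Set.mem_preimage, chord_circ]
  exact mul_neg_of_neg_of_pos (h u hu) (by positivity)

theorem circ_mem_hull_iff {c : Equiv.Perm ℤ} {U : Set ℤ} {i : ℤ} :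
    circ (param c i) ∈ hull c U ↔ i ∈ U := by
  refine ⟨fun h => ?_, circ_mem_hull⟩
  by_contra hi
  -- For equal ends the chord becomes the tangent at the marked point, and every other point of the
  -- circle is strictly on one side of it.
  have := chord_pos_of_mem_hull (a := param c i) (b := param c i) (fun u hu => by
    have : param c u - param c i ≠ 0 :=
      sub_ne_zero.2 fun e => hi (param_injective c e ▸ hu)
    exact mul_self_pos.2 this) h
  rw [chord_circ] at this
  simp at this

/-- The four vectors `(1 + t ^ 2, 1 - t ^ 2, 2 * t)` lie in a space of dimension three, so they
satisfy a linear relation. Its coefficients are, with alternating signs, the Vandermonde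
determinants `V` of the other three parameters. With the negative terms moved across, both sides
become, after division by `W`, convex combinations of the ends of the two chords. -/
theorem exists_mem_segment_inter_segment {a b a' b' : ℝ} (h1 : a < b) (h2 : b < a') (h3 : a' < b') :
    (segment ℝ (circ a) (circ a') ∩ segment ℝ (circ b) (circ b')).Nonempty := by
  let V : ℝ → ℝ → ℝ → ℝ := fun x y z => (y - x) * (z - x) * (z - y)
  have hV : ∀ {x y z : ℝ}, x < y → y < z → 0 < V x y z := fun hxy hyz =>
    mul_pos (mul_pos (sub_pos.2 hxy) (sub_pos.2 (hxy.trans hyz))) (sub_pos.2 hyz)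
  have w1 : 0 < V b a' b' * (1 + a ^ 2) := mul_pos (hV h2 h3) (by positivity)
  have w2 : 0 < V a a' b' * (1 + b ^ 2) := mul_pos (hV (h1.trans h2) h3) (by positivity)
  have w3 : 0 < V a b b' * (1 + a' ^ 2) := mul_pos (hV h1 (h2.trans h3)) (by positivity)
  have w4 : 0 < V a b a' * (1 + b' ^ 2) := mul_pos (hV h1 h2) (by positivity)
  have hsum : V b a' b' * (1 + a ^ 2) + V a b b' * (1 + a' ^ 2) =
      V a a' b' * (1 + b ^ 2) + V a b a' * (1 + b' ^ 2) := by
    simp only [V]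
    ring
  set W := V b a' b' * (1 + a ^ 2) + V a b b' * (1 + a' ^ 2) with hW
  have hWpos : 0 < W := by positivity
  refine ⟨(V b a' b' * (1 + a ^ 2) / W) • circ a + (V a b b' * (1 + a' ^ 2) / W) • circ a',
    ⟨_, _, by positivity, by positivity, ?_, rfl⟩,
    ⟨V a a' b' * (1 + b ^ 2) / W, V a b a' * (1 + b' ^ 2) / W, by positivity, by positivity, ?_, ?_⟩⟩
  · rw [← add_div, ← hW, div_self hWpos.ne']
  · rw [← add_div, ← hsum, div_self hWpos.ne']
  · have d1 : 1 + a ^ 2 ≠ 0 := by positivity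
    have d2 : 1 + b ^ 2 ≠ 0 := by positivity
    have d3 : 1 + a' ^ 2 ≠ 0 := by positivity
    have d4 : 1 + b' ^ 2 ≠ 0 := by positivity
    clear_value W
    refine Prod.ext ?_ ?_ <;>
      simp only [circ, Prod.fst_add, Prod.snd_add, Prod.smul_fst, Prod.smul_snd, smul_eq_mul, V] <;>
      field_simp <;> ring

/-! ### Disjointness of convex hulls -/

/-- Some chord of `U` and some chord of `V` have alternating ends on the circle. -/
def Alternate (c : Equiv.Perm ℤ) (U V : Set ℤ) : Prop :=
  ∃ u ∈ U, ∃ u' ∈ U, ∃ v ∈ V, ∃ v' ∈ V,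
    (param c u < param c v ∧ param c v < param c u' ∧ param c u' < param c v') ∨
      (param c v < param c u ∧ param c u < param c v' ∧ param c v' < param c u')

theorem Alternate.not_disjoint_hull {c : Equiv.Perm ℤ} {U V : Set ℤ} (h : Alternate c U V) :
    ¬ Disjoint (hull c U) (hull c V) := by
  obtain ⟨u, hu, u', hu', v, hv, v', hv', h⟩ := h
  rw [Set.not_disjoint_iff]
  rcases h with ⟨h1, h2, h3⟩ | ⟨h1, h2, h3⟩
  · obtain ⟨Q, hQ, hQ'⟩ := exists_mem_segment_inter_segment h1 h2 h3
    exact ⟨Q, segment_subset_hull hu hu' hQ, segment_subset_hull hv hv' hQ'⟩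
  · obtain ⟨Q, hQ, hQ'⟩ := exists_mem_segment_inter_segment h1 h2 h3
    exact ⟨Q, segment_subset_hull hu hu' hQ', segment_subset_hull hv hv' hQ⟩

/-- The sets of vertices which are finite and nonempty, or those of annular polygons. -/
def IsBlockShape (n : ℕ) (c : Equiv.Perm ℤ) (U : Set ℤ) : Prop :=
  (U.Finite ∧ U.Nonempty) ∨ IsAnnularVertexSet n c U

theorem add_mul_mem_iff_of_add_mem_iff {n : ℕ} {U : Set ℤ} (h : ∀ i : ℤ, i + n ∈ U ↔ i ∈ U)
    (i k : ℤ) : i + k * n ∈ U ↔ i ∈ U := by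
  induction k using Int.induction_on with
  | zero => simp
  | succ k ih => rw [show i + (k + 1 : ℤ) * n = i + k * n + n by ring, h, ih]
  | pred k ih => rw [← h, show i + (-k - 1 : ℤ) * n + n = i + -k * n by ring, ih]

theorem exists_mul_gt {n : ℕ} (hn : 0 < n) (x y : ℤ) : ∃ k : ℤ, y < x + k * n := by
  refine ⟨|y - x| + 1, ?_⟩
  have h1 : (1 : ℤ) ≤ n := by exact_mod_cast hn
  have := le_abs_self (y - x)
  have := abs_nonneg (y - x)
  nlinarith

theorem exists_mul_lt {n : ℕ} (hn : 0 < n) (x y : ℤ) : ∃ k : ℤ, x + k * n < y := by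
  refine ⟨-(|y - x| + 1), ?_⟩
  have h1 : (1 : ℤ) ≤ n := by exact_mod_cast hn
  have := neg_abs_le (y - x)
  have := abs_nonneg (y - x)
  nlinarith

theorem exists_next {S : Set ℤ} {x y : ℤ} (hy : y ∈ S) (hxy : x < y) :
    ∃ q ∈ S, x < q ∧ q ≤ y ∧ ∀ s ∈ S, ¬ (x < s ∧ s < q) := by
  obtain ⟨q, ⟨hq, hxq⟩, hmin⟩ := Int.exists_least_of_bdd (P := fun z => z ∈ S ∧ x < z)
    ⟨x, fun z hz => hz.2.le⟩ ⟨y, hy, hxy⟩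
  exact ⟨q, hq, hxq, hmin y ⟨hy, hxy⟩, fun s hs h => by have := hmin s ⟨hs, h.1⟩; omega⟩

theorem exists_prev {S : Set ℤ} {x y : ℤ} (hy : y ∈ S) (hxy : y < x) :
    ∃ p ∈ S, p < x ∧ y ≤ p ∧ ∀ s ∈ S, ¬ (p < s ∧ s < x) := by
  obtain ⟨p, ⟨hp, hpx⟩, hmax⟩ := Int.exists_greatest_of_bdd (P := fun z => z ∈ S ∧ z < x)
    ⟨x, fun z hz => hz.2.le⟩ ⟨y, hy, hxy⟩
  exact ⟨p, hp, hpx, hmax y ⟨hy, hxy⟩, fun s hs h => by have := hmax s ⟨hs, h.2⟩; omega⟩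

/-- Periodicity provides vertices of `U` on the border of `v`, on both sides of `v`. The nearest
ones are also neighbours for the parameter, in reversed order on the outer border. -/
theorem IsAnnularVertexSet.exists_between {n : ℕ} {c : Equiv.Perm ℤ} {U : Set ℤ}
    (hc : IsPeriodicDerangement n c) (hU : IsAnnularVertexSet n c U) (v : ℤ) (hv : v ∉ U) :
    ∃ a ∈ U, ∃ b ∈ U, param c a < param c v ∧ param c v < param c b ∧
      ∀ u ∈ U, param c u ≤ param c a ∨ param c b ≤ param c u := by
  obtain ⟨hper, ⟨p, hpU, hpL⟩, ⟨q, hqU, hqR⟩⟩ := hU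
  have hper' := add_mul_mem_iff_of_add_mem_iff hper
  rw [hc.mem_Rbar_iff] at hqR
  by_cases hvL : v ∈ Lbar c
  · obtain ⟨k, hk⟩ := exists_mul_gt hc.pos p v
    obtain ⟨l, hl⟩ := exists_mul_lt hc.pos p v
    obtain ⟨a, ⟨haU, haL⟩, hva, -, ha⟩ := exists_next (S := U ∩ Lbar c)
      ⟨(hper' p k).2 hpU, hc.add_mul_mem_Lbar.2 hpL⟩ hk
    obtain ⟨b, ⟨hbU, hbL⟩, hvb, -, hb⟩ := exists_prev (S := U ∩ Lbar c)
      ⟨(hper' p l).2 hpU, hc.add_mul_mem_Lbar.2 hpL⟩ hl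
    refine ⟨a, haU, b, hbU, ?_, ?_, ?_⟩
    · rw [param_lt_param_iff]; tauto
    · rw [param_lt_param_iff]; tauto
    · intro u hu
      by_contra! h
      rw [param_lt_param_iff, param_lt_param_iff] at h
      have huL : u ∈ Lbar c := by tauto
      have h1 := ha u ⟨hu, huL⟩
      have h2 := hb u ⟨hu, huL⟩
      have : u ≠ v := fun e => hv (e ▸ hu)
      have : u < a := by tauto
      have : b < u := by tauto
      omega
  · obtain ⟨k, hk⟩ := exists_mul_gt hc.pos q v
    obtain ⟨l, hl⟩ := exists_mul_lt hc.pos q v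
    obtain ⟨b, ⟨hbU, hbL⟩, hvb, -, hb⟩ := exists_next (S := U ∩ (Lbar c)ᶜ)
      ⟨(hper' q k).2 hqU, fun h => hqR (hc.add_mul_mem_Lbar.1 h)⟩ hk
    obtain ⟨a, ⟨haU, haL⟩, hva, -, ha⟩ := exists_prev (S := U ∩ (Lbar c)ᶜ)
      ⟨(hper' q l).2 hqU, fun h => hqR (hc.add_mul_mem_Lbar.1 h)⟩ hl
    rw [Set.mem_compl_iff] at haL hbL
    refine ⟨a, haU, b, hbU, ?_, ?_, ?_⟩
    · rw [param_lt_param_iff]; tauto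
    · rw [param_lt_param_iff]; tauto
    · intro u hu
      by_contra! h
      rw [param_lt_param_iff, param_lt_param_iff] at h
      have huL : u ∉ Lbar c := by tauto
      have h1 := ha u ⟨hu, huL⟩
      have h2 := hb u ⟨hu, huL⟩
      have : u ≠ v := fun e => hv (e ▸ hu)
      have : a < u := by tauto
      have : u < b := by tauto
      omega

/-- The chord from `a` to `b` is the side of the polygon of `U` that faces `v`: either `v` falls in
a gap between consecutive parameters, or it lies beyond the extreme ones. An annular set has
vertices around every point, so the second case needs only finite sets. -/
theorem IsBlockShape.exists_gap {n : ℕ} {c : Equiv.Perm ℤ} {U : Set ℤ}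
    (hc : IsPeriodicDerangement n c) (hU : IsBlockShape n c U) (v : ℤ) (hv : v ∉ U) :
    ∃ a ∈ U, ∃ b ∈ U,
      (param c a < param c v ∧ param c v < param c b ∧
        ∀ u ∈ U, param c u ≤ param c a ∨ param c b ≤ param c u) ∨
      ((∀ u ∈ U, param c a ≤ param c u ∧ param c u ≤ param c b) ∧
        (param c v < param c a ∨ param c b < param c v)) := by
  rcases hU with ⟨hfin, hne⟩ | hann
  · obtain ⟨m, hm, hmin⟩ := Set.exists_min_image U (param c) hfin hne
    obtain ⟨M, hM, hmax⟩ := Set.exists_max_image U (param c) hfin hne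
    by_cases hout : param c v < param c m ∨ param c M < param c v
    · exact ⟨m, hm, M, hM, Or.inr ⟨fun u hu => ⟨hmin u hu, hmax u hu⟩, hout⟩⟩
    · push Not at hout
      have hne' : ∀ u ∈ U, param c u ≠ param c v := fun u hu e => hv (param_injective c e ▸ hu)
      obtain ⟨a, ⟨haU, ha⟩, hamax⟩ := Set.exists_max_image {u ∈ U | param c u < param c v} (param c)
        (hfin.subset fun _ h => h.1) ⟨m, hm, lt_of_le_of_ne hout.1 (hne' m hm)⟩
      obtain ⟨b, ⟨hbU, hb⟩, hbmin⟩ := Set.exists_min_image {u ∈ U | param c v < param c u} (param c)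
        (hfin.subset fun _ h => h.1) ⟨M, hM, lt_of_le_of_ne hout.2 (hne' M hM).symm⟩
      refine ⟨a, haU, b, hbU, Or.inl ⟨ha, hb, fun u hu => ?_⟩⟩
      rcases lt_or_gt_of_ne (hne' u hu) with h | h
      · exact Or.inl (hamax u ⟨hu, h⟩)
      · exact Or.inr (hbmin u ⟨hu, h⟩)
  · obtain ⟨a, ha, b, hb, h⟩ := hann.exists_between hc v hv
    exact ⟨a, ha, b, hb, Or.inl h⟩

/-- The side of `U` that faces one vertex `v` of `V` separates the hulls: a vertex `v'` of `V` on
the other side would make the chord from `v` to `v'` alternate with it. -/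
theorem IsBlockShape.disjoint_hull {n : ℕ} {c : Equiv.Perm ℤ} {U V : Set ℤ}
    (hc : IsPeriodicDerangement n c) (hU : IsBlockShape n c U) (hUV : Disjoint U V)
    (h : ¬ Alternate c U V) : Disjoint (hull c U) (hull c V) := by
  rcases V.eq_empty_or_nonempty with rfl | ⟨v, hv⟩
  · simp [hull]
  have hne : ∀ u ∈ U, ∀ v ∈ V, param c u ≠ param c v := fun u hu v hv e =>
    Set.disjoint_left.1 hUV hu (param_injective c e ▸ hv)
  obtain ⟨a, ha, b, hb, hab⟩ := hU.exists_gap hc v (Set.disjoint_right.1 hUV hv)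
  rw [Set.disjoint_left]
  intro Q hQU hQV
  rcases hab with ⟨h1, h2, h3⟩ | ⟨h1, h2⟩
  · have p1 : 0 ≤ chord (param c a) (param c b) Q := by
      refine chord_nonneg_of_mem_hull (fun u hu => ?_) hQU
      rcases h3 u hu with h4 | h4 <;> nlinarith
    have p2 : chord (param c a) (param c b) Q < 0 := by
      refine chord_neg_of_mem_hull (fun v' hv' => ?_) hQV
      have hav : param c a < param c v' := by
        refine lt_of_le_of_ne (not_lt.1 fun h4 => h ?_) (hne a ha v' hv')
        exact ⟨a, ha, b, hb, v', hv', v, hv, Or.inr ⟨h4, h1, h2⟩⟩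
      have hbv : param c v' < param c b := by
        refine lt_of_le_of_ne (not_lt.1 fun h4 => h ?_) (hne b hb v' hv').symm
        exact ⟨a, ha, b, hb, v, hv, v', hv', Or.inl ⟨h1, h2, h4⟩⟩
      exact mul_neg_of_pos_of_neg (sub_pos.2 hav) (sub_neg.2 hbv)
    linarith
  · have p1 : chord (param c a) (param c b) Q ≤ 0 := by
      refine chord_nonpos_of_mem_hull (fun u hu => ?_) hQU
      exact mul_nonpos_of_nonneg_of_nonpos (sub_nonneg.2 (h1 u hu).1) (sub_nonpos.2 (h1 u hu).2)
    have p2 : 0 < chord (param c a) (param c b) Q := by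
      refine chord_pos_of_mem_hull (fun v' hv' => ?_) hQV
      have hab := (h1 a ha).2
      have hout : param c v' < param c a ∨ param c b < param c v' := by
        by_contra! h4
        have h5 := lt_of_le_of_ne h4.1 (hne a ha v' hv')
        have h6 := lt_of_le_of_ne h4.2 (hne b hb v' hv').symm
        rcases h2 with h2 | h2
        · exact h ⟨a, ha, b, hb, v, hv, v', hv', Or.inr ⟨h2, h5, h6⟩⟩
        · exact h ⟨a, ha, b, hb, v', hv', v, hv, Or.inl ⟨h5, h6, h2⟩⟩
      rcases hout with h4 | h4
      · exact mul_pos_of_neg_of_neg (by linarith) (by linarith)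
      · exact mul_pos (by linarith) (by linarith)
    linarith

theorem disjoint_hull_iff {n : ℕ} {c : Equiv.Perm ℤ} {U V : Set ℤ}
    (hc : IsPeriodicDerangement n c) (hU : IsBlockShape n c U) :
    Disjoint (hull c U) (hull c V) ↔ Disjoint U V ∧ ¬ Alternate c U V := by
  refine ⟨fun h => ⟨?_, fun h' => h'.not_disjoint_hull h⟩, fun h => hU.disjoint_hull hc h.1 h.2⟩
  rw [Set.disjoint_left] at h ⊢
  exact fun i hi hi' => h (circ_mem_hull hi) (circ_mem_hull hi')

/-! ### Translations of the strip -/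

theorem mem_lifted_iff {c : Equiv.Perm ℤ} {U : Set ℤ} {x : Strip} :
    x ∈ lifted c U ↔ klein x ∈ hull c U := Iff.rfl

theorem tanh_strictMono : StrictMono Real.tanh := by
  intro x y hxy
  have hx : Real.tanh x ∈ Set.Ioo (-1 : ℝ) 1 := ⟨Real.neg_one_lt_tanh x, Real.tanh_lt_one x⟩
  have hy : Real.tanh y ∈ Set.Ioo (-1 : ℝ) 1 := ⟨Real.neg_one_lt_tanh y, Real.tanh_lt_one y⟩
  rwa [← Real.artanh_lt_artanh_iff hx hy, Real.artanh_tanh, Real.artanh_tanh]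

theorem exists_klein_eq {X Y : ℝ} (h : X ^ 2 + Y ^ 2 ≤ 1) (h1 : -1 < X) (h2 : X < 1) :
    ∃ x : Strip, klein x = (X, Y) := by
  have hX : Real.tanh (Real.artanh X) = X := Real.tanh_artanh ⟨h1, h2⟩
  set r := Real.artanh X
  have hc := Real.cosh_pos r
  have hXc : X * Real.cosh r = Real.sinh r := by
    rw [← hX, Real.tanh_eq_sinh_div_cosh]
    field_simp
  have hsq : (Y * Real.cosh r) ^ 2 ≤ 1 := by
    have h3 : (Y * Real.cosh r) ^ 2 ≤ (1 - X ^ 2) * Real.cosh r ^ 2 := by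
      rw [mul_pow]
      exact mul_le_mul_of_nonneg_right (by linarith) (sq_nonneg _)
    have h4 : (1 - X ^ 2) * Real.cosh r ^ 2 = Real.cosh r ^ 2 - (X * Real.cosh r) ^ 2 := by ring
    rw [h4, hXc, Real.cosh_sq] at h3
    linarith
  -- The height is forced by the second coordinate; it lies in `[-1, 1]` because `(1 - X ^ 2) * cosh
  -- r ^ 2 = 1`.
  refine ⟨(r, ⟨Y * Real.cosh r, abs_le.1 ((sq_le_one_iff_abs_le_one _).1 hsq)⟩), ?_⟩
  simp only [klein, hX]
  rw [mul_div_cancel_right₀ _ hc.ne']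

/-- Hulls remain in the closed disk and avoid its two missing points, since these have first
coordinate `±1`. Thus intersections can be tested in the disk instead of the strip. -/
theorem exists_klein_eq_of_mem_hull {c : Equiv.Perm ℤ} {U : Set ℤ} {Q : ℝ × ℝ}
    (hQ : Q ∈ hull c U) : ∃ x ∈ lifted c U, klein x = Q := by
  have hdisk : Convex ℝ {Q : ℝ × ℝ | Q.1 ^ 2 + Q.2 ^ 2 ≤ 1} := by
    intro P hP Q hQ x y hx hy hxy
    obtain rfl : y = 1 - x := by linarith
    simp only [Set.mem_ofPred_eq, Prod.fst_add, Prod.snd_add, Prod.smul_fst, Prod.smul_snd,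
      smul_eq_mul] at *
    -- The convexity defect of the squared norm is `x * y` times the squared distance from `P` to
    -- `Q`.
    nlinarith [mul_nonneg (mul_nonneg hx hy) (add_nonneg (sq_nonneg (P.1 - Q.1))
      (sq_nonneg (P.2 - Q.2)))]
  have h1 : Q.1 ^ 2 + Q.2 ^ 2 ≤ 1 := by
    refine hull_subset hdisk (fun u _ => ?_) hQ
    have : 1 + param c u ^ 2 ≠ 0 := by positivity
    simp only [circ, Set.mem_ofPred_eq]
    apply le_of_eq
    field_simp
    ring
  have h2 : Q ∈ Prod.fst ⁻¹' Set.Ioo (-1 : ℝ) 1 := by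
    refine hull_subset ((convex_Ioo (-1 : ℝ) 1).linear_preimage (LinearMap.fst ℝ ℝ ℝ))
      (fun u _ => ?_) hQ
    rw [← klein_vertex]
    exact ⟨Real.neg_one_lt_tanh _, Real.tanh_lt_one _⟩
  obtain ⟨x, hx⟩ := exists_klein_eq h1 h2.1 h2.2
  exact ⟨x, by rwa [mem_lifted_iff, hx], hx⟩

theorem disjoint_lifted_iff {c : Equiv.Perm ℤ} {U V : Set ℤ} :
    Disjoint (lifted c U) (lifted c V) ↔ Disjoint (hull c U) (hull c V) := by
  rw [Set.disjoint_left, Set.disjoint_left]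
  constructor
  · intro h Q hQ hQ'
    obtain ⟨x, hx, rfl⟩ := exists_klein_eq_of_mem_hull hQ
    exact h hx hQ'
  · exact fun h x hx hx' => h hx hx'

/-- Translation of a set of integers by `k n`. -/
def shift (n : ℕ) (k : ℤ) (U : Set ℤ) : Set ℤ := (fun x => x + k * n) '' U

theorem mem_shift_iff {n : ℕ} {k : ℤ} {U : Set ℤ} {x : ℤ} : x ∈ shift n k U ↔ x - k * n ∈ U := by
  constructor
  · rintro ⟨y, hy, rfl⟩
    simpa using hy
  · exact fun h => ⟨_, h, by simp⟩

theorem add_mul_mem_shift_iff {n : ℕ} {k : ℤ} {U : Set ℤ} {x : ℤ} :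
    x + k * n ∈ shift n k U ↔ x ∈ U := by
  rw [mem_shift_iff, add_sub_cancel_right]

theorem shift_shift (n : ℕ) (k l : ℤ) (U : Set ℤ) :
    shift n k (shift n l U) = shift n (k + l) U := by
  ext x
  simp only [mem_shift_iff]
  rw [show x - k * n - l * n = x - (k + l) * n by ring]

theorem shift_zero (n : ℕ) (U : Set ℤ) : shift n 0 U = U := by
  ext x
  simp [mem_shift_iff]

theorem shift_neg_shift (n : ℕ) (k : ℤ) (U : Set ℤ) : shift n (-k) (shift n k U) = U := by
  rw [shift_shift, neg_add_cancel, shift_zero]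

theorem shift_ne_self {n : ℕ} (hn : 0 < n) {U : Set ℤ} (hU : U.Finite) (hne : U.Nonempty) {k : ℤ}
    (hk : k ≠ 0) : shift n k U ≠ U := by
  intro h
  obtain ⟨m, hm, hmin⟩ := Set.exists_min_image U id hU hne
  obtain ⟨M, hM, hmax⟩ := Set.exists_max_image U id hU hne
  have h1 := add_mul_mem_shift_iff (n := n) (k := k).2 hm
  have h2 := add_mul_mem_shift_iff (n := n) (k := k).2 hM
  rw [h] at h1 h2
  have h3 := hmin _ h1
  have h4 := hmax _ h2
  simp only [id] at h3 h4
  have h5 : k * n = 0 := by omega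
  rcases mul_eq_zero.1 h5 with h6 | h6
  · exact hk h6
  · omega

theorem IsAnnularVertexSet.shift_eq {n : ℕ} {c : Equiv.Perm ℤ} {U : Set ℤ}
    (hU : IsAnnularVertexSet n c U) (k : ℤ) : shift n k U = U := by
  ext x
  rw [mem_shift_iff, ← add_mul_mem_iff_of_add_mem_iff hU.1 _ k, sub_add_cancel]

theorem IsBlockShape.nonempty {n : ℕ} {c : Equiv.Perm ℤ} {U : Set ℤ} (h : IsBlockShape n c U) :
    U.Nonempty := by
  rcases h with h | h
  · exact h.2
  · exact h.2.1.mono Set.inter_subset_left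

/-- The translation of the strip by `r`. -/
def Strip.translate (r : ℝ) (x : Strip) : Strip := (x.1 + r, x.2)

/-- The projective transformation of the disk induced by the translation by `r` of the strip. -/
def hypTranslate (r : ℝ) (Q : ℝ × ℝ) : ℝ × ℝ :=
  ((Q.1 * Real.cosh r + Real.sinh r) / (Real.cosh r + Q.1 * Real.sinh r),
    Q.2 / (Real.cosh r + Q.1 * Real.sinh r))

theorem cosh_add_klein_mul_sinh (r : ℝ) (x : Strip) :
    Real.cosh r + (klein x).1 * Real.sinh r = Real.cosh (x.1 + r) / Real.cosh x.1 := by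
  have := (Real.cosh_pos x.1).ne'
  simp only [klein, Real.tanh_eq_sinh_div_cosh, Real.cosh_add]
  field_simp

theorem klein_translate (r : ℝ) (x : Strip) :
    klein (x.translate r) = hypTranslate r (klein x) := by
  have h1 := (Real.cosh_pos x.1).ne'
  have h2 := (Real.cosh_pos (x.1 + r)).ne'
  rw [hypTranslate, cosh_add_klein_mul_sinh]
  simp only [klein, Strip.translate, Real.tanh_eq_sinh_div_cosh]
  refine Prod.ext ?_ ?_
  · simp only
    rw [Real.sinh_add]
    field_simp
  · simp only
    field_simp

/-- A projective map sends segments to segments where its denominator is positive: the weights `x`,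
`y` are merely rescaled by the denominators `p`, `q`. The positivity is part of the set because it
is needed for this and is itself a convex condition. -/
theorem convex_hypTranslate_preimage (r : ℝ) {C : Set (ℝ × ℝ)} (hC : Convex ℝ C) :
    Convex ℝ {Q : ℝ × ℝ | 0 < Real.cosh r + Q.1 * Real.sinh r ∧ hypTranslate r Q ∈ C} := by
  rintro P ⟨hP, hPC⟩ Q ⟨hQ, hQC⟩ x y hx hy hxy
  set p := Real.cosh r + P.1 * Real.sinh r with hp
  set q := Real.cosh r + Q.1 * Real.sinh r with hq
  have hd : Real.cosh r + (x • P + y • Q).1 * Real.sinh r = x * p + y * q := by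
    obtain rfl : y = 1 - x := by linarith
    simp only [Prod.fst_add, Prod.smul_fst, smul_eq_mul, hp, hq]
    ring
  have hpos : 0 < x * p + y * q := (convex_Ioi (0 : ℝ)) hP hQ hx hy hxy
  refine ⟨by rw [hd]; exact hpos, ?_⟩
  have key : hypTranslate r (x • P + y • Q) =
      (x * p / (x * p + y * q)) • hypTranslate r P + (y * q / (x * p + y * q)) • hypTranslate r Q := by
    rw [hypTranslate, hd, hypTranslate, hypTranslate, ← hp, ← hq]
    clear_value p q
    refine Prod.ext ?_ ?_ <;>
      simp only [Prod.fst_add, Prod.snd_add, Prod.smul_fst, Prod.smul_snd, smul_eq_mul]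
    · obtain rfl : y = 1 - x := by linarith
      field_simp
      ring
    · field_simp
  rw [key]
  refine hC hPC hQC (by positivity) (by positivity) ?_
  rw [← add_div, div_self hpos.ne']

/-! ### Lifts, translates and the covering map -/

section Cover

variable {n : ℕ} {c : Equiv.Perm ℤ}

theorem vertex_add_mul (hc : IsPeriodicDerangement n c) (i k : ℤ) :
    vertex c (i + k * n) = (vertex c i).translate (k * n) := by
  by_cases h : i ∈ Lbar c
  · have h' : i + k * n ∈ Lbar c := hc.add_mul_mem_Lbar.2 h
    simp [vertex, Strip.translate, h, h']
  · have h' : i + k * n ∉ Lbar c := fun h' => h (hc.add_mul_mem_Lbar.1 h')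
    simp [vertex, Strip.translate, h, h']

theorem translate_mem_lifted_shift (hc : IsPeriodicDerangement n c) {U : Set ℤ} {x : Strip}
    (hx : x ∈ lifted c U) (k : ℤ) : x.translate (k * n) ∈ lifted c (shift n k U) := by
  rw [mem_lifted_iff] at hx ⊢
  rw [klein_translate]
  refine (hull_subset (convex_hypTranslate_preimage (k * n) (C := hull c (shift n k U))
    (convex_convexHull ℝ _)) (fun u hu => ⟨?_, ?_⟩) hx).2
  · rw [← klein_vertex, cosh_add_klein_mul_sinh]
    exact div_pos (Real.cosh_pos _) (Real.cosh_pos _)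
  · rw [← klein_vertex, ← klein_translate, ← vertex_add_mul hc, klein_vertex]
    exact circ_mem_hull (add_mul_mem_shift_iff.2 hu)

theorem translate_zero (x : Strip) : x.translate 0 = x := by
  simp [Strip.translate]

theorem cover_eq_cover_iff {x y : Strip} :
    cover n x = cover n y ↔ ∃ k : ℤ, y = x.translate (k * n) := by
  have : ((x.1 : AddCircle (n : ℝ)) = (y.1 : AddCircle (n : ℝ))) ↔ ∃ k : ℤ, y.1 = x.1 + k * n := by
    rw [eq_comm, ← sub_eq_zero, ← AddCircle.coe_sub, AddCircle.coe_eq_zero_iff]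
    refine exists_congr fun k => ?_
    rw [zsmul_eq_mul, eq_sub_iff_add_eq, eq_comm, add_comm]
  simp only [cover, this, Strip.translate, Prod.ext_iff]
  constructor
  · rintro ⟨⟨k, hk⟩, h⟩
    exact ⟨k, hk, h.symm⟩
  · rintro ⟨k, hk, h⟩
    exact ⟨⟨k, hk⟩, h.symm⟩

theorem cover_mem_polygon_iff (hc : IsPeriodicDerangement n c) {U : Set ℤ} {x : Strip} :
    cover n x ∈ polygon n c U ↔ ∃ k : ℤ, x ∈ lifted c (shift n k U) := by
  constructor
  · rintro ⟨y, hy, hyx⟩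
    obtain ⟨k, rfl⟩ := cover_eq_cover_iff.1 hyx
    exact ⟨k, translate_mem_lifted_shift hc hy k⟩
  · rintro ⟨k, hk⟩
    have h := translate_mem_lifted_shift hc hk (-k)
    rw [shift_neg_shift] at h
    exact ⟨_, h, (cover_eq_cover_iff.2 ⟨_, rfl⟩).symm⟩

theorem vertex_mem_lifted_iff {U : Set ℤ} {i : ℤ} : vertex c i ∈ lifted c U ↔ i ∈ U := by
  rw [mem_lifted_iff, klein_vertex, circ_mem_hull_iff]

theorem markedPoint_mem_polygon_iff (hc : IsPeriodicDerangement n c) {U : Set ℤ} {i : ℤ} :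
    markedPoint n c i ∈ polygon n c U ↔ ∃ k : ℤ, i ∈ shift n k U := by
  rw [markedPoint, cover_mem_polygon_iff hc]
  simp only [vertex_mem_lifted_iff]

theorem polygon_shift (hc : IsPeriodicDerangement n c) (U : Set ℤ) (k : ℤ) :
    polygon n c (shift n k U) = polygon n c U := by
  have hsurj : Function.Surjective (cover n) := by
    rintro ⟨a, b⟩
    obtain ⟨r, rfl⟩ := QuotientAddGroup.mk_surjective a
    exact ⟨(r, b), rfl⟩
  ext z
  obtain ⟨x, rfl⟩ := hsurj z
  rw [cover_mem_polygon_iff hc, cover_mem_polygon_iff hc]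
  constructor
  · rintro ⟨l, hl⟩
    exact ⟨l + k, by rwa [← shift_shift]⟩
  · rintro ⟨l, hl⟩
    exact ⟨l - k, by rwa [shift_shift, sub_add_cancel]⟩

theorem disjoint_polygon_iff (hc : IsPeriodicDerangement n c) {U V : Set ℤ} :
    Disjoint (polygon n c U) (polygon n c V) ↔
      ∀ k : ℤ, Disjoint (hull c U) (hull c (shift n k V)) := by
  simp only [← disjoint_lifted_iff]
  constructor
  · intro h k
    rw [Set.disjoint_left]
    intro x hx hx'
    exact Set.disjoint_left.1 h ⟨x, hx, rfl⟩ ((cover_mem_polygon_iff hc).2 ⟨k, hx'⟩)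
  · intro h
    rw [Set.disjoint_left]
    rintro _ ⟨x, hx, rfl⟩ hx'
    obtain ⟨k, hk⟩ := (cover_mem_polygon_iff hc).1 hx'
    exact Set.disjoint_left.1 (h k) hx hk

/-- Two points of the strip have the same image exactly when they differ by a translation by `k *
n`, which has no fixed point for `k ≠ 0`. Embedding therefore means being disjoint from all
nontrivial translates. -/
theorem isDiskVertexSet_iff (hc : IsPeriodicDerangement n c) {U : Set ℤ} :
    IsDiskVertexSet n c U ↔
      U.Finite ∧ U.Nonempty ∧ ∀ k : ℤ, k ≠ 0 → Disjoint (hull c U) (hull c (shift n k U)) := by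
  refine and_congr_right fun hfin => and_congr_right fun hne => ?_
  simp only [← disjoint_lifted_iff]
  constructor
  · intro h k hk
    rw [Set.disjoint_left]
    intro x hx hx'
    have h' := translate_mem_lifted_shift hc hx' (-k)
    rw [shift_neg_shift] at h'
    have h1 := h hx h' (cover_eq_cover_iff.2 ⟨_, rfl⟩)
    have h2 := congrArg Prod.fst h1
    simp only [Strip.translate, Int.cast_neg, neg_mul] at h2
    have h3 : (k : ℝ) * n = 0 := by linarith
    rcases mul_eq_zero.1 h3 with h4 | h4
    · exact hk (by exact_mod_cast h4)
    · have := hc.pos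
      norm_cast at h4
      omega
  · intro h x hx y hy hxy
    obtain ⟨k, rfl⟩ := cover_eq_cover_iff.1 hxy
    by_cases hk : k = 0
    · simp [hk, translate_zero]
    · exact absurd (translate_mem_lifted_shift hc hx k) (Set.disjoint_left.1 (h k hk) hy)

theorem IsDiskVertexSet.shift (hc : IsPeriodicDerangement n c) {U : Set ℤ}
    (hU : IsDiskVertexSet n c U) (k : ℤ) : IsDiskVertexSet n c (shift n k U) := by
  refine ⟨hU.1.image _, hU.2.1.image _, ?_⟩
  intro x hx y hy hxy
  have key : ∀ z ∈ lifted c (CNC.shift n k U), Strip.translate ((-k : ℤ) * n) z ∈ lifted c U := by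
    intro z hz
    have := translate_mem_lifted_shift hc hz (-k)
    rwa [shift_neg_shift] at this
  have h1 := hU.2.2 (key x hx) (key y hy) (by
    rw [← cover_eq_cover_iff.2 ⟨-k, rfl⟩, ← cover_eq_cover_iff.2 ⟨-k, rfl⟩, hxy])
  simp only [Strip.translate, Prod.mk.injEq] at h1
  exact Prod.ext (by linarith [h1.1]) h1.2

/-! ### Recovering the vertices of a polygon -/

theorem tanh_le_fst_le_tanh_of_mem_hull {U : Set ℤ} {a b : ℤ} (h : ∀ u ∈ U, a ≤ u ∧ u ≤ b)
    {Q : ℝ × ℝ} (hQ : Q ∈ hull c U) : Real.tanh a ≤ Q.1 ∧ Q.1 ≤ Real.tanh b := by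
  have : Q ∈ Prod.fst ⁻¹' Set.Icc (Real.tanh a) (Real.tanh b) := by
    refine hull_subset ((convex_Icc _ _).linear_preimage (LinearMap.fst ℝ ℝ ℝ)) (fun u hu => ?_) hQ
    rw [← klein_vertex]
    have := h u hu
    exact ⟨tanh_strictMono.monotone (Int.cast_le.2 this.1),
      tanh_strictMono.monotone (Int.cast_le.2 this.2)⟩
  exact this

/-- A segment which is covered by pairwise disjoint translates of a disk is contained in one of them. -/
theorem mem_shift_of_segment_subset (hc : IsPeriodicDerangement n c) {U : Set ℤ}
    (hU : IsDiskVertexSet n c U) {v v' k₀ : ℤ} (hv : v ∈ shift n k₀ U)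
    (hcov : ∀ Q ∈ segment ℝ (circ (param c v)) (circ (param c v')),
      ∃ k : ℤ, Q ∈ hull c (shift n k U)) : v' ∈ shift n k₀ U := by
  obtain ⟨hfin, hne, hdis⟩ := (isDiskVertexSet_iff hc).1 hU
  have hdis' : ∀ k l : ℤ, k ≠ l → Disjoint (hull c (shift n k U)) (hull c (shift n l U)) := by
    intro k l hkl
    have hk := ((isDiskVertexSet_iff hc).1 (hU.shift hc k)).2.2 (l - k) (sub_ne_zero.2 hkl.symm)
    rwa [shift_shift, sub_add_cancel] at hk
  have hclosed : ∀ k, IsClosed (hull c (shift n k U)) := by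
    intro k
    exact (((hU.shift hc k).1.image _).image _).isClosed_convexHull ℝ
  obtain ⟨a, ha⟩ := hfin.bddBelow
  obtain ⟨b, hb⟩ := hfin.bddAbove
  have hseg : ∀ Q ∈ segment ℝ (circ (param c v)) (circ (param c v')),
      Real.tanh (min v v' : ℤ) ≤ Q.1 ∧ Q.1 ≤ Real.tanh (max v v' : ℤ) := by
    intro Q hQ
    refine tanh_le_fst_le_tanh_of_mem_hull (c := c) (U := {v, v'}) ?_
      (segment_subset_hull (by simp) (by simp) hQ)
    rintro u (rfl | rfl) <;> simp
  -- Comparing first coordinates leaves only finitely many translates that can meet the segment, so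
  -- that the union of the translates other than `k₀` is closed.
  set K : Set ℤ := {k | k ≠ k₀ ∧ min v v' - b ≤ k * n ∧ k * n ≤ max v v' - a} with hK
  have hKfin : K.Finite := by
    apply (Set.finite_Icc (-|min v v' - b|) (|max v v' - a|)).subset
    rintro k ⟨-, h1, h2⟩
    have h3 : (1 : ℤ) ≤ n := by exact_mod_cast hc.pos
    have := neg_abs_le (min v v' - b)
    have := le_abs_self (max v v' - a)
    have := abs_nonneg (max v v' - a)
    have := abs_nonneg (min v v' - b)
    constructor <;> nlinarith
  have hcov' : ∀ Q ∈ segment ℝ (circ (param c v)) (circ (param c v')),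
      Q ∈ hull c (shift n k₀ U) ∪ ⋃ k ∈ K, hull c (shift n k U) := by
    intro Q hQ
    obtain ⟨k, hk⟩ := hcov Q hQ
    by_cases hkk : k = k₀
    · exact Or.inl (hkk ▸ hk)
    · refine Or.inr (Set.mem_iUnion₂.2 ⟨k, ⟨hkk, ?_⟩, hk⟩)
      have h1 := tanh_le_fst_le_tanh_of_mem_hull (c := c) (a := a + k * n) (b := b + k * n)
        (U := shift n k U) (by
          rintro _ ⟨u, hu, rfl⟩
          have := ha hu
          have := hb hu
          simp only
          omega) hk
      have h2 := hseg Q hQ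
      have h3 := tanh_strictMono.le_iff_le.1 (h1.1.trans h2.2)
      have h4 := tanh_strictMono.le_iff_le.1 (h2.1.trans h1.2)
      norm_cast at h3 h4
      omega
  by_contra hv'
  -- If `v'` were in another translate, two closed sets covering the connected segment would both
  -- meet it, hence meet each other, against the disjointness of the translates.
  have hpre := isPreconnected_closed_iff.1
    (convex_segment (𝕜 := ℝ) (circ (param c v)) (circ (param c v'))).isPreconnected
    _ _ (hclosed k₀) (hKfin.isClosed_biUnion fun k _ => hclosed k) hcov'
    ⟨_, left_mem_segment ℝ _ _, circ_mem_hull hv⟩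
    ⟨_, right_mem_segment ℝ _ _, (hcov' _ (right_mem_segment ℝ _ _)).resolve_left
      fun h => hv' (circ_mem_hull_iff.1 h)⟩
  obtain ⟨Q, -, hQ, hQ'⟩ := hpre
  obtain ⟨k, hk, hQk⟩ := Set.mem_iUnion₂.1 hQ'
  exact Set.disjoint_left.1 (hdis' _ _ hk.1) hQk hQ

theorem IsDiskVertexSet.exists_subset_shift (hc : IsPeriodicDerangement n c) {U V : Set ℤ}
    (hU : IsDiskVertexSet n c U) (hV : V.Nonempty) (h : polygon n c V ⊆ polygon n c U) :
    ∃ k : ℤ, V ⊆ CNC.shift n k U := by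
  have hcov : ∀ Q ∈ hull c V, ∃ k : ℤ, Q ∈ hull c (CNC.shift n k U) := by
    intro Q hQ
    obtain ⟨x, hx, rfl⟩ := exists_klein_eq_of_mem_hull hQ
    exact (cover_mem_polygon_iff hc).1 (h ⟨x, hx, rfl⟩)
  obtain ⟨v, hv⟩ := hV
  obtain ⟨k, hk⟩ := hcov _ (circ_mem_hull hv)
  refine ⟨k, fun v' hv' => ?_⟩
  exact mem_shift_of_segment_subset hc hU (circ_mem_hull_iff.1 hk)
    fun Q hQ => hcov Q (segment_subset_hull hv hv' hQ)

theorem IsAnnularVertexSet.infinite (hn : 0 < n) {U : Set ℤ} (hU : IsAnnularVertexSet n c U) :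
    U.Infinite := fun hfin =>
  shift_ne_self hn hfin (hU.2.1.mono Set.inter_subset_left) one_ne_zero (hU.shift_eq 1)

/-- Finiteness distinguishes disks from annular polygons. The latter are recovered from their marked
points, being invariant under translation. For disks, each vertex set is contained in a translate of
the other, and composing the inclusions puts `V` inside its translate by `k + l`; embedding forces
`k + l = 0`. -/
theorem exists_eq_shift_of_polygon_eq (hc : IsPeriodicDerangement n c) {U V : Set ℤ}
    (hU : IsDiskVertexSet n c U ∨ IsAnnularVertexSet n c U)
    (hV : IsDiskVertexSet n c V ∨ IsAnnularVertexSet n c V) (h : polygon n c U = polygon n c V) :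
    ∃ k : ℤ, V = shift n k U := by
  have hneU : U.Nonempty := by
    rcases hU with hU | hU
    · exact hU.2.1
    · exact hU.2.1.mono Set.inter_subset_left
  have hneV : V.Nonempty := by
    rcases hV with hV | hV
    · exact hV.2.1
    · exact hV.2.1.mono Set.inter_subset_left
  rcases hU with hU | hU <;> rcases hV with hV | hV
  · obtain ⟨k, hk⟩ := hU.exists_subset_shift hc hneV h.ge
    obtain ⟨l, hl⟩ := hV.exists_subset_shift hc hneU h.le
    have h1 : shift n k U ⊆ shift n (k + l) V := by
      rw [← shift_shift]
      exact Set.image_mono hl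
    have h2 : k + l = 0 := by
      by_contra hkl
      obtain ⟨v, hv⟩ := hneV
      exact Set.disjoint_left.1 (((isDiskVertexSet_iff hc).1 hV).2.2 _ hkl) (circ_mem_hull hv)
        (circ_mem_hull (h1 (hk hv)))
    rw [h2, shift_zero] at h1
    exact ⟨k, hk.antisymm h1⟩
  · obtain ⟨k, hk⟩ := hU.exists_subset_shift hc hneV h.ge
    exact absurd ((hU.1.image _).subset hk) (hV.infinite hc.pos)
  · obtain ⟨k, hk⟩ := hV.exists_subset_shift hc hneU h.le
    exact absurd ((hV.1.image _).subset hk) (hU.infinite hc.pos)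
  · refine ⟨0, ?_⟩
    have key : ∀ {A B : Set ℤ}, IsAnnularVertexSet n c A → polygon n c B ⊆ polygon n c A →
        B ⊆ A := by
      intro A B hA hAB i hi
      have h1 : markedPoint n c i ∈ polygon n c B := ⟨_, vertex_mem_lifted_iff.2 hi, rfl⟩
      obtain ⟨k, hk⟩ := (markedPoint_mem_polygon_iff hc).1 (hAB h1)
      rwa [hA.shift_eq] at hk
    rw [shift_zero]
    exact (key hU h.ge).antisymm (key hV h.le)

end Cover

/-! ### Crossing sets of integers -/

/-- Drawn as increasing paths which pass below the points of `Lbar c` and above the others, `U` passes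
above `V` at the point `x` of one of them. -/
def Over (c : Equiv.Perm ℤ) (U V : Set ℤ) (x : ℤ) : Prop :=
  (x ∈ U ∧ x ∈ Lbar c ∧ ∃ v ∈ V, ∃ v' ∈ V, v < x ∧ x < v') ∨
    (x ∈ V ∧ x ∉ Lbar c ∧ ∃ u ∈ U, ∃ u' ∈ U, u < x ∧ x < u')

/-- `U` passes above `V` at some place, and below `V` at some other place. -/
def Cross (c : Equiv.Perm ℤ) (U V : Set ℤ) : Prop := (∃ x, Over c U V x) ∧ ∃ y, Over c V U y

section

variable {c : Equiv.Perm ℤ} {U V : Set ℤ}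

theorem Cross.symm (h : Cross c U V) : Cross c V U := And.symm h

theorem Over.mono {U' V' : Set ℤ} {x : ℤ} (h : Over c U V x) (hU : U ⊆ U') (hV : V ⊆ V') :
    Over c U' V' x := by
  rcases h with ⟨h1, h2, v, hv, v', hv', h⟩ | ⟨h1, h2, u, hu, u', hu', h⟩
  · exact Or.inl ⟨hU h1, h2, v, hV hv, v', hV hv', h⟩
  · exact Or.inr ⟨hV h1, h2, u, hU hu, u', hU hu', h⟩

theorem Cross.mono {U' V' : Set ℤ} (h : Cross c U V) (hU : U ⊆ U') (hV : V ⊆ V') :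
    Cross c U' V' :=
  ⟨h.1.imp fun _ hx => hx.mono hU hV, h.2.imp fun _ hx => hx.mono hV hU⟩

theorem Alternate.symm (h : Alternate c U V) : Alternate c V U := by
  obtain ⟨u, hu, u', hu', v, hv, v', hv', h⟩ := h
  exact ⟨v, hv, v', hv', u, hu, u', hu', Or.symm h⟩

/-- Replaces the existential statement by an order condition on four integers, which can be decided
border by border. -/
theorem exists_over_of_quadruple {u u' v v' : ℤ} (hu : u ∈ U) (hu' : u' ∈ U) (hv : v ∈ V)
    (hv' : v' ∈ V)
    (h : (u ∈ Lbar c ∧ (v < u ∧ u < v' ∨ v' < u ∧ u < v)) ∨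
      (u' ∈ Lbar c ∧ (v < u' ∧ u' < v' ∨ v' < u' ∧ u' < v)) ∨
      (v ∉ Lbar c ∧ (u < v ∧ v < u' ∨ u' < v ∧ v < u)) ∨
      (v' ∉ Lbar c ∧ (u < v' ∧ v' < u' ∨ u' < v' ∧ v' < u))) :
    ∃ x, Over c U V x := by
  rcases h with ⟨h, h' | h'⟩ | ⟨h, h' | h'⟩ | ⟨h, h' | h'⟩ | ⟨h, h' | h'⟩
  · exact ⟨_, Or.inl ⟨hu, h, v, hv, v', hv', h'⟩⟩
  · exact ⟨_, Or.inl ⟨hu, h, v', hv', v, hv, h'⟩⟩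
  · exact ⟨_, Or.inl ⟨hu', h, v, hv, v', hv', h'⟩⟩
  · exact ⟨_, Or.inl ⟨hu', h, v', hv', v, hv, h'⟩⟩
  · exact ⟨_, Or.inr ⟨hv, h, u, hu, u', hu', h'⟩⟩
  · exact ⟨_, Or.inr ⟨hv, h, u', hu', u, hu, h'⟩⟩
  · exact ⟨_, Or.inr ⟨hv', h, u, hu, u', hu', h'⟩⟩
  · exact ⟨_, Or.inr ⟨hv', h, u', hu', u, hu, h'⟩⟩

/-- Two chords with alternating ends exchange their vertical order, so each passes above the other
somewhere; an end of one of them witnesses each place. The sixteen distributions of the ends over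
the two borders are checked separately. -/
theorem cross_of_param_lt (hUV : Disjoint U V) {u u' v v' : ℤ} (hu : u ∈ U) (hu' : u' ∈ U)
    (hv : v ∈ V) (hv' : v' ∈ V) (h1 : param c u < param c v) (h2 : param c v < param c u')
    (h3 : param c u' < param c v') : Cross c U V := by
  have n1 : u ≠ v := hUV.ne_of_mem hu hv
  have n2 : u ≠ v' := hUV.ne_of_mem hu hv'
  have n3 : u' ≠ v := hUV.ne_of_mem hu' hv
  have n4 : u' ≠ v' := hUV.ne_of_mem hu' hv'
  rw [param_lt_param_iff] at h1 h2 h3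
  constructor
  · apply exists_over_of_quadruple hu hu' hv hv'
    by_cases m1 : u ∈ Lbar c <;> by_cases m2 : u' ∈ Lbar c <;> by_cases m3 : v ∈ Lbar c <;>
      by_cases m4 : v' ∈ Lbar c <;> simp only [m1, m2, m3, m4, true_and, false_and, not_true,
        not_false_eq_true, or_false, false_or, and_true, and_false] at h1 h2 h3 ⊢ <;> omega
  · apply exists_over_of_quadruple hv hv' hu hu'
    by_cases m1 : u ∈ Lbar c <;> by_cases m2 : u' ∈ Lbar c <;> by_cases m3 : v ∈ Lbar c <;>
      by_cases m4 : v' ∈ Lbar c <;> simp only [m1, m2, m3, m4, true_and, false_and, not_true,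
        not_false_eq_true, or_false, false_or, and_true, and_false] at h1 h2 h3 ⊢ <;> omega

theorem Alternate.cross (hUV : Disjoint U V) (h : Alternate c U V) : Cross c U V := by
  obtain ⟨u, hu, u', hu', v, hv, v', hv', ⟨h1, h2, h3⟩ | ⟨h1, h2, h3⟩⟩ := h
  · exact cross_of_param_lt hUV hu hu' hv hv' h1 h2 h3
  · exact (cross_of_param_lt hUV.symm hv hv' hu hu' h1 h2 h3).symm

/-- Alternation depends only on the cyclic order `a`, `d`, `b`, `e`; the four cases are the places
where the parameter may cut this cycle open. -/
theorem alternate_of_quadruple {a b d e : ℤ} (ha : a ∈ U) (hb : b ∈ U) (hd : d ∈ V) (he : e ∈ V)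
    (h : (param c a < param c d ∧ param c d < param c b ∧ param c b < param c e) ∨
      (param c d < param c b ∧ param c b < param c e ∧ param c e < param c a) ∨
      (param c b < param c e ∧ param c e < param c a ∧ param c a < param c d) ∨
      (param c e < param c a ∧ param c a < param c d ∧ param c d < param c b)) :
    Alternate c U V := by
  rcases h with h | h | h | h
  · exact ⟨a, ha, b, hb, d, hd, e, he, Or.inl h⟩
  · exact ⟨b, hb, a, ha, d, hd, e, he, Or.inr h⟩
  · exact ⟨b, hb, a, ha, e, he, d, hd, Or.inl h⟩
  · exact ⟨a, ha, b, hb, e, he, d, hd, Or.inr h⟩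

/-- Interleaved intervals whose inner ends are on the same side. -/
theorem alternate_of_interleaved {a b d e : ℤ} (ha : a ∈ U) (hb : b ∈ U) (hd : d ∈ V) (he : e ∈ V)
    (h1 : a < d) (h2 : d < b) (h3 : b < e) (h : d ∈ Lbar c ↔ b ∈ Lbar c) : Alternate c U V := by
  by_cases m2 : b ∈ Lbar c
  · apply alternate_of_quadruple ha hb he hd
    simp only [param_lt_param_iff]
    by_cases m1 : a ∈ Lbar c <;> by_cases m4 : e ∈ Lbar c <;> simp only [m1, m2, h, m4, true_and,
      false_and, not_true, not_false_eq_true, or_false, false_or, and_true, and_false] <;> omega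
  · apply alternate_of_quadruple ha hb hd he
    simp only [param_lt_param_iff]
    by_cases m1 : a ∈ Lbar c <;> by_cases m4 : e ∈ Lbar c <;> simp only [m1, m2, h, m4, true_and,
      false_and, not_true, not_false_eq_true, or_false, false_or, and_true, and_false] <;> omega

/-- Nested intervals, when the inner one has its ends on different sides. -/
theorem alternate_of_nested {a b d e : ℤ} (ha : a ∈ U) (hb : b ∈ U) (hd : d ∈ V) (he : e ∈ V)
    (h1 : d < a) (h2 : d < b) (h3 : a < e) (h4 : b < e) (haL : a ∈ Lbar c) (hbL : b ∉ Lbar c) :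
    Alternate c U V := by
  apply alternate_of_quadruple ha hb hd he
  simp only [param_lt_param_iff]
  by_cases m3 : d ∈ Lbar c <;> by_cases m4 : e ∈ Lbar c <;> simp only [m3, haL, hbL, m4, true_and,
      false_and, not_true, not_false_eq_true, or_false, false_or, and_true, and_false] <;>
    omega

/-- Let `x` and `y` be points of the two sets witnessing the two opposite places. If they belong to
different sets they are on the same border, and interleaved intervals result. If they belong to the
same set they are on different borders, and the other set extends beyond both of them: nested
intervals. -/
theorem Cross.alternate (hUV : Disjoint U V) (h : Cross c U V) : Alternate c U V := by
  obtain ⟨⟨x, ⟨hx, hxL, v, hv, v', hv', h1, h2⟩ | ⟨hx, hxR, u, hu, u', hu', h1, h2⟩⟩,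
    ⟨y, ⟨hy, hyL, a, ha, a', ha', h3, h4⟩ | ⟨hy, hyR, b, hb, b', hb', h3, h4⟩⟩⟩ := h
  · rcases lt_or_gt_of_ne (hUV.ne_of_mem hx hy) with h | h
    · exact (alternate_of_interleaved hv hy hx ha' h1 h h4 (by tauto)).symm
    · exact alternate_of_interleaved ha hx hy hv' h3 h h2 (by tauto)
  · rcases le_total v b with h5 | h5 <;> rcases le_total v' b' with h6 | h6
    · exact alternate_of_nested hx hy hv hb' h1 (by omega) (by omega) h4 hxL hyR
    · exact alternate_of_nested hx hy hv hv' h1 (by omega) (by omega) (by omega) hxL hyR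
    · exact alternate_of_nested hx hy hb hb' (by omega) (by omega) (by omega) h4 hxL hyR
    · exact alternate_of_nested hx hy hb hv' (by omega) (by omega) (by omega) (by omega) hxL hyR
  · refine Alternate.symm ?_
    rcases le_total a u with h5 | h5 <;> rcases le_total a' u' with h6 | h6
    · exact alternate_of_nested hy hx ha hu' h3 (by omega) (by omega) h2 hyL hxR
    · exact alternate_of_nested hy hx ha ha' h3 (by omega) (by omega) (by omega) hyL hxR
    · exact alternate_of_nested hy hx hu hu' (by omega) (by omega) (by omega) h2 hyL hxR
    · exact alternate_of_nested hy hx hu ha' (by omega) (by omega) (by omega) (by omega) hyL hxR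
  · rcases lt_or_gt_of_ne (hUV.ne_of_mem hy hx) with h | h
    · exact (alternate_of_interleaved hb hx hy hu' h3 h h2 (by tauto)).symm
    · exact alternate_of_interleaved hu hy hx hb' h1 h h4 (by tauto)

theorem disjoint_hull_iff_not_cross {n : ℕ} (hc : IsPeriodicDerangement n c)
    (hU : IsBlockShape n c U) :
    Disjoint (hull c U) (hull c V) ↔ Disjoint U V ∧ ¬ Cross c U V := by
  rw [disjoint_hull_iff hc hU]
  exact and_congr_right fun h => not_congr ⟨fun h' => h'.cross h, fun h' => h'.alternate h⟩

end

/-! ### Noncrossing partitions of the annulus as partitions of the integers -/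

/-- Partitions of `ℤ`, stable under translation by `n`, into noncrossing blocks which are finite or
are the vertex sets of annular polygons. -/
structure IsBlockPartition (n : ℕ) (c : Equiv.Perm ℤ) (B : Set (Set ℤ)) : Prop where
  shape : ∀ U ∈ B, IsBlockShape n c U
  covers : ∀ i : ℤ, ∃ U ∈ B, i ∈ U
  disjoint : ∀ U ∈ B, ∀ V ∈ B, U ≠ V → Disjoint U V
  not_cross : ∀ U ∈ B, ∀ V ∈ B, U ≠ V → ¬ Cross c U V
  shift_mem : ∀ U ∈ B, ∀ k : ℤ, shift n k U ∈ B

/-- The vertex sets of the lifts of the polygons of `P`. -/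
def blocks (n : ℕ) (c : Equiv.Perm ℤ) (P : Set (Set (Annulus n))) : Set (Set ℤ) :=
  {U | ∃ E ∈ P, U ∈ part n c E}

section

variable {n : ℕ} {c : Equiv.Perm ℤ}

theorem isBlockShape_of_vertexSet {U : Set ℤ}
    (h : IsDiskVertexSet n c U ∨ IsAnnularVertexSet n c U) : IsBlockShape n c U :=
  h.imp_left fun h => ⟨h.1, h.2.1⟩

/-- Distinct lifts have disjoint hulls for one of two reasons: their polygons are different members
of `P`, or they are different translates of one embedded disk. An annular polygon has a single lift.
-/
theorem IsNoncrossingPartition.isBlockPartition (hc : IsPeriodicDerangement n c)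
    {P : Set (Set (Annulus n))} (hP : IsNoncrossingPartition n c P) :
    IsBlockPartition n c (blocks n c P) := by
  have shift_mem : ∀ U ∈ blocks n c P, ∀ k : ℤ, shift n k U ∈ blocks n c P := by
    rintro U ⟨E, hE, hU, rfl⟩ k
    refine ⟨_, hE, ?_, polygon_shift hc U k⟩
    rcases hU with hU | hU
    · exact Or.inl (hU.shift hc k)
    · rw [hU.shift_eq]
      exact Or.inr hU
  have key : ∀ U ∈ blocks n c P, ∀ V ∈ blocks n c P, U ≠ V → Disjoint (hull c U) (hull c V) := by
    rintro U ⟨E, hE, hU, rfl⟩ V ⟨F, hF, hV, rfl⟩ hUV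
    by_cases hEF : polygon n c U = polygon n c V
    · obtain ⟨k, rfl⟩ := exists_eq_shift_of_polygon_eq hc hU hV hEF
      rcases hU with hU | hU
      · refine ((isDiskVertexSet_iff hc).1 hU).2.2 k ?_
        rintro rfl
        exact hUV (shift_zero n U).symm
      · exact absurd (hU.shift_eq k).symm hUV
    · have := (disjoint_polygon_iff hc).1 (hP.disjoint _ hE _ hF hEF) 0
      rwa [shift_zero] at this
  have shape : ∀ U ∈ blocks n c P, IsBlockShape n c U := by
    rintro U ⟨E, hE, hU, rfl⟩
    exact isBlockShape_of_vertexSet hU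
  refine ⟨shape, ?_, ?_, ?_, shift_mem⟩
  · intro i
    obtain ⟨E, hE, hi⟩ := hP.covers i
    obtain ⟨U, hU, rfl⟩ := hP.curved E hE
    obtain ⟨k, hk⟩ := (markedPoint_mem_polygon_iff hc).1 hi
    exact ⟨_, shift_mem U ⟨_, hE, hU, rfl⟩ k, hk⟩
  · intro U hU V hV hUV
    exact ((disjoint_hull_iff_not_cross hc (shape U hU)).1 (key U hU V hV hUV)).1
  · intro U hU V hV hUV
    exact ((disjoint_hull_iff_not_cross hc (shape U hU)).1 (key U hU V hV hUV)).2

theorem IsNoncrossingPartition.image_polygon_blocks {P : Set (Set (Annulus n))}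
    (hP : IsNoncrossingPartition n c P) : polygon n c '' blocks n c P = P := by
  ext E
  constructor
  · rintro ⟨U, ⟨F, hF, -, rfl⟩, rfl⟩
    exact hF
  · intro hE
    obtain ⟨U, hU, rfl⟩ := hP.curved E hE
    exact ⟨U, ⟨_, hE, hU, rfl⟩, rfl⟩

namespace IsBlockPartition

variable {B : Set (Set ℤ)}

theorem eq_of_mem (hB : IsBlockPartition n c B) {U V : Set ℤ} (hU : U ∈ B) (hV : V ∈ B) {i : ℤ}
    (hiU : i ∈ U) (hiV : i ∈ V) : U = V := by
  by_contra h
  exact Set.disjoint_left.1 (hB.disjoint U hU V hV h) hiU hiV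

theorem disjoint_hull (hB : IsBlockPartition n c B) (hc : IsPeriodicDerangement n c) {U V : Set ℤ}
    (hU : U ∈ B) (hV : V ∈ B) (h : U ≠ V) : Disjoint (hull c U) (hull c V) :=
  (disjoint_hull_iff_not_cross hc (hB.shape U hU)).2
    ⟨hB.disjoint U hU V hV h, hB.not_cross U hU V hV h⟩

/-- Embedding comes for free: the nontrivial translates of a finite block are other blocks of the
same noncrossing partition. -/
theorem isDiskVertexSet (hB : IsBlockPartition n c B) (hc : IsPeriodicDerangement n c) {U : Set ℤ}
    (hU : U ∈ B) (hfin : U.Finite) : IsDiskVertexSet n c U := by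
  have hne := (hB.shape U hU).nonempty
  exact (isDiskVertexSet_iff hc).2 ⟨hfin, hne, fun k hk =>
    hB.disjoint_hull hc hU (hB.shift_mem U hU k) (shift_ne_self hc.pos hfin hne hk).symm⟩

theorem vertexSet (hB : IsBlockPartition n c B) (hc : IsPeriodicDerangement n c) {U : Set ℤ}
    (hU : U ∈ B) : IsDiskVertexSet n c U ∨ IsAnnularVertexSet n c U :=
  (hB.shape U hU).imp_left fun h => hB.isDiskVertexSet hc hU h.1

theorem isNoncrossingPartition (hB : IsBlockPartition n c B) (hc : IsPeriodicDerangement n c) :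
    IsNoncrossingPartition n c (polygon n c '' B) := by
  refine ⟨?_, ?_, ?_⟩
  · rintro _ ⟨U, hU, rfl⟩
    exact ⟨U, hB.vertexSet hc hU, rfl⟩
  · rintro _ ⟨U, hU, rfl⟩ _ ⟨V, hV, rfl⟩ hUV
    refine (disjoint_polygon_iff hc).2 fun k => hB.disjoint_hull hc hU (hB.shift_mem V hV k) ?_
    rintro rfl
    exact hUV (polygon_shift hc V k)
  · intro i
    obtain ⟨U, hU, hi⟩ := hB.covers i
    exact ⟨_, ⟨U, hU, rfl⟩, (markedPoint_mem_polygon_iff hc).2 ⟨0, by rwa [shift_zero]⟩⟩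

theorem blocks_image_polygon (hB : IsBlockPartition n c B) (hc : IsPeriodicDerangement n c) :
    blocks n c (polygon n c '' B) = B := by
  ext V
  constructor
  · rintro ⟨_, ⟨U, hU, rfl⟩, hV, h⟩
    obtain ⟨k, rfl⟩ := exists_eq_shift_of_polygon_eq hc (hB.vertexSet hc hU) hV h.symm
    exact hB.shift_mem U hU k
  · intro hV
    exact ⟨_, ⟨V, hV, rfl⟩, hB.vertexSet hc hV, rfl⟩

/-- There is at most one infinite block. -/
theorem eq_of_isAnnularVertexSet (hB : IsBlockPartition n c B) (hc : IsPeriodicDerangement n c)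
    {U V : Set ℤ} (hU : U ∈ B) (hV : V ∈ B) (hU' : IsAnnularVertexSet n c U)
    (hV' : IsAnnularVertexSet n c V) : U = V := by
  by_contra hUV
  apply hB.not_cross U hU V hV hUV
  obtain ⟨-, ⟨x, hx, hxL⟩, ⟨y, hy, hyR⟩⟩ := hU'
  rw [hc.mem_Rbar_iff] at hyR
  obtain ⟨hper, ⟨v, hv, -⟩, -⟩ := hV'
  have hper' := add_mul_mem_iff_of_add_mem_iff hper
  have hbd : ∀ z : ℤ, ∃ a ∈ V, ∃ b ∈ V, a < z ∧ z < b := by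
    intro z
    obtain ⟨k, hk⟩ := exists_mul_lt hc.pos v z
    obtain ⟨l, hl⟩ := exists_mul_gt hc.pos v z
    exact ⟨_, (hper' v k).2 hv, _, (hper' v l).2 hv, hk, hl⟩
  -- As `V` is unbounded in both directions, it passes below the outer vertex `x` and above the
  -- inner vertex `y` of `U`.
  exact ⟨⟨x, Or.inl ⟨hx, hxL, hbd x⟩⟩, ⟨y, Or.inr ⟨hy, hyR, hbd y⟩⟩⟩

end IsBlockPartition

end

/-! ### Blocks of a set of arcs -/

/-- Some arc of `A` goes from `x` to `y`. -/
def Step (A : Set Arc) (x y : ℤ) : Prop := ∃ α ∈ A, α.p = x ∧ α.q = y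

/-- Distinct arcs of `A` have distinct initial points and distinct final points. -/
def HasDistinctEnds (A : Set Arc) : Prop :=
  ∀ α ∈ A, ∀ β ∈ A, α ≠ β → α.p ≠ β.p ∧ α.q ≠ β.q

/-- `S` is a union of connected components of `A`. -/
def IsArcClosed (A : Set Arc) (S : Set ℤ) : Prop := ∀ x y, Step A x y → (x ∈ S ↔ y ∈ S)

/-- `S` is the set of points of a connected component of `A`. -/
structure IsArcBlock (A : Set Arc) (S : Set ℤ) : Prop where
  nonempty : S.Nonempty
  closed : IsArcClosed A S
  step : ∀ p ∈ S, ∀ q ∈ S, p < q → (∀ s ∈ S, ¬ (p < s ∧ s < q)) → Step A p q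

section

variable {A : Set Arc} {S T : Set ℤ}

theorem Step.lt {x y : ℤ} (h : Step A x y) : x < y := by
  obtain ⟨α, -, rfl, rfl⟩ := h
  exact α.lt

theorem HasDistinctEnds.eq_of_p (hA : HasDistinctEnds A) {α β : Arc} (hα : α ∈ A) (hβ : β ∈ A)
    (h : α.p = β.p) : α = β := by
  by_contra hne
  exact (hA α hα β hβ hne).1 h

theorem HasDistinctEnds.eq_of_q (hA : HasDistinctEnds A) {α β : Arc} (hα : α ∈ A) (hβ : β ∈ A)
    (h : α.q = β.q) : α = β := by
  by_contra hne
  exact (hA α hα β hβ hne).2 h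

theorem HasDistinctEnds.step_right_unique (hA : HasDistinctEnds A) {x y z : ℤ} (h : Step A x y)
    (h' : Step A x z) : y = z := by
  obtain ⟨α, hα, rfl, rfl⟩ := h
  obtain ⟨β, hβ, h1, rfl⟩ := h'
  rw [hA.eq_of_p hα hβ h1.symm]

theorem HasDistinctEnds.step_left_unique (hA : HasDistinctEnds A) {x y z : ℤ} (h : Step A x z)
    (h' : Step A y z) : x = y := by
  obtain ⟨α, hα, rfl, rfl⟩ := h
  obtain ⟨β, hβ, rfl, h1⟩ := h'
  rw [hA.eq_of_q hα hβ h1.symm]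

/-- Any two elements of `S` are joined through consecutive elements of `S`, each an arc away from
the preceding one, and `T` is closed under arcs. -/
theorem IsArcBlock.subset (hS : IsArcBlock A S) (hT : IsArcClosed A T) {x : ℤ} (hxS : x ∈ S)
    (hxT : x ∈ T) : S ⊆ T := by
  have key : ∀ d : ℕ, ∀ y ∈ S, ∀ z ∈ S, y ≤ z → z - y ≤ d → (y ∈ T ↔ z ∈ T) := by
    intro d
    induction d with
    | zero =>
      intro y _ z _ h1 h2
      rw [show y = z by omega]
    | succ d ih =>
      intro y hy z hz h1 h2
      rcases h1.eq_or_lt with rfl | h1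
      · rfl
      obtain ⟨q, hq, h3, h4, h5⟩ := exists_next hz h1
      rw [hT _ _ (hS.step y hy q hq h3 h5)]
      exact ih q hq z hz h4 (by omega)
  intro y hy
  rcases le_total x y with h | h
  · exact (key (y - x).toNat x hxS y hy h (by omega)).1 hxT
  · exact (key (x - y).toNat y hy x hxS h (by omega)).2 hxT

theorem IsArcBlock.eq_of_mem (hS : IsArcBlock A S) (hT : IsArcBlock A T) {x : ℤ} (hxS : x ∈ S)
    (hxT : x ∈ T) : S = T :=
  (hS.subset hT.closed hxS hxT).antisymm (hT.subset hS.closed hxT hxS)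

theorem IsArcBlock.disjoint (hS : IsArcBlock A S) (hT : IsArcBlock A T) (h : S ≠ T) :
    Disjoint S T :=
  Set.disjoint_left.2 fun _ h1 h2 => h (hS.eq_of_mem hT h1 h2)

theorem IsArcBlock.not_between (hA : HasDistinctEnds A) (hS : IsArcBlock A S) {x y : ℤ}
    (hx : x ∈ S) (h : Step A x y) : ∀ s ∈ S, ¬ (x < s ∧ s < y) := by
  rintro s hs ⟨h1, h2⟩
  obtain ⟨q, hq, h3, h4, h5⟩ := exists_next hs h1
  have := hA.step_right_unique h (hS.step x hx q hq h3 h5)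
  omega

/-- Every point belongs to a block. -/
theorem HasDistinctEnds.exists_isArcBlock (hA : HasDistinctEnds A) (x : ℤ) :
    ∃ S, IsArcBlock A S ∧ x ∈ S := by
  have hru : Relator.RightUnique (Step A) := fun _ _ _ h h' => hA.step_right_unique h h'
  have hlu : Relator.RightUnique (Function.swap (Step A)) :=
    fun _ _ _ h h' => hA.step_left_unique h h'
  have hle : ∀ {y z}, Relation.ReflTransGen (Step A) y z → y ≤ z := by
    intro y z h
    induction h with
    | refl => exact le_rfl
    | tail _ h ih => exact ih.trans h.lt.le
  -- At most one arc leaves and at most one arc enters each point, so the component of `x` consists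
  -- of its forward and backward orbits, which form one linearly ordered path.
  refine ⟨{y | Relation.ReflTransGen (Step A) x y ∨ Relation.ReflTransGen (Step A) y x},
    ⟨⟨x, Or.inl .refl⟩, ?_, ?_⟩, Or.inl .refl⟩
  · intro y z hyz
    constructor
    · rintro (h | h)
      · exact Or.inl (h.tail hyz)
      · rcases h.cases_head with rfl | ⟨w, hw, h⟩
        · exact Or.inl (.single hyz)
        · rw [hA.step_right_unique hyz hw]
          exact Or.inr h
    · rintro (h | h)
      · rcases h.cases_tail with rfl | ⟨w, h, hw⟩
        · exact Or.inr (.single hyz)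
        · rw [hA.step_left_unique hyz hw]
          exact Or.inl h
      · exact Or.inr (.head hyz h)
  · intro p hp q hq hpq hcons
    have htot : Relation.ReflTransGen (Step A) p q ∨ Relation.ReflTransGen (Step A) q p := by
      rcases hp with hp | hp <;> rcases hq with hq | hq
      · exact Relation.ReflTransGen.total_of_right_unique hru hp hq
      · exact Or.inr (hq.trans hp)
      · exact Or.inl (hp.trans hq)
      · have := Relation.ReflTransGen.total_of_right_unique hlu
          (Relation.reflTransGen_swap.2 hp) (Relation.reflTransGen_swap.2 hq)
        exact (this.imp Relation.reflTransGen_swap.1 Relation.reflTransGen_swap.1).symm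
    have hto : Relation.ReflTransGen (Step A) p q := by
      rcases htot with h | h
      · exact h
      · have := hle h
        omega
    rcases hto.cases_head with h | ⟨w, hw, h⟩
    · omega
    · have hwmem : Relation.ReflTransGen (Step A) x w ∨ Relation.ReflTransGen (Step A) w x := by
        rcases hp with hp | hp
        · exact Or.inl (hp.tail hw)
        · rcases hp.cases_head with rfl | ⟨w', hw', h'⟩
          · exact Or.inl (.single hw)
          · rw [hA.step_right_unique hw hw']
            exact Or.inr h'
      have h1 := hcons w hwmem
      have h2 := hle h
      have h3 := hw.lt
      rwa [show q = w by omega]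

/-! ### Chains and loops -/

/-- The set of endpoints of the arcs of a chain. -/
def chainSupp (l : List Arc) : Set ℤ := {x | ∃ α ∈ l, x = α.p ∨ x = α.q}

theorem IsArcClosed.chainSupp_subset (hS : IsArcClosed A S) (l : List Arc) :
    ∀ α : Arc, IsPartialChain A (α :: l) → α.p ∈ S → chainSupp (α :: l) ⊆ S := by
  induction l with
  | nil =>
    rintro α ⟨-, hA, -⟩ hα x ⟨β, hβ, h⟩
    obtain rfl : β = α := by simpa using hβ
    have := (hS _ _ ⟨β, hA β (by simp), rfl, rfl⟩).1 hα
    rcases h with rfl | rfl <;> assumption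
  | cons γ l ih =>
    rintro α ⟨-, hA, hch⟩ hα x ⟨β, hβ, h⟩
    rw [List.isChain_cons_cons] at hch
    have hq := (hS _ _ ⟨α, hA α (by simp), rfl, rfl⟩).1 hα
    rcases List.mem_cons.1 hβ with rfl | hβ
    · rcases h with rfl | rfl <;> assumption
    · exact ih γ ⟨by simp, fun δ hδ => hA δ (List.mem_cons_of_mem _ hδ), hch.2⟩ (hch.1 ▸ hq)
        ⟨β, hβ, h⟩

/-- An arc attached to a point of the chain is an arc of the chain, by uniqueness of ends, unless it
is attached at an extremity; there it would extend the chain. -/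
theorem IsFullChain.isArcClosed (hA : HasDistinctEnds A) {l : List Arc} (hl : IsFullChain A l) :
    IsArcClosed A (chainSupp l) := by
  obtain ⟨⟨-, hlA, hch⟩, hmax⟩ := hl
  rintro _ _ ⟨α, hα, rfl, rfl⟩
  constructor
  · rintro ⟨β, hβ, h | h⟩
    · rw [hA.eq_of_p hα (hlA β hβ) h]
      exact ⟨β, hβ, Or.inr rfl⟩
    · obtain ⟨l₁, l₂, rfl⟩ := List.append_of_mem hβ
      rcases l₂ with _ | ⟨γ, l₂⟩
      · refine absurd ⟨by simp, ?_, ?_⟩ (hmax α hα).2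
        · intro δ hδ
          rcases List.mem_append.1 hδ with hδ | hδ
          · exact hlA δ hδ
          · rwa [List.mem_singleton.1 hδ]
        · rw [List.isChain_append]
          refine ⟨hch, by simp, ?_⟩
          simp [h]
      · have hγ : γ ∈ l₁ ++ β :: γ :: l₂ := by simp
        have : β.q = γ.p := by
          rw [List.isChain_append] at hch
          exact (List.isChain_cons_cons.1 hch.2.1).1
        rw [hA.eq_of_p hα (hlA γ hγ) (h.trans this)]
        exact ⟨γ, hγ, Or.inr rfl⟩
  · rintro ⟨β, hβ, h | h⟩
    · obtain ⟨l₁, l₂, rfl⟩ := List.append_of_mem hβ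
      rcases List.eq_nil_or_concat l₁ with rfl | ⟨l₁, γ, rfl⟩
      · refine absurd ⟨by simp, ?_, ?_⟩ (hmax α hα).1
        · intro δ hδ
          rcases List.mem_cons.1 hδ with rfl | hδ
          · exact hα
          · exact hlA δ hδ
        · rw [List.nil_append, List.isChain_cons_cons]
          exact ⟨h, hch⟩
      · have hγ : γ ∈ l₁.concat γ ++ β :: l₂ := by simp
        have : γ.q = β.p := by
          rw [List.isChain_append] at hch
          exact hch.2.2 γ (by simp) β (by simp)
        rw [hA.eq_of_q hα (hlA γ hγ) (h.trans this.symm)]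
        exact ⟨γ, hγ, Or.inl rfl⟩
    · rw [hA.eq_of_q hα (hlA β hβ) h]
      exact ⟨β, hβ, Or.inl rfl⟩

theorem chainSupp_finite (l : List Arc) : (chainSupp l).Finite := by
  have : chainSupp l = ⋃ α ∈ {α | α ∈ l}, {α.p, α.q} := by
    ext x
    simp [chainSupp]
  rw [this]
  exact l.finite_toSet.biUnion fun α _ => by simp

theorem IsChainSupport.isArcBlock (hA : HasDistinctEnds A) (h : IsChainSupport A S) :
    IsArcBlock A S ∧ S.Finite := by
  rcases h with ⟨l, hl, rfl⟩ | ⟨x, hx, rfl⟩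
  · change IsArcBlock A (chainSupp l) ∧ (chainSupp l).Finite
    refine ⟨?_, chainSupp_finite l⟩
    obtain ⟨α, l', rfl⟩ := List.exists_cons_of_ne_nil hl.1.1
    -- The support is compared with the component of the first point: a chain is connected, hence
    -- inside it, and a full chain is closed, hence contains it.
    obtain ⟨U, hU, hαU⟩ := hA.exists_isArcBlock α.p
    have h1 := hU.closed.chainSupp_subset l' α hl.1 hαU
    have h2 := hU.subset (hl.isArcClosed hA) hαU ⟨α, by simp, Or.inl rfl⟩
    rwa [h1.antisymm h2]
  · refine ⟨⟨by simp, ?_, ?_⟩, by simp⟩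
    · rintro _ _ ⟨α, hα, rfl, rfl⟩
      simp [(hx α hα).1.symm, (hx α hα).2.symm]
    · rintro p rfl q rfl h
      exact absurd h (lt_irrefl _)

theorem IsLoop.isArcClosed (hA : HasDistinctEnds A) {f : ℤ → Arc} (hf : IsLoop A f) :
    IsArcClosed A (loopSupp f) := by
  rintro _ _ ⟨α, hα, rfl, rfl⟩
  constructor
  · rintro ⟨i, h | h⟩
    · rw [hA.eq_of_p hα (hf i).1 h]
      exact ⟨i, Or.inr rfl⟩
    · rw [hA.eq_of_p hα (hf (i + 1)).1 (h.trans (hf i).2)]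
      exact ⟨i + 1, Or.inr rfl⟩
  · rintro ⟨i, h | h⟩
    · have := (hf (i - 1)).2
      rw [sub_add_cancel] at this
      rw [hA.eq_of_q hα (hf (i - 1)).1 (h.trans this.symm)]
      exact ⟨i - 1, Or.inl rfl⟩
    · rw [hA.eq_of_q hα (hf i).1 h]
      exact ⟨i, Or.inl rfl⟩

theorem IsArcClosed.loopSupp_subset (hS : IsArcClosed A S) {f : ℤ → Arc} (hf : IsLoop A f)
    (h0 : (f 0).p ∈ S) : loopSupp f ⊆ S := by
  have hstep : ∀ i, (f i).p ∈ S ↔ (f i).q ∈ S := fun i => hS _ _ ⟨f i, (hf i).1, rfl, rfl⟩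
  have key : ∀ i : ℤ, (f i).p ∈ S := by
    intro i
    induction i using Int.induction_on with
    | zero => exact h0
    | succ i ih => rwa [← (hf i).2, ← hstep]
    | pred i ih =>
      have := (hf (-i - 1)).2
      rw [sub_add_cancel] at this
      rwa [hstep, this]
  rintro x ⟨i, rfl | rfl⟩
  · exact key i
  · exact (hstep i).1 (key i)

theorem IsLoop.infinite {f : ℤ → Arc} (hf : IsLoop A f) : (loopSupp f).Infinite := by
  intro hfin
  obtain ⟨M, ⟨i, hM⟩, hmax⟩ := Set.exists_max_image _ id hfin ⟨(f 0).p, 0, Or.inl rfl⟩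
  have h1 := hmax _ ⟨i, Or.inr rfl⟩
  have h2 := hmax _ ⟨i + 1, Or.inr rfl⟩
  have h3 := (hf i).2
  have h4 := (f i).lt
  have h5 := (f (i + 1)).lt
  simp only [id] at h1 h2
  omega

theorem IsLoopSupport.isArcBlock (hA : HasDistinctEnds A) (h : IsLoopSupport A S) :
    IsArcBlock A S ∧ S.Infinite := by
  obtain ⟨f, hf, rfl⟩ := h
  refine ⟨?_, hf.infinite⟩
  obtain ⟨U, hU, hfU⟩ := hA.exists_isArcBlock (f 0).p
  have h1 := hU.closed.loopSupp_subset hf hfU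
  have h2 := hU.subset (hf.isArcClosed hA) hfU ⟨0, Or.inl rfl⟩
  rwa [h1.antisymm h2]

theorem IsArcBlock.exists_partialChain (hS : IsArcBlock A S) {M : ℤ} (hM : M ∈ S) :
    ∀ d : ℕ, ∀ x ∈ S, x < M → M - x ≤ d →
      ∃ l α, IsPartialChain A (α :: l) ∧ α.p = x ∧ ∃ β ∈ (α :: l).getLast?, β.q = M := by
  intro d
  induction d with
  | zero => intro x _ h1 h2; omega
  | succ d ih =>
    intro x hx h1 h2
    obtain ⟨q, hq, h3, h4, h5⟩ := exists_next hM h1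
    obtain ⟨α, hα, hαp, hαq⟩ := hS.step x hx q hq h3 h5
    rcases h4.eq_or_lt with rfl | h4
    · exact ⟨[], α, ⟨by simp, by simpa using hα, by simp⟩, hαp, α, by simp, hαq⟩
    · obtain ⟨l, γ, ⟨-, hlA, hch⟩, hγ, β, hβ, hβq⟩ := ih q hq h4 (by omega)
      refine ⟨γ :: l, α, ⟨by simp, ?_, ?_⟩, hαp, β, by simpa using hβ, hβq⟩
      · intro δ hδ
        rcases List.mem_cons.1 hδ with rfl | hδ
        · exact hα
        · exact hlA δ hδ
      · rw [List.isChain_cons_cons]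
        exact ⟨by rw [hαq, hγ], hch⟩

theorem IsArcBlock.isChainSupport (hA : HasDistinctEnds A) (hS : IsArcBlock A S)
    (hfin : S.Finite) : IsChainSupport A S := by
  obtain ⟨m, hm, hmin⟩ := Set.exists_min_image S id hfin hS.nonempty
  obtain ⟨M, hM, hmax⟩ := Set.exists_max_image S id hfin hS.nonempty
  simp only [id] at hmin hmax
  rcases (hmin M hM).eq_or_lt with h | h
  · right
    have hSm : S = {m} := by
      ext x
      rw [Set.mem_singleton_iff]
      refine ⟨fun hx => ?_, fun hx => hx ▸ hm⟩
      have := hmin x hx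
      have := hmax x hx
      omega
    refine ⟨m, fun α hα => ?_, hSm⟩
    have h1 := hS.closed _ _ ⟨α, hα, rfl, rfl⟩
    have h2 := α.lt
    rw [hSm, Set.mem_singleton_iff, Set.mem_singleton_iff] at h1
    omega
  · left
    obtain ⟨l, α, hl, hα, β, hβ, hβq⟩ :=
      hS.exists_partialChain hM (M - m).toNat m hm h (by omega)
    have hfull : IsFullChain A (α :: l) := by
      refine ⟨hl, fun γ hγ => ⟨fun h' => ?_, fun h' => ?_⟩⟩
      · have h1 := (List.isChain_cons_cons.1 h'.2.2).1
        have h2 := hmin γ.p ((hS.closed _ _ ⟨γ, hγ, rfl, rfl⟩).2 (by rwa [h1, hα]))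
        have := γ.lt
        omega
      · have h1 := (List.isChain_append.1 h'.2.2).2.2 β hβ γ (by simp)
        have h2 := hmax γ.q ((hS.closed _ _ ⟨γ, hγ, rfl, rfl⟩).1 (by rwa [← h1, hβq]))
        have := γ.lt
        omega
    refine ⟨_, hfull, ?_⟩
    exact hS.eq_of_mem (IsChainSupport.isArcBlock hA (Or.inl ⟨_, hfull, rfl⟩)).1 hm
      ⟨α, by simp, Or.inl hα.symm⟩

/-- Without extremal elements, passing to the next element is a permutation `e` of `S`; its integer
powers at a base point run through a bi-infinite sequence of arcs. -/
theorem IsArcBlock.isLoopSupport (hA : HasDistinctEnds A) (hS : IsArcBlock A S)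
    (hup : ∀ x ∈ S, ∃ y ∈ S, x < y) (hdown : ∀ x ∈ S, ∃ y ∈ S, y < x) : IsLoopSupport A S := by
  have hout : ∀ x : S, ∃ α ∈ A, α.p = x ∧ α.q ∈ S := by
    rintro ⟨x, hx⟩
    obtain ⟨y, hy, hxy⟩ := hup x hx
    obtain ⟨q, hq, h3, -, h5⟩ := exists_next hy hxy
    obtain ⟨α, hα, h6, h7⟩ := hS.step x hx q hq h3 h5
    exact ⟨α, hα, h6, h7 ▸ hq⟩
  choose a ha hap haq using hout
  have hinj : Function.Injective fun x : S => (⟨(a x).q, haq x⟩ : S) := by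
    intro x y hxy
    have h1 : a x = a y := hA.eq_of_q (ha x) (ha y) (congrArg Subtype.val hxy)
    exact Subtype.ext ((hap x).symm.trans ((congrArg Arc.p h1).trans (hap y)))
  have hsurj : Function.Surjective fun x : S => (⟨(a x).q, haq x⟩ : S) := by
    rintro ⟨y, hy⟩
    obtain ⟨x, hx, hxy⟩ := hdown y hy
    obtain ⟨p, hp, h3, -, h5⟩ := exists_prev hx hxy
    obtain ⟨α, hα, h6, h7⟩ := hS.step p hp y hy h3 h5
    have h8 : α = a ⟨p, hp⟩ := hA.eq_of_p hα (ha ⟨p, hp⟩) (h6.trans (hap ⟨p, hp⟩).symm)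
    exact ⟨⟨p, hp⟩, Subtype.ext ((congrArg Arc.q h8).symm.trans h7)⟩
  let e : Equiv.Perm S := Equiv.ofBijective _ ⟨hinj, hsurj⟩
  obtain ⟨x₀, hx₀⟩ := hS.nonempty
  have hloop : IsLoop A fun i => a ((e ^ i) ⟨x₀, hx₀⟩) := by
    intro i
    refine ⟨ha _, ?_⟩
    rw [hap, add_comm, zpow_add, zpow_one, Equiv.Perm.mul_apply]
    rfl
  refine ⟨_, hloop, ?_⟩
  refine hS.eq_of_mem (IsLoopSupport.isArcBlock hA ⟨_, hloop, rfl⟩).1 hx₀ ⟨0, Or.inl ?_⟩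
  rw [hap]
  rfl

end

/-! ### Arc diagrams and partitions of the integers -/

section

variable {n : ℕ} {c : Equiv.Perm ℤ}

/-- The borders dictate on which side of the arc each intermediate point lies, so that an arc is
determined by its ends. -/
theorem Arc.mem_L_iff (hc : IsPeriodicDerangement n c) {α : Arc} (hL : α.L ⊆ Lbar c)
    (hR : α.R ⊆ Rbar c) {x : ℤ} : x ∈ α.L ↔ α.p < x ∧ x < α.q ∧ x ∈ Lbar c := by
  have h := Set.ext_iff.1 α.union_eq x
  have h1 := @hL x
  have h2 := @hR x
  rw [hc.mem_Rbar_iff] at h2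
  simp only [Set.mem_union, Set.mem_Ioo] at h
  tauto

theorem Arc.mem_R_iff (hc : IsPeriodicDerangement n c) {α : Arc} (hL : α.L ⊆ Lbar c)
    (hR : α.R ⊆ Rbar c) {x : ℤ} : x ∈ α.R ↔ α.p < x ∧ x < α.q ∧ x ∉ Lbar c := by
  have h := Set.ext_iff.1 α.union_eq x
  have h1 := @hL x
  have h2 := @hR x
  rw [hc.mem_Rbar_iff] at h2
  simp only [Set.mem_union, Set.mem_Ioo] at h
  tauto

theorem Arc.ext_of_subset (hc : IsPeriodicDerangement n c) {α β : Arc} (hL : α.L ⊆ Lbar c)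
    (hR : α.R ⊆ Rbar c) (hL' : β.L ⊆ Lbar c) (hR' : β.R ⊆ Rbar c) (hp : α.p = β.p)
    (hq : α.q = β.q) : α = β := by
  refine Arc.ext hp hq ?_ ?_ <;> ext x
  · rw [Arc.mem_L_iff hc hL hR, Arc.mem_L_iff hc hL' hR', hp, hq]
  · rw [Arc.mem_R_iff hc hL hR, Arc.mem_R_iff hc hL' hR', hp, hq]

theorem exists_pair_between_iff {p q x : ℤ} (h : p < q) :
    (∃ u ∈ ({p, q} : Set ℤ), ∃ u' ∈ ({p, q} : Set ℤ), u < x ∧ x < u') ↔ p < x ∧ x < q := by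
  constructor
  · rintro ⟨u, rfl | rfl, u', rfl | rfl, h1, h2⟩ <;> omega
  · exact fun h' => ⟨p, by simp, q, by simp, h'⟩

/-- No point lies to the left of one arc and to the right of the other, since these sides are on
different borders. Only the terms involving endpoints survive, and they express `Over`; the two
halves occur in opposite orders. -/
theorem Arc.crosses_iff (hc : IsPeriodicDerangement n c) {α β : Arc} (hL : α.L ⊆ Lbar c)
    (hR : α.R ⊆ Rbar c) (hL' : β.L ⊆ Lbar c) (hR' : β.R ⊆ Rbar c) :
    α.Crosses β ↔ Cross c {α.p, α.q} {β.p, β.q} := by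
  rw [Arc.Crosses, Cross, and_comm]
  refine and_congr (exists_congr fun x => ?_) (exists_congr fun x => ?_)
  · simp only [Over, exists_pair_between_iff α.lt, exists_pair_between_iff β.lt, Set.mem_union,
      Set.mem_inter_iff, Arc.mem_R_iff hc hL hR, Arc.mem_L_iff hc hL' hR']
    tauto
  · simp only [Over, exists_pair_between_iff α.lt, exists_pair_between_iff β.lt, Set.mem_union,
      Set.mem_inter_iff, Arc.mem_L_iff hc hL hR, Arc.mem_R_iff hc hL' hR']
    tauto

/-- The arc from `p` to `q` which passes below the points of `Lbar c` and above the others. -/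
def arcBetween (c : Equiv.Perm ℤ) (p q : ℤ) (h : p < q) : Arc where
  p := p
  q := q
  L := Set.Ioo p q ∩ Lbar c
  R := Set.Ioo p q ∩ (Lbar c)ᶜ
  lt := h
  union_eq := by rw [← Set.inter_union_distrib_left, Set.union_compl_self, Set.inter_univ]
  disj := by
    rw [Set.disjoint_left]
    exact fun x h1 h2 => h2.2 h1.2

/-- The arcs between consecutive elements of the members of `B`. -/
def arcsOf (c : Equiv.Perm ℤ) (B : Set (Set ℤ)) : Set Arc :=
  {α | (∃ U ∈ B, α.p ∈ U ∧ α.q ∈ U ∧ ∀ u ∈ U, ¬ (α.p < u ∧ u < α.q)) ∧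
    α.L ⊆ Lbar c ∧ α.R ⊆ Rbar c}

theorem arcDiagram_eq (n : ℕ) (c : Equiv.Perm ℤ) (P : Set (Set (Annulus n))) :
    arcDiagram n c P = arcsOf c (blocks n c P) := by
  ext α
  refine and_congr_left fun _ => ?_
  constructor
  · rintro ⟨E, hE, U, hU, h⟩
    exact ⟨U, ⟨E, hE, hU⟩, h⟩
  · rintro ⟨U, ⟨E, hE, hU⟩, h⟩
    exact ⟨E, hE, U, hU, h⟩

/-! ### From block partitions to arc diagrams -/

namespace IsBlockPartition

variable {B : Set (Set ℤ)}

theorem hasDistinctEnds (hB : IsBlockPartition n c B) (hc : IsPeriodicDerangement n c) :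
    HasDistinctEnds (arcsOf c B) := by
  rintro α ⟨⟨U, hU, hαp, hαq, hα⟩, hαL, hαR⟩ β ⟨⟨V, hV, hβp, hβq, hβ⟩, hβL, hβR⟩ hαβ
  have h1 := α.lt
  have h2 := β.lt
  constructor
  · intro h
    obtain rfl : U = V := hB.eq_of_mem hU hV hαp (h ▸ hβp)
    have h3 := hα _ hβq
    have h4 := hβ _ hαq
    exact hαβ (Arc.ext_of_subset hc hαL hαR hβL hβR h (by omega))
  · intro h
    obtain rfl : U = V := hB.eq_of_mem hU hV hαq (h ▸ hβq)
    have h3 := hα _ hβp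
    have h4 := hβ _ hαp
    exact hαβ (Arc.ext_of_subset hc hαL hαR hβL hβR (by omega) h)

theorem isArcBlock (hB : IsBlockPartition n c B) (hc : IsPeriodicDerangement n c) {U : Set ℤ}
    (hU : U ∈ B) : IsArcBlock (arcsOf c B) U := by
  refine ⟨(hB.shape U hU).nonempty, ?_, ?_⟩
  · rintro _ _ ⟨α, ⟨⟨V, hV, hp, hq, -⟩, -⟩, rfl, rfl⟩
    constructor
    · intro h
      rwa [hB.eq_of_mem hU hV h hp]
    · intro h
      rwa [hB.eq_of_mem hU hV h hq]
  · intro p hp q hq hpq h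
    refine ⟨arcBetween c p q hpq, ⟨⟨U, hU, hp, hq, h⟩, Set.inter_subset_right, ?_⟩, rfl, rfl⟩
    rintro x ⟨-, hx⟩
    exact hc.mem_Rbar_iff.2 hx

/-- The blocks cover `ℤ` and a component is determined by any of its points, so there is no
component besides the blocks. The injectivity of the construction rests on this. -/
theorem mem_iff_isArcBlock (hB : IsBlockPartition n c B) (hc : IsPeriodicDerangement n c)
    {U : Set ℤ} : U ∈ B ↔ IsArcBlock (arcsOf c B) U := by
  refine ⟨hB.isArcBlock hc, fun hU => ?_⟩
  obtain ⟨x, hx⟩ := hU.nonempty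
  obtain ⟨V, hV, hxV⟩ := hB.covers x
  rwa [hU.eq_of_mem (hB.isArcBlock hc hV) hx hxV]

theorem isAnnularVertexSet (hB : IsBlockPartition n c B) {U : Set ℤ} (hU : U ∈ B)
    (h : U.Infinite) : IsAnnularVertexSet n c U :=
  (hB.shape U hU).resolve_left fun h' => h h'.1

theorem isChainSupport_iff (hB : IsBlockPartition n c B) (hc : IsPeriodicDerangement n c)
    {U : Set ℤ} : IsChainSupport (arcsOf c B) U ↔ U ∈ B ∧ U.Finite := by
  rw [hB.mem_iff_isArcBlock hc]
  exact ⟨fun h => h.isArcBlock (hB.hasDistinctEnds hc),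
    fun h => h.1.isChainSupport (hB.hasDistinctEnds hc) h.2⟩

theorem isLoopSupport_iff (hB : IsBlockPartition n c B) (hc : IsPeriodicDerangement n c)
    {U : Set ℤ} : IsLoopSupport (arcsOf c B) U ↔ U ∈ B ∧ U.Infinite := by
  rw [hB.mem_iff_isArcBlock hc]
  refine ⟨fun h => h.isArcBlock (hB.hasDistinctEnds hc), fun h => ?_⟩
  have hper := (hB.isAnnularVertexSet ((hB.mem_iff_isArcBlock hc).2 h.1) h.2).1
  have := hc.pos
  refine h.1.isLoopSupport (hB.hasDistinctEnds hc) (fun x hx => ⟨x + n, (hper x).2 hx, by omega⟩)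
    fun x hx => ⟨x - n, (hper _).1 (by simpa using hx), by omega⟩

theorem isCyclicCNoncrossing (hB : IsBlockPartition n c B) (hc : IsPeriodicDerangement n c) :
    IsCyclicCNoncrossing n c (arcsOf c B) where
  translate_mem := by
    have hsub : ∀ α : Arc, ((α.translate n).L ⊆ Lbar c ↔ α.L ⊆ Lbar c) ∧
        ((α.translate n).R ⊆ Rbar c ↔ α.R ⊆ Rbar c) := by
      intro α
      have hl : ∀ x : ℤ, x + n ∈ Lbar c ↔ x ∈ Lbar c := fun x => by
        simpa using hc.add_mul_mem_Lbar (i := x) (k := 1)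
      have hr : ∀ x : ℤ, x + n ∈ Rbar c ↔ x ∈ Rbar c := fun x => by
        simpa using hc.add_mul_mem_Rbar (i := x) (k := 1)
      refine ⟨⟨fun h x hx => ?_, fun h x hx => ?_⟩, ⟨fun h x hx => ?_, fun h x hx => ?_⟩⟩
      · exact (hl x).1 (h (show x + n - n ∈ α.L by simpa using hx))
      · have := (hl _).2 (h (show x - n ∈ α.L from hx))
        simpa using this
      · exact (hr x).1 (h (show x + n - n ∈ α.R by simpa using hx))
      · have := (hr _).2 (h (show x - n ∈ α.R from hx))
        simpa using this
    have hshift : ∀ (U : Set ℤ) (k x : ℤ), x ∈ shift n k U ↔ x - k * n ∈ U :=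
      fun U k x => mem_shift_iff
    intro α
    refine and_congr ?_ (and_congr (hsub α).1 (hsub α).2)
    constructor
    · rintro ⟨U, hU, hp, hq, h⟩
      refine ⟨_, hB.shift_mem U hU (-1), ?_, ?_, ?_⟩
      · rw [hshift]; simpa [Arc.translate] using hp
      · rw [hshift]; simpa [Arc.translate] using hq
      · intro u hu h'
        rw [hshift] at hu
        refine h _ hu ?_
        simp only [Arc.translate]
        omega
    · rintro ⟨U, hU, hp, hq, h⟩
      refine ⟨_, hB.shift_mem U hU 1, ?_, ?_, ?_⟩
      · rw [hshift]; simpa [Arc.translate] using hp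
      · rw [hshift]; simpa [Arc.translate] using hq
      · intro u hu h'
        rw [hshift] at hu
        refine h _ hu ?_
        simp only [Arc.translate] at h'
        omega
  noncrossing := by
    intro α hα β hβ hαβ
    refine ⟨?_, hB.hasDistinctEnds hc α hα β hβ hαβ⟩
    obtain ⟨⟨U, hU, hαp, hαq, hα⟩, hαL, hαR⟩ := hα
    obtain ⟨⟨V, hV, hβp, hβq, hβ⟩, hβL, hβR⟩ := hβ
    rw [Arc.crosses_iff hc hαL hαR hβL hβR]
    intro h
    -- Within one block, a crossing would put an end of one arc strictly between the ends of the
    -- other, which are consecutive.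
    by_cases hUV : U = V
    · subst hUV
      obtain ⟨x, ⟨hx, -, hx'⟩ | ⟨hx, -, hx'⟩⟩ := h.1
      · rw [exists_pair_between_iff β.lt] at hx'
        rcases hx with rfl | rfl
        · exact hβ _ hαp hx'
        · exact hβ _ hαq hx'
      · rw [exists_pair_between_iff α.lt] at hx'
        rcases hx with rfl | rfl
        · exact hα _ hβp hx'
        · exact hα _ hβq hx'
    · refine hB.not_cross U hU V hV hUV (h.mono ?_ ?_)
      · rintro x (rfl | rfl) <;> assumption
      · rintro x (rfl | rfl) <;> assumption
  left_sub := fun α hα => hα.2.1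
  right_sub := fun α hα => hα.2.2
  real_loops := by
    intro f hf
    obtain ⟨hU, hinf⟩ := (hB.isLoopSupport_iff hc).1 ⟨f, hf, rfl⟩
    obtain ⟨-, ⟨x, hx, hxL⟩, ⟨y, hy, hyR⟩⟩ := hB.isAnnularVertexSet hU hinf
    exact ⟨fun h => hc.mem_Rbar_iff.1 hyR (h hy), fun h => hc.mem_Rbar_iff.1 (h hx) hxL⟩

end IsBlockPartition

/-! ### From arc diagrams to block partitions -/

namespace IsCyclicCNoncrossing

variable {A : Set Arc}

theorem hasDistinctEnds (hA : IsCyclicCNoncrossing n c A) : HasDistinctEnds A :=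
  fun α hα β hβ h => (hA.noncrossing α hα β hβ h).2

theorem step_add_iff (hA : IsCyclicCNoncrossing n c A) (k x y : ℤ) :
    Step A (x + k * n) (y + k * n) ↔ Step A x y := by
  have h1 : ∀ x y : ℤ, Step A (x + n) (y + n) ↔ Step A x y := by
    intro x y
    constructor
    · rintro ⟨α, hα, hp, hq⟩
      refine ⟨α.translate (-n), ?_, by simp [Arc.translate, hp], by simp [Arc.translate, hq]⟩
      rw [← hA.translate_mem]
      convert hα using 1
      ext <;> simp [Arc.translate]
    · rintro ⟨α, hα, rfl, rfl⟩
      exact ⟨α.translate n, (hA.translate_mem α).2 hα, rfl, rfl⟩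
  induction k using Int.induction_on with
  | zero => simp
  | succ k ih =>
    refine Iff.trans ?_ ih
    rw [show x + (k + 1 : ℤ) * n = x + k * n + n by ring,
      show y + (k + 1 : ℤ) * n = y + k * n + n by ring]
    exact h1 _ _
  | pred k ih =>
    refine Iff.trans (h1 _ _).symm ?_
    rwa [show x + (-k - 1 : ℤ) * n + n = x + -k * n by ring,
      show y + (-k - 1 : ℤ) * n + n = y + -k * n by ring]

theorem isArcBlock_shift (hA : IsCyclicCNoncrossing n c A) {U : Set ℤ} (hU : IsArcBlock A U)
    (k : ℤ) : IsArcBlock A (shift n k U) := by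
  have hstep : ∀ x y : ℤ, Step A (x - k * n) (y - k * n) ↔ Step A x y := by
    intro x y
    rw [← hA.step_add_iff k, sub_add_cancel, sub_add_cancel]
  refine ⟨hU.nonempty.image _, ?_, ?_⟩
  · intro x y h
    rw [mem_shift_iff, mem_shift_iff]
    exact hU.closed _ _ ((hstep x y).2 h)
  · intro p hp q hq hpq h
    rw [mem_shift_iff] at hp hq
    rw [← hstep]
    refine hU.step _ hp _ hq (by omega) fun s hs h' => ?_
    exact h _ (add_mul_mem_shift_iff.2 hs) (by omega)

/-- Induction on the distance between the two places. At a point of `U ∪ V` strictly between them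
one set passes above the other, and this yields a closer pair of opposite places. If there is no
such point, each set has a single arc spanning the interval, and these two arcs cross. -/
theorem not_over (hc : IsPeriodicDerangement n c) (hA : IsCyclicCNoncrossing n c A) :
    ∀ d : ℕ, ∀ U V : Set ℤ, IsArcBlock A U → IsArcBlock A V → Disjoint U V → ∀ x y : ℤ, x < y →
      y - x ≤ d → Over c U V x → ¬ Over c V U y := by
  intro d
  induction d with
  | zero => intro U V _ _ _ x y h1 h2; omega
  | succ d ih =>
    intro U V hU hV hUV x y hxy hd hx hy
    have hbd : ∀ {U V : Set ℤ} {z : ℤ}, Over c U V z →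
        (∃ u ∈ U, u ≤ z) ∧ (∃ v ∈ V, v ≤ z) ∧ (∃ u ∈ U, z ≤ u) ∧ ∃ v ∈ V, z ≤ v := by
      rintro U V z (⟨hz, -, v, hv, v', hv', h1, h2⟩ | ⟨hz, -, u, hu, u', hu', h1, h2⟩)
      · exact ⟨⟨z, hz, le_rfl⟩, ⟨v, hv, h1.le⟩, ⟨z, hz, le_rfl⟩, ⟨v', hv', h2.le⟩⟩
      · exact ⟨⟨u, hu, h1.le⟩, ⟨z, hz, le_rfl⟩, ⟨u', hu', h2.le⟩, ⟨z, hz, le_rfl⟩⟩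
    obtain ⟨⟨u, hu, hux⟩, ⟨v, hv, hvx⟩, -, -⟩ := hbd hx
    obtain ⟨-, -, ⟨v', hv', hyv⟩, ⟨u', hu', hyu⟩⟩ := hbd hy
    by_cases hz : ∃ z, z ∈ U ∪ V ∧ x < z ∧ z < y
    · obtain ⟨z, hz, h1, h2⟩ := hz
      have hz' : Over c U V z ∨ Over c V U z := by
        by_cases hzL : z ∈ Lbar c <;> rcases hz with hz | hz
        · exact Or.inl (Or.inl ⟨hz, hzL, v, hv, v', hv', by omega⟩)
        · exact Or.inr (Or.inl ⟨hz, hzL, u, hu, u', hu', by omega⟩)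
        · exact Or.inr (Or.inr ⟨hz, hzL, v, hv, v', hv', by omega⟩)
        · exact Or.inl (Or.inr ⟨hz, hzL, u, hu, u', hu', by omega⟩)
      rcases hz' with hz' | hz'
      · exact ih U V hU hV hUV z y h2 (by omega) hz' hy
      · exact ih U V hU hV hUV x z h1 (by omega) hx hz'
    · have key : ∀ W ⊆ U ∪ V, IsArcBlock A W → (∃ w ∈ W, w ≤ x) → (∃ w ∈ W, y ≤ w) →
          ∃ α ∈ A, α.p ∈ W ∧ α.q ∈ W ∧ α.p ≤ x ∧ y ≤ α.q ∧ ∀ s ∈ W, ¬ (α.p < s ∧ s < α.q) := by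
        rintro W hWs hW ⟨w, hw, hwx⟩ ⟨w', hw', hyw⟩
        -- The bounds `x + 1` and `y - 1` let the strict searches return `x` and `y` themselves when
        -- they belong to `W`.
        obtain ⟨p, hp, h1, -, h2⟩ := exists_prev hw (show w < x + 1 by omega)
        obtain ⟨q, hq, h3, -, h4⟩ := exists_next hw' (show y - 1 < w' by omega)
        have h5 : ∀ s ∈ W, ¬ (p < s ∧ s < q) := by
          intro s hs h
          have h6 := h2 s hs
          have h7 := h4 s hs
          exact hz ⟨s, hWs hs, by omega, by omega⟩
        obtain ⟨α, hα, rfl, rfl⟩ := hW.step p hp q hq (by omega) h5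
        exact ⟨α, hα, hp, hq, by omega, by omega, h5⟩
      obtain ⟨α, hα, hαp, hαq, h1, h2, h3⟩ := key U Set.subset_union_left hU ⟨u, hu, hux⟩
        ⟨u', hu', hyu⟩
      obtain ⟨β, hβ, hβp, hβq, h4, h5, h6⟩ := key V Set.subset_union_right hV ⟨v, hv, hvx⟩
        ⟨v', hv', hyv⟩
      have hαβ : α ≠ β := fun h => Set.disjoint_left.1 hUV hαp (h ▸ hβp)
      refine (hA.noncrossing α hα β hβ hαβ).1 ((Arc.crosses_iff hc (hA.left_sub α hα)
        (hA.right_sub α hα) (hA.left_sub β hβ) (hA.right_sub β hβ)).2 ⟨⟨x, ?_⟩, ⟨y, ?_⟩⟩)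
      · rw [Over, exists_pair_between_iff α.lt, exists_pair_between_iff β.lt]
        rcases hx with ⟨hx, hxL, -⟩ | ⟨hx, hxL, -⟩
        · have := h3 x hx
          have := hUV.ne_of_mem hx hβp
          exact Or.inl ⟨Or.inl (by omega), hxL, by omega⟩
        · have := h6 x hx
          have := hUV.ne_of_mem hαp hx
          exact Or.inr ⟨Or.inl (by omega), hxL, by omega⟩
      · rw [Over, exists_pair_between_iff α.lt, exists_pair_between_iff β.lt]
        rcases hy with ⟨hy, hyL, -⟩ | ⟨hy, hyL, -⟩
        · have := h6 y hy
          have := hUV.ne_of_mem hαq hy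
          exact Or.inl ⟨Or.inr (by simp only [Set.mem_singleton_iff]; omega), hyL, by omega⟩
        · have := h3 y hy
          have := hUV.ne_of_mem hy hβq
          exact Or.inr ⟨Or.inr (by simp only [Set.mem_singleton_iff]; omega), hyL, by omega⟩

theorem not_cross (hc : IsPeriodicDerangement n c) (hA : IsCyclicCNoncrossing n c A) {U V : Set ℤ}
    (hU : IsArcBlock A U) (hV : IsArcBlock A V) (h : U ≠ V) : ¬ Cross c U V := by
  rintro ⟨⟨x, hx⟩, ⟨y, hy⟩⟩
  have hUV := hU.disjoint hV h
  rcases lt_trichotomy x y with hxy | rfl | hxy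
  · exact hA.not_over hc _ U V hU hV hUV x y hxy (by omega : y - x ≤ ((y - x).toNat : ℤ)) hx hy
  · rw [Set.disjoint_left] at hUV
    rcases hx with ⟨hx, hxL, -⟩ | ⟨hx, hxL, -⟩ <;> rcases hy with ⟨hy, hyL, -⟩ | ⟨hy, hyL, -⟩
    · exact hUV hx hy
    · exact hyL hxL
    · exact hxL hyL
    · exact hUV hy hx
  · exact hA.not_over hc _ V U hV hU hUV.symm y x hxy (by omega : x - y ≤ ((x - y).toNat : ℤ)) hy hx

/-- Two elements of an infinite component are congruent modulo `n`. The corresponding translate is a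
component meeting `U`, hence equal to `U`, which thus has a nonzero period. That this period can be
taken to be `n` requires more. -/
theorem unbounded (hc : IsPeriodicDerangement n c) (hA : IsCyclicCNoncrossing n c A) {U : Set ℤ}
    (hU : IsArcBlock A U) (hinf : U.Infinite) :
    (∀ z : ℤ, ∃ y ∈ U, z < y) ∧ ∀ z : ℤ, ∃ y ∈ U, y < z := by
  have hpos : (0 : ℤ) < n := by exact_mod_cast hc.pos
  obtain ⟨x, hx, y, hy, hxy, hmod⟩ := hinf.exists_ne_map_eq_of_mapsTo (f := fun z => z % (n : ℤ))
    (t := Set.Ico 0 (n : ℤ)) (fun z _ => ⟨Int.emod_nonneg z hpos.ne', Int.emod_lt_of_pos z hpos⟩)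
    (Set.finite_Ico _ _)
  obtain ⟨k, rfl⟩ := modEq_iff_exists_add_mul.1 (show x ≡ y [ZMOD n] from hmod)
  have hk : k ≠ 0 := by
    rintro rfl
    simp at hxy
  have hshift := (hA.isArcBlock_shift hU k).eq_of_mem hU (add_mul_mem_shift_iff.2 hx) hy
  have hper : ∀ i : ℤ, i + ((k.natAbs * n : ℕ) : ℤ) ∈ U ↔ i ∈ U := by
    intro i
    rcases Int.natAbs_eq k with h | h
    · have h1 : ((k.natAbs * n : ℕ) : ℤ) = k * n := by
        rw [Nat.cast_mul, ← h]
      rw [h1]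
      conv_lhs => rw [← hshift]
      exact add_mul_mem_shift_iff
    · have h1 : ((k.natAbs * n : ℕ) : ℤ) = -(k * n) := by
        rw [Nat.cast_mul]
        nth_rw 2 [h]
        ring
      rw [h1, ← sub_eq_add_neg, ← mem_shift_iff, hshift]
  have hpos' : 0 < k.natAbs * n := Nat.mul_pos (Int.natAbs_pos.2 hk) hc.pos
  refine ⟨fun z => ?_, fun z => ?_⟩
  · obtain ⟨l, hl⟩ := exists_mul_gt hpos' x z
    exact ⟨_, (add_mul_mem_iff_of_add_mem_iff hper x l).2 hx, hl⟩
  · obtain ⟨l, hl⟩ := exists_mul_lt hpos' x z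
    exact ⟨_, (add_mul_mem_iff_of_add_mem_iff hper x l).2 hx, hl⟩

/-- An infinite component supports a loop, so it has vertices on both borders. Its translate by `n`
is also unbounded on both sides; if distinct, it would pass below an outer vertex and above an inner
vertex, thus crossing it. -/
theorem isBlockShape (hc : IsPeriodicDerangement n c) (hA : IsCyclicCNoncrossing n c A) {U : Set ℤ}
    (hU : IsArcBlock A U) : IsBlockShape n c U := by
  by_cases hfin : U.Finite
  · exact Or.inl ⟨hfin, hU.nonempty⟩
  · right
    obtain ⟨hup, hdown⟩ := hA.unbounded hc hU hfin
    obtain ⟨f, hf, hUf⟩ := hU.isLoopSupport hA.hasDistinctEnds (fun x _ => hup x) fun x _ => hdown x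
    have hreal := hA.real_loops f hf
    rw [← hUf, Set.not_subset, Set.not_subset] at hreal
    obtain ⟨⟨y, hy, hyL⟩, ⟨x, hx, hxR⟩⟩ := hreal
    rw [hc.mem_Rbar_iff, not_not] at hxR
    refine ⟨fun i => ?_, ⟨x, hx, hxR⟩, ⟨y, hy, hc.mem_Rbar_iff.2 hyL⟩⟩
    have hV := hA.isArcBlock_shift hU 1
    have hVU : shift n 1 U = U := by
      by_contra hne
      have hbd : ∀ z : ℤ, ∃ a ∈ shift n 1 U, ∃ b ∈ shift n 1 U, a < z ∧ z < b := by
        intro z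
        obtain ⟨a, ha, ha'⟩ := hdown (z - 1 * n)
        obtain ⟨b, hb, hb'⟩ := hup (z - 1 * n)
        exact ⟨_, add_mul_mem_shift_iff.2 ha, _, add_mul_mem_shift_iff.2 hb, by omega, by omega⟩
      exact hA.not_cross hc hU hV (Ne.symm hne)
        ⟨⟨x, Or.inl ⟨hx, hxR, hbd x⟩⟩, ⟨y, Or.inr ⟨hy, hyL, hbd y⟩⟩⟩
    have := add_mul_mem_shift_iff (n := n) (k := 1) (U := U) (x := i)
    rwa [hVU, one_mul] at this

theorem isBlockPartition (hc : IsPeriodicDerangement n c) (hA : IsCyclicCNoncrossing n c A) :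
    IsBlockPartition n c {U | IsArcBlock A U} where
  shape := fun _ hU => hA.isBlockShape hc hU
  covers := fun i => hA.hasDistinctEnds.exists_isArcBlock i
  disjoint := fun _ hU _ hV h => IsArcBlock.disjoint hU hV h
  not_cross := fun _ hU _ hV h => hA.not_cross hc hU hV h
  shift_mem := fun _ hU k => hA.isArcBlock_shift hU k

theorem arcsOf_isArcBlock (hc : IsPeriodicDerangement n c) (hA : IsCyclicCNoncrossing n c A) :
    arcsOf c {U | IsArcBlock A U} = A := by
  ext α
  constructor
  · rintro ⟨⟨U, hU, hp, hq, h⟩, hL, hR⟩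
    obtain ⟨β, hβ, h1, h2⟩ := IsArcBlock.step hU _ hp _ hq α.lt h
    rwa [Arc.ext_of_subset hc hL hR (hA.left_sub β hβ) (hA.right_sub β hβ) h1.symm h2.symm]
  · intro hα
    obtain ⟨U, hU, hp⟩ := hA.hasDistinctEnds.exists_isArcBlock α.p
    have hst : Step A α.p α.q := ⟨α, hα, rfl, rfl⟩
    exact ⟨⟨U, hU, hp, (hU.closed _ _ hst).1 hp, hU.not_between hA.hasDistinctEnds hp hst⟩,
      hA.left_sub α hα, hA.right_sub α hα⟩

end IsCyclicCNoncrossing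

/-- The construction of arc diagrams is a bijection. -/
theorem bijOn_arcDiagram (hc : IsPeriodicDerangement n c) :
    Set.BijOn (arcDiagram n c) {P | IsNoncrossingPartition n c P}
      {A | IsCyclicCNoncrossing n c A} := by
  refine ⟨?_, ?_, ?_⟩
  · intro P hP
    rw [Set.mem_ofPred_eq, arcDiagram_eq]
    exact (IsNoncrossingPartition.isBlockPartition hc hP).isCyclicCNoncrossing hc
  · intro P hP Q hQ hPQ
    have hPB := IsNoncrossingPartition.isBlockPartition hc hP
    have hQB := IsNoncrossingPartition.isBlockPartition hc hQ
    have : blocks n c P = blocks n c Q := by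
      ext U
      rw [hPB.mem_iff_isArcBlock hc, hQB.mem_iff_isArcBlock hc, ← arcDiagram_eq, ← arcDiagram_eq,
        hPQ]
    rw [← IsNoncrossingPartition.image_polygon_blocks hP,
      ← IsNoncrossingPartition.image_polygon_blocks hQ, this]
  · intro A hA
    have hB := IsCyclicCNoncrossing.isBlockPartition hc hA
    refine ⟨_, hB.isNoncrossingPartition hc, ?_⟩
    rw [arcDiagram_eq, hB.blocks_image_polygon hc, IsCyclicCNoncrossing.arcsOf_isArcBlock hc hA]

theorem isChainSupport_arcDiagram_iff (hc : IsPeriodicDerangement n c) {P : Set (Set (Annulus n))}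
    (hP : IsNoncrossingPartition n c P) (U : Set ℤ) :
    IsChainSupport (arcDiagram n c P) U ↔
      IsDiskVertexSet n c U ∧ ∃ E ∈ P, U ∈ part n c E := by
  have hB := hP.isBlockPartition hc
  rw [arcDiagram_eq, hB.isChainSupport_iff hc, and_comm]
  exact and_congr_left fun hU => ⟨hB.isDiskVertexSet hc hU, fun h => h.1⟩

theorem isLoopSupport_arcDiagram_iff (hc : IsPeriodicDerangement n c) {P : Set (Set (Annulus n))}
    (hP : IsNoncrossingPartition n c P) (U : Set ℤ) :
    IsLoopSupport (arcDiagram n c P) U ↔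
      IsAnnularVertexSet n c U ∧ ∃ E ∈ P, U ∈ part n c E := by
  have hB := hP.isBlockPartition hc
  rw [arcDiagram_eq, hB.isLoopSupport_iff hc, and_comm]
  exact and_congr_left fun hU => ⟨hB.isAnnularVertexSet hU, fun h => h.infinite hc.pos⟩

end

/-! ### The next vertex of a polygon -/

/-- `j` is the vertex after `i` on the boundary of the polygon with vertex set `U`. -/
def NextIn (c : Equiv.Perm ℤ) (U : Set ℤ) (i j : ℤ) : Prop :=
  j ∈ U ∧ (j = i → U = {i}) ∧
    ∀ u ∈ U, WeaklyRight (klein (vertex c i)) (klein (vertex c j)) (klein (vertex c u))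

/-- The orientation determinant of three points of the circle is the Vandermonde product of their
parameters times a positive factor. -/
theorem weaklyRight_iff {c : Equiv.Perm ℤ} {i j u : ℤ} :
    WeaklyRight (klein (vertex c i)) (klein (vertex c j)) (klein (vertex c u)) ↔
      (param c j - param c i) * (param c u - param c i) * (param c u - param c j) ≤ 0 := by
  have key : ∀ a b x : ℝ, ((circ b).1 - (circ a).1) * ((circ x).2 - (circ a).2) -
      ((circ b).2 - (circ a).2) * ((circ x).1 - (circ a).1) =
      (b - a) * (x - a) * (x - b) * (4 / ((1 + a ^ 2) * (1 + b ^ 2) * (1 + x ^ 2))) := by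
    intro a b x
    have d1 : 1 + a ^ 2 ≠ 0 := by positivity
    have d2 : 1 + b ^ 2 ≠ 0 := by positivity
    have d3 : 1 + x ^ 2 ≠ 0 := by positivity
    simp only [circ]
    field_simp
    ring
  rw [WeaklyRight, klein_vertex, klein_vertex, klein_vertex, key,
    ← not_lt, mul_pos_iff_of_pos_right (by positivity), not_lt]

section

variable {n : ℕ} {c : Equiv.Perm ℤ} {U : Set ℤ}

theorem nextIn_iff {i j : ℤ} : NextIn c U i j ↔ j ∈ U ∧ (j = i → U = {i}) ∧
    ∀ u ∈ U, (param c j - param c i) * (param c u - param c i) * (param c u - param c j) ≤ 0 := by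
  simp only [NextIn, weaklyRight_iff]

/-- For two candidates, the inequality of each evaluated at the other gives opposite signs to the
same product, which therefore vanishes. -/
theorem NextIn.unique {i j j' : ℤ} (h : NextIn c U i j) (h' : NextIn c U i j') : j = j' := by
  rw [nextIn_iff] at h h'
  obtain ⟨hj, h1, h2⟩ := h
  obtain ⟨hj', h1', h2'⟩ := h'
  by_cases e : U = {i}
  · rw [e, Set.mem_singleton_iff] at hj hj'
    rw [hj, hj']
  · have d : param c j - param c i ≠ 0 :=
      sub_ne_zero.2 fun h => e (h1 (param_injective c h))
    have d' : param c j' - param c i ≠ 0 :=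
      sub_ne_zero.2 fun h => e (h1' (param_injective c h))
    have h3 := h2 j' hj'
    have h4 := h2' j hj
    have h5 : (param c j - param c i) * (param c j' - param c i) * (param c j' - param c j) = 0 := by
      linarith
    have h6 := (mul_eq_zero.1 h5).resolve_left (mul_ne_zero d d')
    exact param_injective c (sub_eq_zero.1 h6).symm

theorem NextIn.shift (hc : IsPeriodicDerangement n c) {i j : ℤ} (h : NextIn c U i j) (k : ℤ) :
    NextIn c (shift n k U) (i + k * n) (j + k * n) := by
  rw [nextIn_iff] at h ⊢
  obtain ⟨hj, h1, h2⟩ := h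
  refine ⟨add_mul_mem_shift_iff.2 hj, fun e => ?_, ?_⟩
  · rw [h1 (by simpa using e), CNC.shift, Set.image_singleton]
  · rintro _ ⟨u, hu, rfl⟩
    simp only [param_add_mul hc]
    -- Translation multiplies all parameters by one positive factor, so the product of three
    -- differences is multiplied by its cube.
    have := mul_nonpos_of_nonneg_of_nonpos (a := Real.exp (-(k * n : ℝ)) ^ 3) (by positivity)
      (h2 u hu)
    nlinarith

/-- The generic step of a clockwise walk, to the next smaller parameter. -/
theorem nextIn_of_param_lt {i j : ℤ} (hj : j ∈ U) (hlt : param c j < param c i)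
    (h : ∀ u ∈ U, param c i ≤ param c u ∨ param c u ≤ param c j) : NextIn c U i j := by
  rw [nextIn_iff]
  refine ⟨hj, fun e => absurd hlt (by simp [e]), fun u hu => ?_⟩
  rw [mul_assoc]
  apply mul_nonpos_of_nonpos_of_nonneg (by linarith)
  rcases h u hu with h | h
  · exact mul_nonneg (by linarith) (by linarith)
  · exact mul_nonneg_of_nonpos_of_nonpos (by linarith) (by linarith)

/-- The closing step of a clockwise walk, from the smallest parameter back to the largest; it
includes one-point polygons. -/
theorem nextIn_of_forall_le {i j : ℤ} (hi : i ∈ U) (hj : j ∈ U)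
    (h : ∀ u ∈ U, param c i ≤ param c u ∧ param c u ≤ param c j) : NextIn c U i j := by
  rw [nextIn_iff]
  refine ⟨hj, fun e => ?_, fun u hu => ?_⟩
  · subst e
    ext u
    rw [Set.mem_singleton_iff]
    exact ⟨fun hu => param_injective c ((h u hu).2.antisymm (h u hu).1), fun e => e ▸ hi⟩
  · have := h u hu
    exact mul_nonpos_of_nonneg_of_nonpos (mul_nonneg (by linarith) (by linarith)) (by linarith)

/-! ### Elementary divisors -/

theorem mem_increasing {S : Set ℤ} (hS : S.Finite) {x : ℤ} : x ∈ increasing S ↔ x ∈ S := by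
  rw [increasing, dif_pos hS]
  simp

theorem mem_of_mem_increasing {S : Set ℤ} {x : ℤ} (h : x ∈ increasing S) : x ∈ S := by
  by_cases hS : S.Finite
  · exact (mem_increasing hS).1 h
  · simp [increasing, hS] at h

theorem increasing_pairwise (S : Set ℤ) : (increasing S).Pairwise (· < ·) := by
  by_cases hS : S.Finite
  · rw [increasing, dif_pos hS]
    exact (Finset.sortedLT_sort _).pairwise
  · simp [increasing, hS]

/-- A cycle without shift which goes clockwise sends each vertex to the next one. -/
theorem nextIn_affineCycle {l : List ℤ} (hl : l.Pairwise (fun x y => ¬ x ≡ y [ZMOD n]))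
    (hdec : l.Pairwise (fun x y => param c y < param c x)) {i : ℤ} (hi : i ∈ l) :
    NextIn c {x | x ∈ l} i (affineCycle n l 0 i) := by
  obtain ⟨k, hk, rfl⟩ := List.getElem_of_mem hi
  have hdec' := List.pairwise_iff_getElem.1 hdec
  have hle : ∀ (a b : ℕ) (ha : a < l.length) (hb : b < l.length), a ≤ b →
      param c l[b] ≤ param c l[a] := by
    intro a b ha hb hab
    rcases hab.eq_or_lt with rfl | hab
    · exact le_rfl
    · exact (hdec' a b ha hb hab).le
  have h0 : 0 < l.length := by omega
  rw [affineCycle_apply_of_modEq 0 hl hk (by rw [List.getD_eq_getElem _ _ hk]),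
    List.getD_eq_getElem _ _ hk, sub_self, zero_add, zero_mul, add_zero]
  by_cases hk' : k + 1 < l.length
  · rw [List.getD_eq_getElem _ _ hk']
    refine nextIn_of_param_lt (List.getElem_mem hk') (hdec' _ _ hk hk' (by omega)) ?_
    intro u hu
    obtain ⟨m, hm, rfl⟩ := List.getElem_of_mem hu
    rcases le_or_gt m k with h | h
    · exact Or.inl (hle _ _ hm hk h)
    · exact Or.inr (hle _ _ hk' hm h)
  -- After the last entry, the default value of `getD` is the first entry, the shift being `0`.
  · rw [List.getD_eq_default _ _ (by omega), List.getD_eq_getElem _ _ h0]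
    refine nextIn_of_forall_le hi (List.getElem_mem h0) fun u hu => ?_
    obtain ⟨m, hm, rfl⟩ := List.getElem_of_mem hu
    exact ⟨hle _ _ hm hk (by omega), hle _ _ h0 hm (by omega)⟩

/-- Outer vertices from left to right, then inner vertices from right to left, is the order of
decreasing parameters. The condition on residues ensures that `affineCycle` is a genuine cycle and
not its default value `1`. -/
theorem nextIn_elementaryDivisor_of_finite (hc : IsPeriodicDerangement n c) (hU : U.Finite)
    (hmod : ∀ x ∈ U, ∀ y ∈ U, x ≡ y [ZMOD n] → x = y) {i : ℤ} (hi : i ∈ U) :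
    NextIn c U i (elementaryDivisor n c U i) := by
  rw [elementaryDivisor, if_pos hU]
  set l := increasing (U ∩ Lbar c) ++ (increasing (U ∩ Rbar c)).reverse with hl
  have hmem : ∀ x, x ∈ l ↔ x ∈ U := by
    intro x
    rw [hl, List.mem_append, List.mem_reverse, mem_increasing (hU.subset Set.inter_subset_left),
      mem_increasing (hU.subset Set.inter_subset_left), Set.mem_inter_iff, Set.mem_inter_iff,
      hc.mem_Rbar_iff]
    tauto
  have hdec : l.Pairwise (fun x y => param c y < param c x) := by
    rw [hl, List.pairwise_append]
    refine ⟨(increasing_pairwise _).imp_of_mem ?_,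
      List.pairwise_reverse.2 ((increasing_pairwise _).imp_of_mem ?_), ?_⟩
    · intro a b ha hb hab
      have h1 := (mem_of_mem_increasing ha).2
      have h2 := (mem_of_mem_increasing hb).2
      rw [param_lt_param_iff]
      tauto
    · intro a b ha hb hab
      have h1 := hc.mem_Rbar_iff.1 (mem_of_mem_increasing ha).2
      have h2 := hc.mem_Rbar_iff.1 (mem_of_mem_increasing hb).2
      rw [param_lt_param_iff]
      tauto
    · intro a ha b hb
      have h1 := (mem_of_mem_increasing ha).2
      have h2 := hc.mem_Rbar_iff.1 (mem_of_mem_increasing (List.mem_reverse.1 hb)).2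
      rw [param_lt_param_iff]
      tauto
  have hnc : l.Pairwise (fun x y => ¬ x ≡ y [ZMOD n]) := by
    refine hdec.imp_of_mem fun {a b} ha hb hab h => ?_
    rw [hmod a ((hmem a).1 ha) b ((hmem b).1 hb) h] at hab
    exact lt_irrefl _ hab
  have := nextIn_affineCycle hnc hdec ((hmem i).2 hi)
  rwa [show {x | x ∈ l} = U from Set.ext hmem] at this

theorem eq_of_modEq_of_mem_Icc {x y : ℤ} (hx : x ∈ Set.Icc (1 : ℤ) n) (hy : y ∈ Set.Icc (1 : ℤ) n)
    (h : x ≡ y [ZMOD n]) : x = y := by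
  obtain ⟨k, rfl⟩ := modEq_iff_exists_add_mul.1 h
  obtain ⟨h1, h2⟩ := hx
  obtain ⟨h3, h4⟩ := hy
  have hk : k = 0 := by
    by_contra hk
    rcases lt_or_gt_of_ne hk with hk | hk <;> nlinarith
  simp [hk]

theorem exists_eq_add_mul_of_pos (hn : 0 < n) (x : ℤ) :
    ∃ y ∈ Set.Icc (1 : ℤ) n, ∃ k : ℤ, x = y + k * n := by
  have hpos : (0 : ℤ) < n := by exact_mod_cast hn
  refine ⟨(x - 1) % n + 1, ⟨?_, ?_⟩, (x - 1) / n, ?_⟩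
  · have := Int.emod_nonneg (x - 1) hpos.ne'
    omega
  · have := Int.emod_lt_of_pos (x - 1) hpos
    omega
  · have := Int.emod_add_mul_ediv (x - 1) n
    linarith

theorem increasing_inter_Icc_pairwise (S : Set ℤ) :
    (increasing (S ∩ Set.Icc 1 n)).Pairwise (fun x y => ¬ x ≡ y [ZMOD n]) := by
  refine (increasing_pairwise _).imp_of_mem fun {a b} ha hb hab h => ?_
  exact hab.ne (eq_of_modEq_of_mem_Icc (mem_of_mem_increasing ha).2 (mem_of_mem_increasing hb).2 h)

/-- A cycle of shift `1` sends each element of a periodic set to the next one. -/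
theorem affineCycle_increasing_apply {S : Set ℤ} (hn : 0 < n) (hS : ∀ i : ℤ, i + n ∈ S ↔ i ∈ S)
    {i : ℤ} (hi : i ∈ S) :
    affineCycle n (increasing (S ∩ Set.Icc 1 n)) 1 i ∈ S ∧
      i < affineCycle n (increasing (S ∩ Set.Icc 1 n)) 1 i ∧
        ∀ s ∈ S, ¬ (i < s ∧ s < affineCycle n (increasing (S ∩ Set.Icc 1 n)) 1 i) := by
  have hper := add_mul_mem_iff_of_add_mem_iff hS
  have hl := increasing_inter_Icc_pairwise (n := n) S
  have hlt := increasing_pairwise (S ∩ Set.Icc 1 n)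
  have hmem : ∀ x, x ∈ increasing (S ∩ Set.Icc 1 n) ↔ x ∈ S ∧ 1 ≤ x ∧ x ≤ n := fun x =>
    mem_increasing ((Set.finite_Icc _ _).subset Set.inter_subset_right)
  set l := increasing (S ∩ Set.Icc 1 n)
  obtain ⟨y, hy, p, rfl⟩ := exists_eq_add_mul_of_pos hn i
  rw [hper] at hi
  rw [affineCycle_add_mul]
  suffices h : affineCycle n l 1 y ∈ S ∧ y < affineCycle n l 1 y ∧
      ∀ s ∈ S, ¬ (y < s ∧ s < affineCycle n l 1 y) by
    refine ⟨(hper _ _).2 h.1, by omega, fun s hs h' => h.2.2 (s - p * n) ?_ (by omega)⟩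
    rw [← hper _ p, sub_add_cancel]
    exact hs
  obtain ⟨k, hk, rfl⟩ := List.getElem_of_mem ((hmem y).2 ⟨hi, hy⟩)
  have hlt' := List.pairwise_iff_getElem.1 hlt
  have hle : ∀ (a b : ℕ) (ha : a < l.length) (hb : b < l.length), a ≤ b → l[a] ≤ l[b] := by
    intro a b ha hb hab
    rcases hab.eq_or_lt with rfl | hab
    · exact le_rfl
    · exact (hlt' a b ha hb hab).le
  have h0 : 0 < l.length := by omega
  rw [affineCycle_apply_of_modEq 1 hl hk (by rw [List.getD_eq_getElem _ _ hk]),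
    List.getD_eq_getElem _ _ hk, sub_self, zero_add, one_mul]
  by_cases hk' : k + 1 < l.length
  · rw [List.getD_eq_getElem _ _ hk']
    have hk1 := (hmem _).1 (List.getElem_mem hk')
    refine ⟨hk1.1, hlt' _ _ hk hk' (by omega), fun s hs h => ?_⟩
    obtain ⟨m, hm, rfl⟩ := List.getElem_of_mem ((hmem s).2 ⟨hs, by have := hy.1; omega, by omega⟩)
    rcases le_or_gt m k with h' | h'
    · have := hle _ _ hm hk h'
      omega
    · have := hle _ _ hk' hm h'
      omega
  -- The last element of the window `[1, n]` goes to the first one translated by `n`, which is the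
  -- default value for shift `1`; a candidate beyond `n` is brought back into the window.
  · rw [List.getD_eq_default _ _ (by omega), List.getD_eq_getElem _ _ h0]
    have h00 := (hmem _).1 (List.getElem_mem h0)
    refine ⟨(hS _).2 h00.1, by have := hy.2; omega, fun s hs h => ?_⟩
    by_cases hsn : s ≤ n
    · obtain ⟨m, hm, rfl⟩ := List.getElem_of_mem ((hmem s).2 ⟨hs, by have := hy.1; omega, hsn⟩)
      have := hle _ _ hm hk (by omega)
      omega
    · obtain ⟨m, hm, hms⟩ := List.getElem_of_mem ((hmem (s - n)).2
        ⟨by rw [← hS, sub_add_cancel]; exact hs, by omega, by omega⟩)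
      have := hle _ _ h0 hm (by omega)
      omega

/-- A cycle of shift `-1` sends each element of a periodic set to the previous one. -/
theorem affineCycle_reverse_increasing_apply {S : Set ℤ} (hn : 0 < n)
    (hS : ∀ i : ℤ, i + n ∈ S ↔ i ∈ S) {i : ℤ} (hi : i ∈ S) :
    affineCycle n (increasing (S ∩ Set.Icc 1 n)).reverse (-1) i ∈ S ∧
      affineCycle n (increasing (S ∩ Set.Icc 1 n)).reverse (-1) i < i ∧
        ∀ s ∈ S, ¬ (affineCycle n (increasing (S ∩ Set.Icc 1 n)).reverse (-1) i < s ∧ s < i) := by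
  have hper := add_mul_mem_iff_of_add_mem_iff hS
  have hl : (increasing (S ∩ Set.Icc 1 n)).reverse.Pairwise (fun x y => ¬ x ≡ y [ZMOD n]) :=
    List.pairwise_reverse.2 ((increasing_inter_Icc_pairwise (n := n) S).imp fun h h' => h h'.symm)
  have hlt : (increasing (S ∩ Set.Icc 1 n)).reverse.Pairwise (fun x y => y < x) :=
    List.pairwise_reverse.2 (increasing_pairwise (S ∩ Set.Icc 1 n))
  have hmem : ∀ x, x ∈ (increasing (S ∩ Set.Icc 1 n)).reverse ↔ x ∈ S ∧ 1 ≤ x ∧ x ≤ n := fun x =>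
    List.mem_reverse.trans (mem_increasing ((Set.finite_Icc _ _).subset Set.inter_subset_right))
  set l := (increasing (S ∩ Set.Icc 1 n)).reverse
  obtain ⟨y, hy, p, rfl⟩ := exists_eq_add_mul_of_pos hn i
  rw [hper] at hi
  rw [affineCycle_add_mul]
  suffices h : affineCycle n l (-1) y ∈ S ∧ affineCycle n l (-1) y < y ∧
      ∀ s ∈ S, ¬ (affineCycle n l (-1) y < s ∧ s < y) by
    refine ⟨(hper _ _).2 h.1, by omega, fun s hs h' => h.2.2 (s - p * n) ?_ (by omega)⟩
    rw [← hper _ p, sub_add_cancel]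
    exact hs
  obtain ⟨k, hk, rfl⟩ := List.getElem_of_mem ((hmem y).2 ⟨hi, hy⟩)
  have hlt' := List.pairwise_iff_getElem.1 hlt
  have hle : ∀ (a b : ℕ) (ha : a < l.length) (hb : b < l.length), a ≤ b → l[b] ≤ l[a] := by
    intro a b ha hb hab
    rcases hab.eq_or_lt with rfl | hab
    · exact le_rfl
    · exact (hlt' a b ha hb hab).le
  have h0 : 0 < l.length := by omega
  rw [affineCycle_apply_of_modEq (-1) hl hk (by rw [List.getD_eq_getElem _ _ hk]),
    List.getD_eq_getElem _ _ hk, sub_self, zero_add, neg_one_mul, ← sub_eq_add_neg]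
  by_cases hk' : k + 1 < l.length
  · rw [List.getD_eq_getElem _ _ hk']
    have hk1 := (hmem _).1 (List.getElem_mem hk')
    refine ⟨hk1.1, hlt' _ _ hk hk' (by omega), fun s hs h => ?_⟩
    obtain ⟨m, hm, rfl⟩ := List.getElem_of_mem ((hmem s).2 ⟨hs, by omega, by have := hy.2; omega⟩)
    rcases le_or_gt m k with h' | h'
    · have := hle _ _ hm hk h'
      omega
    · have := hle _ _ hk' hm h'
      omega
  · rw [List.getD_eq_default _ _ (by omega), List.getD_eq_getElem _ _ h0]
    have h00 := (hmem _).1 (List.getElem_mem h0)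
    refine ⟨by rw [← hS, sub_add_cancel]; exact h00.1, by have := hy.1; omega, fun s hs h => ?_⟩
    by_cases hsn : 1 ≤ s
    · obtain ⟨m, hm, rfl⟩ := List.getElem_of_mem ((hmem s).2 ⟨hs, hsn, by have := hy.2; omega⟩)
      have := hle _ _ hm hk (by omega)
      omega
    · obtain ⟨m, hm, hms⟩ := List.getElem_of_mem ((hmem (s + n)).2
        ⟨(hS s).2 hs, by omega, by omega⟩)
      have := hle _ _ h0 hm (by omega)
      omega

/-- The two cycles act on different borders. Moving right on the outer border and left on the inner
one both decrease the parameter, and by periodicity there is always a next vertex, so no closing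
step occurs. -/
theorem nextIn_elementaryDivisor_of_annular (hc : IsPeriodicDerangement n c)
    (hU : IsAnnularVertexSet n c U) {i : ℤ} (hi : i ∈ U) :
    NextIn c U i (elementaryDivisor n c U i) := by
  have hinf := hU.infinite hc.pos
  have hperL : ∀ i : ℤ, i + n ∈ U ∩ Lbar c ↔ i ∈ U ∩ Lbar c := fun i => by
    have := hc.add_mul_mem_Lbar (i := i) (k := 1)
    rw [one_mul] at this
    rw [Set.mem_inter_iff, hU.1 i, this, Set.mem_inter_iff]
  have hperR : ∀ i : ℤ, i + n ∈ U ∩ Rbar c ↔ i ∈ U ∩ Rbar c := fun i => by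
    have := hc.add_mul_mem_Rbar (i := i) (k := 1)
    rw [one_mul] at this
    rw [Set.mem_inter_iff, hU.1 i, this, Set.mem_inter_iff]
  rw [elementaryDivisor, if_neg hinf, Equiv.Perm.mul_apply]
  by_cases hiL : i ∈ Lbar c
  · have hfix : affineCycle n (increasing (U ∩ Rbar c ∩ Set.Icc 1 n)).reverse (-1) i = i := by
      refine affineCycle_apply_of_forall_not_modEq _ fun a ha h => ?_
      have h1 := (mem_of_mem_increasing (List.mem_reverse.1 ha)).1.2
      obtain ⟨k, rfl⟩ := modEq_iff_exists_add_mul.1 h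
      rw [hc.add_mul_mem_Lbar] at hiL
      exact hc.mem_Rbar_iff.1 h1 hiL
    rw [hfix]
    obtain ⟨⟨h1, h2⟩, h3, h4⟩ := affineCycle_increasing_apply hc.pos hperL ⟨hi, hiL⟩
    refine nextIn_of_param_lt h1 (param_lt_param_iff.2 (by tauto)) fun u hu => ?_
    rw [← not_lt, ← not_lt, param_lt_param_iff, param_lt_param_iff]
    by_cases huL : u ∈ Lbar c
    · have := h4 u ⟨hu, huL⟩
      simp only [hiL, h2, huL, true_and, not_true, false_and, or_false, false_or]
      omega
    · tauto
  · obtain ⟨⟨h1, h2⟩, h3, h4⟩ := affineCycle_reverse_increasing_apply hc.pos hperR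
      ⟨hi, hc.mem_Rbar_iff.2 hiL⟩
    set j := affineCycle n (increasing (U ∩ Rbar c ∩ Set.Icc 1 n)).reverse (-1) i
    rw [hc.mem_Rbar_iff] at h2
    have hfix : affineCycle n (increasing (U ∩ Lbar c ∩ Set.Icc 1 n)) 1 j = j := by
      refine affineCycle_apply_of_forall_not_modEq _ fun a ha h => ?_
      obtain ⟨k, hk⟩ := modEq_iff_exists_add_mul.1 h
      rw [hk, hc.add_mul_mem_Lbar] at h2
      exact h2 (mem_of_mem_increasing ha).1.2
    rw [hfix]
    refine nextIn_of_param_lt h1 (param_lt_param_iff.2 (by tauto)) fun u hu => ?_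
    rw [← not_lt, ← not_lt, param_lt_param_iff, param_lt_param_iff]
    by_cases huL : u ∈ Lbar c
    · tauto
    · have := h4 u ⟨hu, hc.mem_Rbar_iff.2 huL⟩
      simp only [hiL, h2, huL, true_and, not_false_eq_true, false_and, false_or]
      omega

theorem elementaryDivisor_add_mul (c : Equiv.Perm ℤ) (T : Set ℤ) (x k : ℤ) :
    elementaryDivisor n c T (x + k * n) = elementaryDivisor n c T x + k * n := by
  rw [elementaryDivisor]
  split_ifs
  · exact affineCycle_add_mul _ _ _ _ _
  · rw [Equiv.Perm.mul_apply, Equiv.Perm.mul_apply, affineCycle_add_mul, affineCycle_add_mul]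

theorem elementaryDivisor_apply_of_forall_not_mem (c : Equiv.Perm ℤ) {T : Set ℤ} {x : ℤ}
    (h : ∀ k : ℤ, x ∉ shift n k T) : elementaryDivisor n c T x = x := by
  have key : ∀ a ∈ T, ¬ a ≡ x [ZMOD n] := by
    intro a ha hax
    obtain ⟨k, rfl⟩ := modEq_iff_exists_add_mul.1 hax
    exact h k (add_mul_mem_shift_iff.2 ha)
  rw [elementaryDivisor]
  split_ifs
  · refine affineCycle_apply_of_forall_not_modEq _ fun a ha => key a ?_
    rcases List.mem_append.1 ha with ha | ha
    · exact (mem_of_mem_increasing ha).1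
    · exact (mem_of_mem_increasing (List.mem_reverse.1 ha)).1
  · have h1 : affineCycle n (increasing (T ∩ Rbar c ∩ Set.Icc 1 n)).reverse (-1) x = x :=
      affineCycle_apply_of_forall_not_modEq _ fun a ha =>
        key a (mem_of_mem_increasing (List.mem_reverse.1 ha)).1.1
    rw [Equiv.Perm.mul_apply, h1]
    exact affineCycle_apply_of_forall_not_modEq _ fun a ha => key a (mem_of_mem_increasing ha).1.1

end

/-! ### The sum condition for affine permutations -/

section

variable {n : ℕ} {c : Equiv.Perm ℤ}

/-- `σ` commutes with the translation by `n`. -/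
def IsPeriodicPerm (n : ℕ) (σ : Equiv.Perm ℤ) : Prop := ∀ k : ℤ, σ (k + n) = σ k + n

/-- The total displacement of `σ` over a period. -/
def displacement (n : ℕ) (σ : Equiv.Perm ℤ) : ℤ := ∑ k ∈ Finset.Icc (1 : ℤ) n, (σ k - k)

theorem IsPeriodicPerm.add_mul {σ : Equiv.Perm ℤ} (h : IsPeriodicPerm n σ) (x k : ℤ) :
    σ (x + k * n) = σ x + k * n := by
  induction k using Int.induction_on with
  | zero => simp
  | succ k ih =>
    rw [show x + (k + 1 : ℤ) * n = x + k * n + n by ring, h, ih]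
    ring
  | pred k ih =>
    have := h (x + (-k - 1 : ℤ) * n)
    rw [show x + (-k - 1 : ℤ) * n + n = x + -k * n by ring, ih] at this
    linarith

theorem IsPeriodicPerm.mul {σ τ : Equiv.Perm ℤ} (hσ : IsPeriodicPerm n σ)
    (hτ : IsPeriodicPerm n τ) : IsPeriodicPerm n (σ * τ) := fun k => by
  rw [Equiv.Perm.mul_apply, hτ, hσ, Equiv.Perm.mul_apply]

theorem isPeriodicPerm_affineCycle (n : ℕ) (l : List ℤ) (s : ℤ) :
    IsPeriodicPerm n (affineCycle n l s) := fun k => by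
  simpa using affineCycle_add_mul n l s k 1

theorem isPeriodicPerm_elementaryDivisor (n : ℕ) (c : Equiv.Perm ℤ) (T : Set ℤ) :
    IsPeriodicPerm n (elementaryDivisor n c T) := fun k => by
  simpa using elementaryDivisor_add_mul (n := n) c T k 1

/-- The sum of a periodic function over a period, computed on other representatives. -/
theorem sum_Icc_eq_sum_of_periodic {ι : Type*} (hn : 0 < n) (s : Finset ι) (f : ι → ℤ) (g : ℤ → ℤ)
    (hg : ∀ x k : ℤ, g (x + k * n) = g x) (hf : ∀ i ∈ s, ∀ j ∈ s, f i ≡ f j [ZMOD n] → i = j)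
    (h0 : ∀ x, (∀ i ∈ s, ¬ f i ≡ x [ZMOD n]) → g x = 0) :
    ∑ x ∈ Finset.Icc (1 : ℤ) n, g x = ∑ i ∈ s, g (f i) := by
  choose r hr hr' using exists_eq_add_mul_of_pos hn
  have hmod : ∀ x, r x ≡ x [ZMOD n] := fun x => modEq_iff_exists_add_mul.2 (hr' x)
  have hinj : Set.InjOn (fun i => r (f i)) s := fun i hi j hj h =>
    hf i hi j hj ((hmod _).symm.trans ((congrArg (· ≡ f j [ZMOD n]) h).mpr (hmod _)))
  have hsum : ∑ i ∈ s, g (f i) = ∑ x ∈ s.image fun i => r (f i), g x := by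
    rw [Finset.sum_image hinj]
    refine Finset.sum_congr rfl fun i _ => ?_
    obtain ⟨k, hk⟩ := hr' (f i)
    conv_lhs => rw [hk]
    exact hg _ _
  rw [hsum]
  symm
  apply Finset.sum_subset
  · intro x hx
    obtain ⟨i, -, rfl⟩ := Finset.mem_image.1 hx
    exact Finset.mem_Icc.2 (hr _)
  · intro x hx hx'
    refine h0 x fun i hi h => hx' (Finset.mem_image.2 ⟨i, hi, ?_⟩)
    exact eq_of_modEq_of_mem_Icc (hr _) (Finset.mem_Icc.1 hx) ((hmod _).trans h)

theorem displacement_mul (hn : 0 < n) {σ τ : Equiv.Perm ℤ} (hσ : IsPeriodicPerm n σ)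
    (hτ : IsPeriodicPerm n τ) :
    displacement n (σ * τ) = displacement n σ + displacement n τ := by
  -- The displacement `σ k - k` depends only on `k` modulo `n`, and `τ` permutes the residue
  -- classes.
  have h : ∑ k ∈ Finset.Icc (1 : ℤ) n, (σ k - k) =
      ∑ k ∈ Finset.Icc (1 : ℤ) n, (σ (τ k) - τ k) := by
    refine sum_Icc_eq_sum_of_periodic hn _ τ (fun k => σ k - k) ?_ ?_ ?_
    · intro x k
      simp only [hσ.add_mul]
      ring
    · intro i hi j hj h
      obtain ⟨k, hk⟩ := modEq_iff_exists_add_mul.1 h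
      rw [← hτ.add_mul] at hk
      exact eq_of_modEq_of_mem_Icc (Finset.mem_Icc.1 hi) (Finset.mem_Icc.1 hj)
        (modEq_iff_exists_add_mul.2 ⟨k, τ.injective hk⟩)
    · intro x hx
      obtain ⟨y, hy, k, hk⟩ := exists_eq_add_mul_of_pos hn (τ.symm x)
      refine absurd (modEq_iff_exists_add_mul.2 ⟨k, ?_⟩) (hx y (Finset.mem_Icc.2 hy))
      rw [← hτ.add_mul, ← hk, Equiv.apply_symm_apply]
  rw [displacement, displacement, displacement, h, ← Finset.sum_add_distrib]
  exact Finset.sum_congr rfl fun k _ => by rw [Equiv.Perm.mul_apply]; ring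

theorem displacement_affineCycle (hn : 0 < n) {l : List ℤ} {s : ℤ}
    (hl : l.Pairwise (fun x y => ¬ x ≡ y [ZMOD n])) (hne : l ≠ []) :
    displacement n (affineCycle n l s) = s * n := by
  -- Inside the list the default value is immaterial. Choosing `l.getD 0 0 + s * n` lets the sum of
  -- displacements telescope up to the index `l.length`, leaving `s * n`.
  have hget : ∀ i ∈ Finset.range l.length, l.getD i (l.getD 0 0 + s * n) = l.getD i 0 := by
    intro i hi
    rw [List.getD_eq_getElem _ _ (Finset.mem_range.1 hi),
      List.getD_eq_getElem _ _ (Finset.mem_range.1 hi)]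
  have h := sum_Icc_eq_sum_of_periodic hn (Finset.range l.length) (fun i => l.getD i 0)
    (fun k => affineCycle n l s k - k) (fun x k => by simp only [affineCycle_add_mul]; ring) (by
      intro i hi j hj hij
      rw [Finset.mem_range] at hi hj
      rw [List.getD_eq_getElem _ _ hi, List.getD_eq_getElem _ _ hj] at hij
      by_contra hne
      rcases lt_or_gt_of_ne hne with h | h
      · exact List.pairwise_iff_getElem.1 hl _ _ hi hj h hij
      · exact List.pairwise_iff_getElem.1 hl _ _ hj hi h hij.symm) (by
      intro x hx
      rw [affineCycle_apply_of_forall_not_modEq, sub_self]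
      intro a ha
      obtain ⟨i, hi, rfl⟩ := List.getElem_of_mem ha
      have := hx i (Finset.mem_range.2 hi)
      rwa [List.getD_eq_getElem _ _ hi] at this)
  rw [displacement, h]
  have h' : ∑ i ∈ Finset.range l.length, (affineCycle n l s (l.getD i 0) - l.getD i 0) =
      ∑ i ∈ Finset.range l.length,
        (l.getD (i + 1) (l.getD 0 0 + s * n) - l.getD i (l.getD 0 0 + s * n)) := by
    refine Finset.sum_congr rfl fun i hi => ?_
    rw [affineCycle_apply_of_modEq s hl (Finset.mem_range.1 hi) (Int.ModEq.refl _), hget i hi]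
    ring
  have hpos : 0 < l.length := List.length_pos_iff.2 hne
  rw [h', Finset.sum_range_sub fun i => l.getD i (l.getD 0 0 + s * n),
    List.getD_eq_default _ _ le_rfl, hget 0 (Finset.mem_range.2 hpos)]
  ring

theorem displacement_one (n : ℕ) : displacement n 1 = 0 := by
  simp [displacement]

/-- The cycles of shifts `1` and `-1` of an annular block compensate each other; both lists are
nonempty because the block has vertices on both borders. -/
theorem displacement_elementaryDivisor (hc : IsPeriodicDerangement n c) {T : Set ℤ}
    (hT : IsBlockShape n c T) : displacement n (elementaryDivisor n c T) = 0 := by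
  by_cases hfin : T.Finite
  · rw [elementaryDivisor, if_pos hfin]
    set l := increasing (T ∩ Lbar c) ++ (increasing (T ∩ Rbar c)).reverse
    by_cases hl : l.Pairwise (fun x y => ¬ x ≡ y [ZMOD n])
    · by_cases hne : l = []
      · have : affineCycle n [] 0 = 1 := by
          ext x
          exact affineCycle_apply_of_forall_not_modEq _ (by simp)
        rw [hne, this, displacement_one]
      · rw [displacement_affineCycle hc.pos hl hne, zero_mul]
    · rw [affineCycle, dif_neg hl, displacement_one]
  · obtain ⟨hper, ⟨x, hx, hxL⟩, ⟨y, hy, hyR⟩⟩ := hT.resolve_left fun h => hfin h.1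
    have hper' := add_mul_mem_iff_of_add_mem_iff hper
    rw [elementaryDivisor, if_neg hfin, displacement_mul hc.pos (isPeriodicPerm_affineCycle _ _ _)
      (isPeriodicPerm_affineCycle _ _ _), displacement_affineCycle hc.pos
      (increasing_inter_Icc_pairwise _), displacement_affineCycle hc.pos]
    · ring
    · exact List.pairwise_reverse.2 ((increasing_inter_Icc_pairwise _).imp fun h h' => h h'.symm)
    · obtain ⟨z, hz, k, rfl⟩ := exists_eq_add_mul_of_pos hc.pos y
      rw [Ne, List.reverse_eq_nil_iff]
      exact List.ne_nil_of_mem ((mem_increasing ((Set.finite_Icc _ _).subset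
        Set.inter_subset_right)).2 ⟨⟨(hper' _ _).1 hy, hc.add_mul_mem_Rbar.1 hyR⟩, hz⟩)
    · obtain ⟨z, hz, k, rfl⟩ := exists_eq_add_mul_of_pos hc.pos x
      exact List.ne_nil_of_mem ((mem_increasing ((Set.finite_Icc _ _).subset
        Set.inter_subset_right)).2 ⟨⟨(hper' _ _).1 hx, hc.add_mul_mem_Lbar.1 hxL⟩, hz⟩)

/-! ### Products of elementary divisors -/

theorem prod_map_apply_of_forall_fixed {ι : Type*} (f : ι → Equiv.Perm ℤ) (l : List ι) {x : ℤ}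
    (h : ∀ t ∈ l, f t x = x) : (l.map f).prod x = x := by
  induction l with
  | nil => rfl
  | cons a l ih =>
    rw [List.map_cons, List.prod_cons, Equiv.Perm.mul_apply,
      ih fun t ht => h t (List.mem_cons_of_mem _ ht), h a (by simp)]

/-- The factor `f t` preserves `U` and all others fix it pointwise, so the position of `f t` in the
product does not matter. -/
theorem prod_map_apply_of_mem {ι : Type*} (f : ι → Equiv.Perm ℤ) {l : List ι} (hl : l.Nodup)
    {t : ι} (ht : t ∈ l) {U : Set ℤ} (hU : ∀ x ∈ U, f t x ∈ U)
    (hfix : ∀ t' ∈ l, t' ≠ t → ∀ x ∈ U, f t' x = x) {x : ℤ} (hx : x ∈ U) :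
    (l.map f).prod x = f t x := by
  induction l with
  | nil => simp at ht
  | cons a l ih =>
    rw [List.nodup_cons] at hl
    rw [List.map_cons, List.prod_cons, Equiv.Perm.mul_apply]
    rcases List.mem_cons.1 ht with rfl | ht
    · rw [prod_map_apply_of_forall_fixed f l fun t' ht' => hfix t' (List.mem_cons_of_mem _ ht')
        (fun e => hl.1 (e ▸ ht')) x hx]
    · rw [ih hl.2 ht fun t' ht' => hfix t' (List.mem_cons_of_mem _ ht')]
      exact hfix a (by simp) (fun e => hl.1 (e ▸ ht)) _ (hU x hx)

/-- On each block of `B`, `σ` sends each point to the next one. -/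
def IsPermOfBlocks (c : Equiv.Perm ℤ) (B : Set (Set ℤ)) (σ : Equiv.Perm ℤ) : Prop :=
  ∀ U ∈ B, ∀ i ∈ U, NextIn c U i (σ i)

theorem isPermOf_iff {P : Set (Set (Annulus n))} {σ : Equiv.Perm ℤ} :
    IsPermOf n c P σ ↔ IsPermOfBlocks c (blocks n c P) σ := by
  constructor
  · rintro h U ⟨E, hE, hU⟩ i hi
    exact h E hE U hU i hi
  · intro h E hE U hU i hi
    exact h U ⟨E, hE, hU⟩ i hi

namespace IsBlockPartition

variable {B : Set (Set ℤ)}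

theorem isPermOfBlocks_unique (hB : IsBlockPartition n c B) {σ τ : Equiv.Perm ℤ}
    (hσ : IsPermOfBlocks c B σ) (hτ : IsPermOfBlocks c B τ) : σ = τ := by
  ext i
  obtain ⟨U, hU, hi⟩ := hB.covers i
  exact (hσ U hU i hi).unique (hτ U hU i hi)

theorem isNumbering_iff (hB : IsBlockPartition n c B) (hc : IsPeriodicDerangement n c)
    {Γ : List (Set ℤ)} : IsNumbering n (arcsOf c B) Γ ↔
      Γ.Nodup ∧ (∀ S ∈ Γ, S ∈ B) ∧ ∀ S ∈ B, ∃! T, T ∈ Γ ∧ ∃ k : ℤ, S = shift n k T := by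
  have h : ∀ S, IsChainSupport (arcsOf c B) S ∨ IsLoopSupport (arcsOf c B) S ↔ S ∈ B := by
    intro S
    rw [hB.isChainSupport_iff hc, hB.isLoopSupport_iff hc, ← and_or_left]
    exact and_iff_left S.finite_or_infinite
  simp only [IsNumbering, h]
  rfl

theorem nextIn_elementaryDivisor (hB : IsBlockPartition n c B) (hc : IsPeriodicDerangement n c)
    {U : Set ℤ} (hU : U ∈ B) {i : ℤ} (hi : i ∈ U) :
    NextIn c U i (elementaryDivisor n c U i) := by
  by_cases hfin : U.Finite
  · refine nextIn_elementaryDivisor_of_finite hc hfin (fun x hx y hy h => ?_) hi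
    obtain ⟨k, rfl⟩ := modEq_iff_exists_add_mul.1 h
    have h1 := hB.eq_of_mem (hB.shift_mem U hU k) hU (add_mul_mem_shift_iff.2 hx) hy
    by_cases hk : k = 0
    · simp [hk]
    · exact absurd h1 (shift_ne_self hc.pos hfin ⟨i, hi⟩ hk)
  · exact nextIn_elementaryDivisor_of_annular hc (hB.isAnnularVertexSet hU hfin) hi

/-- A divisor commutes with translations by multiples of `n`, so it performs the clockwise step on
all translates of its block, and it fixes the other blocks. Together with the uniqueness of the next
vertex, this makes the product independent of representatives and order. -/
theorem isPermOfBlocks_prod (hB : IsBlockPartition n c B) (hc : IsPeriodicDerangement n c)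
    {Γ : List (Set ℤ)} (hΓ : IsNumbering n (arcsOf c B) Γ) :
    IsPermOfBlocks c B (Γ.map (elementaryDivisor n c)).prod := by
  rw [hB.isNumbering_iff hc] at hΓ
  obtain ⟨hnd, hΓB, huniq⟩ := hΓ
  intro U hU i hi
  obtain ⟨T, ⟨hT, k, rfl⟩, hT'⟩ := huniq U hU
  have hnext : ∀ x ∈ shift n k T, NextIn c (shift n k T) x (elementaryDivisor n c T x) := by
    rintro _ ⟨x, hx, rfl⟩
    rw [elementaryDivisor_add_mul]
    exact (hB.nextIn_elementaryDivisor hc (hΓB T hT) hx).shift hc k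
  rw [prod_map_apply_of_mem (elementaryDivisor n c) hnd hT (fun x hx => (hnext x hx).1) ?_ hi]
  · exact hnext i hi
  · intro S hS hST x hx
    refine elementaryDivisor_apply_of_forall_not_mem c fun l hl => hST ?_
    exact hT' S ⟨hS, l, hB.eq_of_mem hU (hB.shift_mem S (hΓB S hS) l) hx hl⟩

theorem exists_isNumbering (hB : IsBlockPartition n c B) (hc : IsPeriodicDerangement n c) :
    ∃ Γ, IsNumbering n (arcsOf c B) Γ := by
  classical
  let s : Setoid (Set ℤ) :=
    { r := fun S T => ∃ k : ℤ, S = shift n k T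
      iseqv :=
        { refl := fun S => ⟨0, (shift_zero n S).symm⟩
          symm := by
            rintro S T ⟨k, rfl⟩
            exact ⟨-k, (shift_neg_shift n k T).symm⟩
          trans := by
            rintro S T W ⟨k, rfl⟩ ⟨l, rfl⟩
            exact ⟨k + l, shift_shift n k l W⟩ } }
  choose b hbB hb using hB.covers
  let rep : Set ℤ → Set ℤ := fun S => (Quotient.mk s S).out
  have hrep : ∀ S, ∃ k : ℤ, S = shift n k (rep S) := fun S =>
    s.symm (Quotient.exact (Quotient.out_eq (Quotient.mk s S)))
  have hrepB : ∀ S ∈ B, rep S ∈ B := by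
    intro S hS
    obtain ⟨k, hk⟩ := hrep S
    have := hB.shift_mem S hS (-k)
    rw [hk, shift_neg_shift] at this
    exact this
  have hrep_eq : ∀ {S T}, (∃ k : ℤ, S = shift n k T) → rep S = rep T := fun h =>
    congrArg Quotient.out (Quotient.sound (s := s) h)
  -- Every block has a translate containing one of `1, …, n`, so the representatives of the blocks
  -- of these points suffice, and they form a finite list.
  refine ⟨((Finset.Icc (1 : ℤ) n).image fun i => rep (b i)).toList, (hB.isNumbering_iff hc).2
    ⟨Finset.nodup_toList _, ?_, ?_⟩⟩
  · intro S hS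
    rw [Finset.mem_toList, Finset.mem_image] at hS
    obtain ⟨i, -, rfl⟩ := hS
    exact hrepB _ (hbB i)
  · intro S hS
    refine ⟨rep S, ⟨?_, hrep S⟩, ?_⟩
    · obtain ⟨x, hx⟩ := (hB.shape S hS).nonempty
      obtain ⟨i, hi, k, rfl⟩ := exists_eq_add_mul_of_pos hc.pos x
      rw [Finset.mem_toList, Finset.mem_image]
      exact ⟨i, Finset.mem_Icc.2 hi, (hrep_eq ⟨k, hB.eq_of_mem hS (hB.shift_mem _ (hbB i) k) hx
        (add_mul_mem_shift_iff.2 (hb i))⟩).symm⟩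
    · rintro T ⟨hT, hST⟩
      rw [Finset.mem_toList, Finset.mem_image] at hT
      obtain ⟨i, -, rfl⟩ := hT
      rw [hrep_eq hST]
      exact (hrep_eq (s.symm (hrep (b i)))).symm

theorem isAffinePermutation_prod (hB : IsBlockPartition n c B) (hc : IsPeriodicDerangement n c)
    {Γ : List (Set ℤ)} (hΓ : ∀ S ∈ Γ, S ∈ B) :
    IsAffinePermutation n (Γ.map (elementaryDivisor n c)).prod := by
  have key : IsPeriodicPerm n (Γ.map (elementaryDivisor n c)).prod ∧
      displacement n (Γ.map (elementaryDivisor n c)).prod = 0 := by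
    induction Γ with
    | nil => exact ⟨fun k => rfl, displacement_one n⟩
    | cons T Γ ih =>
      obtain ⟨h1, h2⟩ := ih fun S hS => hΓ S (List.mem_cons_of_mem _ hS)
      rw [List.map_cons, List.prod_cons, displacement_mul hc.pos
        (isPeriodicPerm_elementaryDivisor n c T) h1, h2,
        displacement_elementaryDivisor hc (hB.shape T (hΓ T (by simp)))]
      exact ⟨(isPeriodicPerm_elementaryDivisor n c T).mul h1, rfl⟩
  refine ⟨key.1, ?_⟩
  have := key.2
  rwa [displacement, Finset.sum_sub_distrib, sub_eq_zero] at this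

/-! ### Recovering a partition from its permutation -/

/-- A finite block is a single orbit. Every nonempty part of `U` stable under `σ` contains the
vertex `m` of smallest parameter, so `U ∩ S` and `U \ S` cannot both be nonempty. -/
theorem subset_of_forall_mem_iff {σ : Equiv.Perm ℤ} {U S : Set ℤ} (hU : U.Finite)
    (hσ : ∀ i ∈ U, NextIn c U i (σ i)) (hS : ∀ i ∈ U, i ∈ S ↔ σ i ∈ S) {i : ℤ} (hi : i ∈ U)
    (hiS : i ∈ S) : U ⊆ S := by
  obtain ⟨m, hm, hmin⟩ := Set.exists_min_image U (param c) hU ⟨i, hi⟩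
  have key : ∀ X ⊆ U, (∀ x ∈ X, σ x ∈ X) → X.Nonempty → m ∈ X := by
    intro X hXU hX hne
    obtain ⟨x, hx, hxmin⟩ := Set.exists_min_image X (param c) (hU.subset hXU) hne
    by_contra hmX
    have h1 : param c m < param c x := lt_of_le_of_ne (hmin x (hXU hx))
      fun e => hmX (param_injective c e ▸ hx)
    have h2 := hxmin _ (hX x hx)
    obtain ⟨-, h3, h4⟩ := nextIn_iff.1 (hσ x (hXU hx))
    rcases h2.eq_or_lt with h2 | h2
    · have h5 := h3 (param_injective c h2).symm
      rw [h5, Set.mem_singleton_iff] at hm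
      exact hmX (hm ▸ hx)
    -- The step from `x` to `σ x` raises the parameter, so a vertex with a parameter below that of
    -- `x` would lie strictly to its left.
    · have h6 := h4 m hm
      have h7 : 0 < (param c (σ x) - param c x) * (param c m - param c x) *
          (param c m - param c (σ x)) := by
        rw [mul_assoc]
        exact mul_pos (by linarith) (mul_pos_of_neg_of_neg (by linarith) (by linarith))
      linarith
  have h1 : m ∈ U ∩ S := key _ Set.inter_subset_left
    (fun x hx => ⟨(hσ x hx.1).1, (hS x hx.1).1 hx.2⟩) ⟨i, hi, hiS⟩
  intro j hj
  by_contra hjS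
  have h2 : m ∈ U \ S := key _ Set.sdiff_subset
    (fun x hx => ⟨(hσ x hx.1).1, fun h => hx.2 ((hS x hx.1).2 h)⟩) ⟨j, hj, hjS⟩
  exact h2.2 h1.2

theorem mem_iff_apply_mem (hB : IsBlockPartition n c B) {σ : Equiv.Perm ℤ}
    (hσ : IsPermOfBlocks c B σ) {U : Set ℤ} (hU : U ∈ B) (i : ℤ) : i ∈ U ↔ σ i ∈ U := by
  refine ⟨fun hi => (hσ U hU i hi).1, fun h => ?_⟩
  obtain ⟨V, hV, hi⟩ := hB.covers i
  rwa [hB.eq_of_mem hU hV h (hσ V hV i hi).1]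

/-- If `U'` were infinite it would contain the orbit `U`. At the vertex of `U` with smallest
parameter `σ` cannot go down, so no vertex of `U'` has a smaller parameter; but an annular block has
inner vertices of arbitrarily small parameter. -/
theorem finite_of_mem (hc : IsPeriodicDerangement n c) {B' : Set (Set ℤ)}
    (hB' : IsBlockPartition n c B') {σ : Equiv.Perm ℤ}
    (hσ : IsPermOfBlocks c B σ) (hσ' : IsPermOfBlocks c B' σ) {U U' : Set ℤ} (hU : U ∈ B)
    (hU' : U' ∈ B') {i : ℤ} (hi : i ∈ U) (hi' : i ∈ U') (hfin : U.Finite) : U'.Finite := by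
  by_contra hinf
  obtain ⟨hper, -, ⟨y, hy, hyR⟩⟩ := hB'.isAnnularVertexSet hU' hinf
  have hsub : U ⊆ U' := subset_of_forall_mem_iff hfin (hσ U hU)
    (fun j _ => hB'.mem_iff_apply_mem hσ' hU' j) hi hi'
  obtain ⟨m, hm, hmin⟩ := Set.exists_min_image U (param c) hfin ⟨i, hi⟩
  obtain ⟨-, h1, h2⟩ := nextIn_iff.1 (hσ' U' hU' m (hsub hm))
  have h3 := hmin _ (hσ U hU m hm).1
  rcases h3.eq_or_lt with h3 | h3
  · exact hinf (by rw [h1 (param_injective c h3).symm]; simp)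
  · have h4 : ∀ u ∈ U', param c m ≤ param c u := by
      intro u hu
      by_contra! h5
      have h6 := h2 u hu
      have h7 : 0 < (param c (σ m) - param c m) * (param c u - param c m) *
          (param c u - param c (σ m)) := by
        rw [mul_assoc]
        exact mul_pos (by linarith) (mul_pos_of_neg_of_neg (by linarith) (by linarith))
      linarith
    obtain ⟨k, hk⟩ := exists_mul_lt hc.pos y m
    have h5 := h4 _ ((add_mul_mem_iff_of_add_mem_iff hper y k).2 hy)
    rw [← not_lt, param_lt_param_iff] at h5
    rw [hc.mem_Rbar_iff] at hyR
    have h6 : y + k * n ∉ Lbar c := fun h => hyR (hc.add_mul_mem_Lbar.1 h)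
    tauto

/-- The orbit argument covers finite blocks only. The points of an infinite block lie in infinite
blocks of `B'`, and there is at most one of these. -/
theorem subset_of_isPermOfBlocks (hB : IsBlockPartition n c B) (hc : IsPeriodicDerangement n c)
    {B' : Set (Set ℤ)} (hB' : IsBlockPartition n c B') {σ : Equiv.Perm ℤ}
    (hσ : IsPermOfBlocks c B σ) (hσ' : IsPermOfBlocks c B' σ) {U U' : Set ℤ} (hU : U ∈ B)
    (hU' : U' ∈ B') {i : ℤ} (hi : i ∈ U) (hi' : i ∈ U') : U ⊆ U' := by
  by_cases hfin : U.Finite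
  · exact subset_of_forall_mem_iff hfin (hσ U hU)
      (fun j _ => hB'.mem_iff_apply_mem hσ' hU' j) hi hi'
  · intro j hj
    obtain ⟨V, hV, hjV⟩ := hB'.covers j
    have h1 : U'.Infinite := fun h => hfin (finite_of_mem hc hB hσ' hσ hU' hU hi' hi h)
    have h2 : V.Infinite := fun h => hfin (finite_of_mem hc hB hσ' hσ hV hU hjV hj h)
    rwa [hB'.eq_of_isAnnularVertexSet hc hU' hV (hB'.isAnnularVertexSet hU' h1)
      (hB'.isAnnularVertexSet hV h2)]

theorem eq_of_isPermOfBlocks (hB : IsBlockPartition n c B) (hc : IsPeriodicDerangement n c)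
    {B' : Set (Set ℤ)} (hB' : IsBlockPartition n c B') {σ : Equiv.Perm ℤ}
    (hσ : IsPermOfBlocks c B σ) (hσ' : IsPermOfBlocks c B' σ) : B = B' := by
  have key : ∀ {B B' : Set (Set ℤ)}, IsBlockPartition n c B → IsBlockPartition n c B' →
      IsPermOfBlocks c B σ → IsPermOfBlocks c B' σ → B ⊆ B' := by
    intro B B' hB hB' hσ hσ' U hU
    obtain ⟨i, hi⟩ := (hB.shape U hU).nonempty
    obtain ⟨V, hV, hiV⟩ := hB'.covers i
    rwa [(hB.subset_of_isPermOfBlocks hc hB' hσ hσ' hU hV hi hiV).antisymm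
      (hB'.subset_of_isPermOfBlocks hc hB hσ' hσ hV hU hiV hi)]
  exact (key hB hB' hσ hσ').antisymm (key hB' hB hσ' hσ)

theorem exists_isNC (hB : IsBlockPartition n c B) (hc : IsPeriodicDerangement n c) :
    ∃ σ, IsAffinePermutation n σ ∧ (∀ τ, IsNC n c (arcsOf c B) τ ↔ τ = σ) ∧
      IsPermOfBlocks c B σ := by
  obtain ⟨Γ, hΓ⟩ := hB.exists_isNumbering hc
  have hperm := hB.isPermOfBlocks_prod hc hΓ
  refine ⟨_, hB.isAffinePermutation_prod hc ((hB.isNumbering_iff hc).1 hΓ).2.1, fun τ => ?_, hperm⟩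
  constructor
  · rintro ⟨Γ', hΓ', rfl⟩
    exact hB.isPermOfBlocks_unique (hB.isPermOfBlocks_prod hc hΓ') hperm
  · exact fun h => ⟨Γ, hΓ, h⟩

end IsBlockPartition

/-! ### Back to polygons: the permutation of a partition and the inverse map -/

theorem existsUnique_isPermOf (hc : IsPeriodicDerangement n c) {P : Set (Set (Annulus n))}
    (hP : IsNoncrossingPartition n c P) : ∃! σ, IsPermOf n c P σ := by
  have hB := hP.isBlockPartition hc
  obtain ⟨σ, -, -, hσ⟩ := hB.exists_isNC hc
  exact ⟨σ, isPermOf_iff.2 hσ, fun τ hτ => hB.isPermOfBlocks_unique (isPermOf_iff.1 hτ) hσ⟩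

theorem IsCyclicCNoncrossing.exists_isNC (hc : IsPeriodicDerangement n c) {A : Set Arc}
    (hA : IsCyclicCNoncrossing n c A) :
    ∃ σ, IsAffinePermutation n σ ∧ (∀ τ, IsNC n c A τ ↔ τ = σ) ∧
      ∀ P, IsNoncrossingPartition n c P → (IsPermOf n c P σ ↔ arcDiagram n c P = A) := by
  have hB := hA.isBlockPartition hc
  obtain ⟨σ, h1, h2, h3⟩ := hB.exists_isNC hc
  rw [hA.arcsOf_isArcBlock hc] at h2
  refine ⟨σ, h1, h2, fun P hP => ?_⟩
  have hPB := hP.isBlockPartition hc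
  rw [isPermOf_iff, arcDiagram_eq]
  constructor
  · intro h
    rw [hPB.eq_of_isPermOfBlocks hc hB h h3, hA.arcsOf_isArcBlock hc]
  · intro h
    have : blocks n c P = {U | IsArcBlock A U} := by
      ext U
      rw [hPB.mem_iff_isArcBlock hc, h]
      rfl
    rwa [this]

end

end CNC

end

theorem mainTheorem7 (n : ℕ) (hn : 2 ≤ n) (c : Equiv.Perm ℤ) (hc : CNC.IsCoxeterElement n c) :
    -- the construction is a bijection
    Set.BijOn (CNC.arcDiagram n c)
      {P | CNC.IsNoncrossingPartition n c P} {A | CNC.IsCyclicCNoncrossing n c A} ∧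
    -- the lifts of disk polygons become the chains, the annular polygons become the loops
    (∀ P, CNC.IsNoncrossingPartition n c P → ∀ U : Set ℤ,
      (CNC.IsChainSupport (CNC.arcDiagram n c P) U ↔
        CNC.IsDiskVertexSet n c U ∧ ∃ E ∈ P, U ∈ CNC.part n c E) ∧
      (CNC.IsLoopSupport (CNC.arcDiagram n c P) U ↔
        CNC.IsAnnularVertexSet n c U ∧ ∃ E ∈ P, U ∈ CNC.part n c E)) ∧
    -- the permutation of a partition of the annulus is well defined
    (∀ P, CNC.IsNoncrossingPartition n c P → ∃! σ, CNC.IsPermOf n c P σ) ∧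
    -- the inverse map, as a product of elementary divisors
    (∀ A, CNC.IsCyclicCNoncrossing n c A →
      ∃ σ, CNC.IsAffinePermutation n σ ∧ (∀ τ, CNC.IsNC n c A τ ↔ τ = σ) ∧
        ∀ P, CNC.IsNoncrossingPartition n c P →
          (CNC.IsPermOf n c P σ ↔ CNC.arcDiagram n c P = A)) := by
  have h := hc.isPeriodicDerangement hn
  exact ⟨CNC.bijOn_arcDiagram h,
    fun P hP U => ⟨CNC.isChainSupport_arcDiagram_iff h hP U, CNC.isLoopSupport_arcDiagram_iff h hP U⟩,
    fun P hP => CNC.existsUnique_isPermOf h hP, fun A hA => hA.exists_isNC h⟩
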